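/- **Conventions.** Let $\rho(M)$ be the spectral radius of a matrix $M$. Let $A_0,A_1$ be real $2\times2$ matrices and, for $\alpha\ge 0$, put $A_0^{(\alpha)}:=A_0$, $A_1^{(\alpha)}:=\alpha A_1$. The joint spectral radius is $$\varrho(\alpha):=\lim_{n\to\infty}\max\bigl\{\|A^{(\alpha)}_{i_n}\cdots A^{(\alpha)}_{i_1}\|^{1/n} : i_1,\dots,i_n\in\{0,1\}\bigr\}.$$ For a finite word $u=u_1\cdots u_m$ in $\{0,1\}$ put $\mathcal A_\alpha(u):=A^{(\alpha)}_{u_m}\cdots A^{(\alpha)}_{u_1}$ and $\mathcal A(u):=\mathcal A_1(u)$; write $|u|=m$ for its length, $|u|_1$ for its number of $1$s, and, if $u$ is nonempty, $\varsigma(u):=|u|_1/|u|$. A sequence $x\in\{0,1\}^{\mathbb N}$ is *weakly extremal* for $\alpha$ if $\|A^{(\alpha)}_{x_n}\cdots A^{(\alpha)}_{x_1}\|^{1/n}\to\varrho(\alpha)$. A word is *balanced* if $\bigl||v_1|_1-|v_2|_1\bigr|\le1$ for all subwords (contiguous factors) $v_1,v_2$ of it of equal length, and *cyclically balanced* if all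 its cyclic permutations are balanced. For $\gamma\in[0,1]$ let $X_\gamma$ be the set of sequences $x$ for which there is $\delta\in\mathbb R$ with either $x_n=\lfloor\gamma(n+1)+\delta\rfloor-\lfloor\gamma n+\delta\rfloor$ for all $n$ or $x_n=\lceil\gamma(n+1)+\delta\rceil-\lceil\gamma n+\delta\rceil$ for all $n$. *Standard pairs* form the smallest set of pairs of words that contains $(0,1)$ and contains $(uv,v)$ and $(u,vu)$ whenever it contains $(u,v)$. **Hypotheses.** *Technical hypotheses:* $A_0,A_1$ have non-negative entries, are invertible, have positive trace, and have no common invariant subspace other than $\{0\}$ and $\mathbb R^2$; and $\mathcal A(u)$ has positive entries for every finite word $u$ that is not of the form $0^n$ or $1^n$. *Sturmian hypothesis:* there is a function $\mathfrak r:[0,\infty)\to[0,1]$ (necessarily unique, called the $1$-ratio function) such that for every $\alpha\ge0$: every $x\in X_{\mathfrak r(\alpha)}$ is weakly extremal for $\alpha$; every $x$ weakly extremal for $\alpha$ satisfies $\frac1n\#\{1\le i\le n: x_i=1\}\to\mathfrak r(\alpha)$; and $\rho(\mathcal A_\alpha(u))<\varrho(\alpha)^{|u|}$ for every finite word $u$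 that is not cyclically balanced. **Theorem 2.3.** Let $A_0,A_1$ satisfy the technical hypotheses and the Sturmian hypothesis, with $1$-ratio function $\mathfrak r$. Then: (i) $\mathfrak r$ is continuous and non-decreasing, $\mathfrak r(0)=0$, and $\lim_{\alpha\to\infty}\mathfrak r(\alpha)=1$. (ii) For every rational $\gamma\in(0,1)$ the set $\mathfrak r^{-1}(\gamma)$ is a closed bounded interval with nonempty interior. The set $\mathfrak r^{-1}(0)\cap(0,\infty)$ is nonempty if and only if $A_0$ is diagonalisable, and $\mathfrak r^{-1}(1)$ is nonempty if and only if $A_1$ is diagonalisable. If $A_0$ is diagonalisable, then $P_0:=\lim_{n\to\infty}\rho(A_0)^{-n}A_0^n$ exists and $$\mathfrak r^{-1}(0)=\left[0,\frac{\rho(A_0)}{\rho(P_0A_1)}\right];$$ if $A_1$ is diagonalisable, then $P_1:=\lim_{n\to\infty}\rho(A_1)^{-n}A_1^n$ exists and $$\mathfrak r^{-1}(1)=\left[\frac{\rho(P_1A_0)}{\rho(A_1)},\infty\right).$$ Let $p/q\in(0,1)$ be in least terms. Then there is a standard pair $(u,v)$ with $\varsigma(uv)=p/q$. For every such pair, put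 $q_1:=|u|$, $q_2:=|v|$, $B_1:=\mathcal A(u)$, $B_2:=\mathcal A(v)$ and $A:=B_1B_2$. Then $A$ has positive entries, the limit $P:=\lim_{n\to\infty}\rho(A)^{-n}A^n$ exists, $$\mathfrak r^{-1}(p/q)=\left[\frac{\rho(B_1P)^q}{\rho(A)^{q_1}},\ \frac{\rho(A)^{q_2}}{\rho(PB_2)^q}\right],$$ and $\varrho(\alpha)=\rho(\mathcal A_\alpha(uv))^{1/q}$ for every $\alpha\in\mathfrak r^{-1}(p/q)$. (iii) The set $\mathfrak r^{-1}([0,1)\setminus\mathbb Q)$ has Hausdorff dimension zero, and $\mathfrak r^{-1}(\gamma)$ consists of exactly one point for every irrational $\gamma\in(0,1)$. -/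

import Mathlib

open Filter Topology

noncomputable section

namespace SturmianPair

/-! ### Matrices -/

/-- Real `2 × 2` matrices. -/
abbrev Mat2 : Type := Matrix (Fin 2) (Fin 2) ℝ

/-- The spectral radius `ρ(M)`: the maximum modulus of the complex eigenvalues of `M`. -/
def specRad (M : Mat2) : ℝ :=
  (spectralRadius ℂ (M.map (algebraMap ℝ ℂ))).toReal

section
attribute [local instance] Matrix.linftyOpNormedAddCommGroup

/-- A norm on `2 × 2` matrices: the operator norm induced by the sup norm of `ℝ²`. The notions
below do not depend on which norm is used. -/
def matNorm (M : Mat2) : ℝ := ‖M‖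

end

/-- `M` is diagonalisable (over `ℝ`). -/
def Diagonalisable (M : Mat2) : Prop :=
  ∃ U : Mat2ˣ, ((U⁻¹ : Mat2ˣ) * M * U : Mat2).IsDiag

/-- `P = lim_{n → ∞} ρ(M)⁻ⁿ Mⁿ`, in the topology of entrywise convergence. -/
def IsPowerLimit (M P : Mat2) : Prop :=
  Tendsto (fun n : ℕ => ((specRad M)⁻¹) ^ n • M ^ n) atTop (𝓝 P)

/-! ### Words -/

/-- Finite words over the alphabet `{0, 1}`. -/
abbrev Word : Type := List (Fin 2)

/-- The number `|u|₁` of entries of `u` equal to `1`. -/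
def ones (u : Word) : ℕ := u.count 1

/-- The slope `|u|₁ / |u|` (of a nonempty word). -/
def wordSlope (u : Word) : ℝ := (ones u : ℝ) / (u.length : ℝ)

/-- `u` is balanced: the numbers of `1`s in any two subwords of the same length differ by at
most one. -/
def BalancedWord (u : Word) : Prop :=
  ∀ v₁ v₂ : Word, v₁ <:+: u → v₂ <:+: u → v₁.length = v₂.length →
    |(ones v₁ : ℤ) - (ones v₂ : ℤ)| ≤ 1

/-- `u` is cyclically balanced: all its cyclic permutations (including `u`) are balanced. -/
def CyclicallyBalanced (u : Word) : Prop :=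
  ∀ w : Word, u.IsRotated w → BalancedWord w

/-- Standard pairs of words: the smallest set of pairs containing `(0, 1)` and closed under
`(u, v) ↦ (uv, v)` and `(u, v) ↦ (u, vu)`. -/
inductive IsStandardPair : Word → Word → Prop
  | base : IsStandardPair [0] [1]
  | left {u v : Word} (h : IsStandardPair u v) : IsStandardPair (u ++ v) v
  | right {u v : Word} (h : IsStandardPair u v) : IsStandardPair u (v ++ u)

/-- The infinite word `x` has frequency of `1`s equal to `γ`. -/
def HasOneFrequency (x : ℕ → Fin 2) (γ : ℝ) : Prop :=
  Tendsto (fun n : ℕ => (((Finset.range n).filter fun i => x i = 1).card : ℝ) / n) atTop (𝓝 γ)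

/-- The set `X_γ` of Sturmian words of slope `γ`. Infinite words are indexed from `0`; since `δ` is
an arbitrary real number, the set does not depend on the first index. -/
def sturmianSet (γ : ℝ) : Set (ℕ → Fin 2) :=
  {x | ∃ δ : ℝ,
    (∀ n : ℕ, (((x n : Fin 2) : ℕ) : ℤ) = ⌊γ * ((n : ℝ) + 1) + δ⌋ - ⌊γ * (n : ℝ) + δ⌋) ∨
    (∀ n : ℕ, (((x n : Fin 2) : ℕ) : ℤ) = ⌈γ * ((n : ℝ) + 1) + δ⌉ - ⌈γ * (n : ℝ) + δ⌉)}

/-! ### Products along words and the joint spectral radius -/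

/-- The product `B_{u_m} ⋯ B_{u_1}` associated to a finite word `u = u_1 ⋯ u_m`. -/
def wordProd (B : Fin 2 → Mat2) (u : Word) : Mat2 := (u.map B).reverse.prod

/-- The product `B_{x_n} ⋯ B_{x_1}` along the first `n` letters of an infinite word. -/
def seqProd (B : Fin 2 → Mat2) (x : ℕ → Fin 2) (n : ℕ) : Mat2 :=
  wordProd B (List.ofFn fun i : Fin n => x i)

/-- The joint spectral radius of the pair `{B₀, B₁}`:
`lim_{n → ∞} max {‖B_{i_n} ⋯ B_{i_1}‖^{1/n}}`. (The limit always exists.) -/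
def jsr (B : Fin 2 → Mat2) : ℝ :=
  limUnder atTop fun n : ℕ =>
    ⨆ w : Fin n → Fin 2, matNorm (wordProd B (List.ofFn w)) ^ ((1 : ℝ) / n)

/-- `x` is weakly extremal for `B`: `‖B_{x_n} ⋯ B_{x_1}‖^{1/n}` tends to the joint spectral
radius. -/
def WeaklyExtremal (B : Fin 2 → Mat2) (x : ℕ → Fin 2) : Prop :=
  Tendsto (fun n : ℕ => matNorm (seqProd B x n) ^ ((1 : ℝ) / n)) atTop (𝓝 (jsr B))

/-- The pair `(A₀, α A₁)`. -/
def scaled (A : Fin 2 → Mat2) (α : ℝ) : Fin 2 → Mat2 := ![A 0, α • A 1]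

/-! ### The hypotheses -/

/-- The technical hypotheses on a pair of matrices. -/
structure TechnicalHypotheses (A : Fin 2 → Mat2) : Prop where
  nonneg : ∀ k i j, 0 ≤ A k i j
  invertible : ∀ k, IsUnit (A k)
  trace_pos : ∀ k, 0 < (A k).trace
  /-- There is no common invariant subspace other than `0` and `ℝ²`. -/
  no_common_invariant : ∀ W : Submodule ℝ (Fin 2 → ℝ),
    (∀ k, ∀ x ∈ W, (A k).mulVec x ∈ W) → W = ⊥ ∨ W = ⊤
  /-- Products along words that are not of the form `0ⁿ` or `1ⁿ` have positive entries. -/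
  mixed_pos : ∀ u : Word, (∀ (n : ℕ) (k : Fin 2), u ≠ List.replicate n k) →
    ∀ i j, 0 < wordProd A u i j

/-- `r : [0, ∞) → [0, 1]` witnesses the Sturmian hypothesis for `A`, that is, `r` is the `1`-ratio
function of `A`. Only the values of `r` on `[0, ∞)` matter. -/
structure IsOneRatioFunction (A : Fin 2 → Mat2) (r : ℝ → ℝ) : Prop where
  mapsTo : Set.MapsTo r (Set.Ici 0) (Set.Icc 0 1)
  extremal : ∀ α : ℝ, 0 ≤ α → ∀ x ∈ sturmianSet (r α), WeaklyExtremal (scaled A α) x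
  frequency : ∀ α : ℝ, 0 ≤ α → ∀ x : ℕ → Fin 2,
    WeaklyExtremal (scaled A α) x → HasOneFrequency x (r α)
  strict : ∀ α : ℝ, 0 ≤ α → ∀ u : Word, ¬ CyclicallyBalanced u →
    specRad (wordProd (scaled A α) u) < jsr (scaled A α) ^ u.length

/-- The preimage `r⁻¹(S)` under `r` as a function on `[0, ∞)`. -/
def preimageOf (r : ℝ → ℝ) (S : Set ℝ) : Set ℝ := {α : ℝ | 0 ≤ α ∧ r α ∈ S}

end SturmianPair

end

open SturmianPair

/-! Write 𝔯 for the 1-ratio function. An extremal Sturmian sequence for α has frequency 𝔯(α) of ones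
and competes at every other parameter β, so 𝔯(α) is a subgradient of log ϱ as a function of log α
(`rpow_mul_jsr_le`). Comparing two such inequalities gives monotonicity. Continuity is a compactness
argument: extremal Sturmian sequences can be shifted so that their normalised norms stay above one
half for a prescribed time (`exists_shift`), and a limit of such shifts is extremal at the limit
parameter with the limit frequency (`eq_of_tendsto`).

The plateaus come from Farey neighbours. For a standard pair (u, v) one has |v|₁|u| − |u|₁|v| = 1,
so comparing the products along u and along vuⁿ at equal total length leaves exactly one factor α.
On the plateau of slope ς(u), ϱ is realised by u and the words vuⁿ bound α from above; on the
plateaus of the slopes ς(vuⁿ), which decrease to ς(u), the roles are exchanged. Normalised powers of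
𝒜(u) tend to the dominant projection, so both bounds converge to the same number, which is therefore
the right endpoint (`isGreatest_preimage`); left endpoints are dual (`isLeast_preimage`). The pairs
(u, vu) and (uv, v) then give the two ends of the plateau of uv. These ends can coincide only if the
Fricke polynomial −det[X, Y] of the two products vanishes (`specRad_domProj_mul_mul`). Along the
tree of standard pairs this polynomial changes only by determinants (`fricke_wordProd`), and for the
initial pair it is nonzero because there is no common eigenvector (`fricke_ne_zero`).

For the dimension, an irrational slope is enclosed by standard pairs both of whose words are long.
The gap between the two plateaus is at most a constant times |u| + |v| times the product of the two
ratios |small eigenvalue| / large eigenvalue (`gap_le`). Those ratios decay exponentially in the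
word length while the slopes stay away from 0 and 1: the permanent is supermultiplicative, the
absolute determinant is multiplicative, and on each block containing both letters the former wins by
a fixed factor (`exists_rate_eigMin`). A pair of slopes is encoded by four integers, so
exponentially small gaps make every Hausdorff sum of positive exponent tend to zero. Uniqueness at
irrational slopes follows, since an interval has dimension one. -/

namespace SturmianPair

/-! ### Matrix norms and Gelfand's formula -/

section Norm
attribute [local instance] Matrix.linftyOpNormedAddCommGroup Matrix.linftyOpNormedRing
  Matrix.linftyOpNormedAlgebra

theorem matNorm_mul_le (M N : Mat2) : matNorm (M * N) ≤ matNorm M * matNorm N :=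
  Matrix.linfty_opNorm_mul M N

theorem matNorm_one : matNorm 1 = 1 := norm_one

theorem matNorm_nonneg (M : Mat2) : 0 ≤ matNorm M := norm_nonneg _

theorem matNorm_smul (c : ℝ) (M : Mat2) : matNorm (c • M) = |c| * matNorm M := by
  unfold matNorm
  rw [norm_smul, Real.norm_eq_abs]

theorem matNorm_eq (M : Mat2) :
    matNorm M = max (|M 0 0| + |M 0 1|) (|M 1 0| + |M 1 1|) := by
  unfold matNorm
  rw [Matrix.linfty_opNorm_def]
  have : (Finset.univ : Finset (Fin 2)) = {0, 1} := rfl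
  simp [this, Finset.sup_insert]

theorem continuous_matNorm : Continuous matNorm := by
  have : matNorm = fun M : Mat2 => max (|M 0 0| + |M 0 1|) (|M 1 0| + |M 1 1|) :=
    funext matNorm_eq
  rw [this]
  fun_prop

/-- Gelfand's formula over ℂ; the row-sum norm does not change when a real matrix is regarded as a
complex one. -/
theorem tendsto_matNorm_pow_specRad (M : Mat2) :
    Tendsto (fun n : ℕ => matNorm (M ^ n) ^ ((1 : ℝ) / n)) atTop (𝓝 (specRad M)) := by
  have hc : CompleteSpace (Matrix (Fin 2) (Fin 2) ℂ) := FiniteDimensional.complete ℂ _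
  have h := spectrum.pow_norm_pow_one_div_tendsto_nhds_spectralRadius (M.map (algebraMap ℝ ℂ))
  have hne : spectralRadius ℂ (M.map (algebraMap ℝ ℂ)) ≠ ⊤ :=
    ((spectrum.spectralRadius_le_nnnorm _).trans_lt ENNReal.coe_lt_top).ne
  have h2 := (ENNReal.tendsto_toReal hne).comp h
  refine h2.congr fun n => ?_
  have hn : ‖(M.map (algebraMap ℝ ℂ)) ^ n‖ = matNorm (M ^ n) := by
    rw [← Matrix.map_pow]
    unfold matNorm
    rw [Matrix.linfty_opNorm_def, Matrix.linfty_opNorm_def]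
    simp
  simp only [Function.comp]
  rw [hn, ENNReal.toReal_ofReal (Real.rpow_nonneg (matNorm_nonneg _) _)]

end Norm

/-! ### Spectra of non-negative 2 × 2 matrices -/

/-- The discriminant of the characteristic polynomial. -/
noncomputable def disc (M : Mat2) : ℝ := (M 0 0 - M 1 1) ^ 2 + 4 * M 0 1 * M 1 0

/-- The larger eigenvalue of a matrix with non-negative discriminant. -/
noncomputable def eigMax (M : Mat2) : ℝ := (M 0 0 + M 1 1 + √(disc M)) / 2

/-- The smaller eigenvalue of a matrix with non-negative discriminant. -/
noncomputable def eigMin (M : Mat2) : ℝ := (M 0 0 + M 1 1 - √(disc M)) / 2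

/-- All entries are non-negative. -/
def EntriesNonneg (M : Mat2) : Prop := ∀ i j, 0 ≤ M i j

theorem EntriesNonneg.mul {M N : Mat2} (hM : EntriesNonneg M) (hN : EntriesNonneg N) :
    EntriesNonneg (M * N) := fun i j => by
  rw [Matrix.mul_apply]
  exact Finset.sum_nonneg fun k _ => mul_nonneg (hM i k) (hN k j)

theorem entriesNonneg_one : EntriesNonneg 1 := by
  intro i j
  fin_cases i <;> fin_cases j <;> simp

theorem EntriesNonneg.pow {M : Mat2} (hM : EntriesNonneg M) (n : ℕ) : EntriesNonneg (M ^ n) := by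
  induction n with
  | zero => simpa using entriesNonneg_one
  | succ n ih => rw [pow_succ]; exact ih.mul hM

theorem EntriesNonneg.smul {M : Mat2} (hM : EntriesNonneg M) {c : ℝ} (hc : 0 ≤ c) :
    EntriesNonneg (c • M) := fun i j => mul_nonneg hc (hM i j)

theorem EntriesNonneg.disc_nonneg {M : Mat2} (hM : EntriesNonneg M) : 0 ≤ disc M := by
  have h1 := mul_nonneg (hM 0 1) (hM 1 0)
  unfold disc
  nlinarith [sq_nonneg (M 0 0 - M 1 1)]

theorem eigMax_add_eigMin (M : Mat2) : eigMax M + eigMin M = M.trace := by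
  rw [Matrix.trace_fin_two]; unfold eigMax eigMin; ring

theorem eigMax_mul_eigMin {M : Mat2} (hM : 0 ≤ disc M) : eigMax M * eigMin M = M.det := by
  have := Real.sq_sqrt hM
  rw [Matrix.det_fin_two]; unfold eigMax eigMin
  unfold disc at *
  nlinarith

theorem abs_eigMin_le {M : Mat2} (hM : EntriesNonneg M) : |eigMin M| ≤ eigMax M := by
  have h0 := hM 0 0
  have h1 := hM 1 1
  have h2 := Real.sqrt_nonneg (disc M)
  rw [abs_le]; unfold eigMax eigMin
  constructor <;> linarith

/-- Non-negative off-diagonal entries make the discriminant non-negative, so the characteristic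
polynomial splits over ℝ; the non-negative trace makes the larger root dominant in modulus. -/
theorem specRad_eq {M : Mat2} (hM : EntriesNonneg M) : specRad M = eigMax M := by
  have hle := abs_eigMin_le hM
  have hmem : ∀ z : ℂ, z ∈ spectrum ℂ (M.map (algebraMap ℝ ℂ)) ↔ z = eigMax M ∨ z = eigMin M := by
    intro z
    have h1 : (eigMax M : ℂ) + eigMin M = M 0 0 + M 1 1 := by
      have := eigMax_add_eigMin M
      rw [Matrix.trace_fin_two] at this
      exact_mod_cast this
    have h2 : (eigMax M : ℂ) * eigMin M = M 0 0 * M 1 1 - M 0 1 * M 1 0 := by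
      have := eigMax_mul_eigMin hM.disc_nonneg
      rw [Matrix.det_fin_two] at this
      exact_mod_cast this
    rw [spectrum.mem_iff, Matrix.isUnit_iff_isUnit_det, isUnit_iff_ne_zero, not_not,
      Matrix.det_fin_two]
    simp only [Matrix.algebraMap_eq_diagonal, Matrix.sub_apply, Matrix.diagonal_apply, Matrix.map_apply]
    simp only [Pi.algebraMap_apply, Algebra.algebraMap_self, RingHom.id_apply, if_true,
      Complex.coe_algebraMap]
    have h3 : (z - M 0 0) * (z - M 1 1) - (0 - (M 0 1 : ℂ)) * (0 - M 1 0)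
        = (z - eigMax M) * (z - eigMin M) := by
      linear_combination z * h1 - h2
    simp only [show ((0 : Fin 2) = 1) = False by simp, show ((1 : Fin 2) = 0) = False by simp,
      if_false]
    rw [h3, mul_eq_zero, sub_eq_zero, sub_eq_zero]
  have hset : spectrum ℂ (M.map (algebraMap ℝ ℂ)) = {(eigMax M : ℂ), (eigMin M : ℂ)} := by
    ext z; rw [hmem]; simp
  unfold specRad spectralRadius
  rw [hset, iSup_pair, ENNReal.toReal_sup (by simp) (by simp)]
  simp only [ENNReal.coe_toReal, coe_nnnorm, Complex.norm_real, Real.norm_eq_abs]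
  rw [abs_of_nonneg ((abs_nonneg _).trans hle), sup_eq_left.2 hle]

theorem specRad_nonneg (M : Mat2) : 0 ≤ specRad M := ENNReal.toReal_nonneg

theorem specRad_eq_trace_det {M : Mat2} (hM : EntriesNonneg M) :
    specRad M = (M.trace + √(M.trace ^ 2 - 4 * M.det)) / 2 := by
  rw [specRad_eq hM, Matrix.trace_fin_two, Matrix.det_fin_two]
  unfold eigMax
  have : disc M = (M 0 0 + M 1 1) ^ 2 - 4 * (M 0 0 * M 1 1 - M 0 1 * M 1 0) := by
    unfold disc; ring
  rw [this]

theorem specRad_mul_comm {M N : Mat2} (hM : EntriesNonneg M) (hN : EntriesNonneg N) :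
    specRad (M * N) = specRad (N * M) := by
  rw [specRad_eq_trace_det (hM.mul hN), specRad_eq_trace_det (hN.mul hM), Matrix.trace_mul_comm,
    Matrix.det_mul_comm]

theorem specRad_smul {M : Mat2} (hM : EntriesNonneg M) {c : ℝ} (hc : 0 ≤ c) :
    specRad (c • M) = c * specRad M := by
  rw [specRad_eq_trace_det (hM.smul hc), specRad_eq_trace_det hM, Matrix.trace_smul,
    Matrix.det_smul]
  have : (c • M.trace) ^ 2 - 4 * (c ^ Fintype.card (Fin 2) * M.det)
      = c ^ 2 * (M.trace ^ 2 - 4 * M.det) := by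
    simp; ring
  rw [this, Real.sqrt_mul (sq_nonneg c), Real.sqrt_sq hc, smul_eq_mul]
  ring

/-- Used for products containing a rank-one projection: there the spectral radius becomes linear in
the other factor. -/
theorem specRad_eq_trace_of_det_eq_zero {M : Mat2} (hM : EntriesNonneg M) (h : M.det = 0) :
    specRad M = M.trace := by
  have : 0 ≤ M.trace := by
    rw [Matrix.trace_fin_two]; exact add_nonneg (hM 0 0) (hM 1 1)
  rw [specRad_eq_trace_det hM, h, mul_zero, sub_zero, Real.sqrt_sq this]
  ring

theorem trace_le_two_mul_specRad {M : Mat2} (hM : EntriesNonneg M) :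
    M.trace ≤ 2 * specRad M := by
  rw [specRad_eq_trace_det hM]
  linarith [Real.sqrt_nonneg (M.trace ^ 2 - 4 * M.det)]

theorem specRad_pos_of_trace_pos {M : Mat2} (hM : EntriesNonneg M) (h : 0 < M.trace) :
    0 < specRad M := by
  linarith [trace_le_two_mul_specRad hM]

theorem tendsto_specRad {ι : Type*} {l : Filter ι} [l.NeBot] {M : ι → Mat2} {N : Mat2}
    (hM : ∀ i, EntriesNonneg (M i)) (h : Tendsto M l (𝓝 N)) :
    Tendsto (fun i => specRad (M i)) l (𝓝 (specRad N)) := by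
  have hN : EntriesNonneg N := fun i j =>
    ge_of_tendsto' ((continuous_id.matrix_elem i j).continuousAt.tendsto.comp h) fun k => hM k i j
  rw [specRad_eq hN]
  simp_rw [fun i => specRad_eq (hM i)]
  have hc : Continuous eigMax := by
    unfold eigMax disc
    fun_prop
  exact hc.continuousAt.tendsto.comp h

/-! ### The dominant spectral projection -/

/-- The spectral projection onto the dominant eigenspace. -/
noncomputable def domProj (M : Mat2) : Mat2 := (eigMax M - eigMin M)⁻¹ • (M - eigMin M • 1)

theorem eigMax_sub_eigMin (M : Mat2) : eigMax M - eigMin M = √(disc M) := by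
  unfold eigMax eigMin; ring

theorem eigMin_lt_eigMax {M : Mat2} (h : 0 < disc M) : eigMin M < eigMax M := by
  have := Real.sqrt_pos.2 h
  linarith [eigMax_sub_eigMin M]

theorem abs_eigMin_lt {M : Mat2} (hd : 0 < disc M) (ht : 0 < M.trace) :
    |eigMin M| < eigMax M := by
  rw [abs_lt]
  have := eigMin_lt_eigMax hd
  have := eigMax_add_eigMin M
  constructor <;> linarith

theorem cayley_hamilton (M : Mat2) : M * M = M.trace • M - M.det • (1 : Mat2) := by
  rw [Matrix.trace_fin_two, Matrix.det_fin_two]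
  ext i j
  fin_cases i <;> fin_cases j <;> simp [Matrix.mul_apply, Fin.sum_univ_two] <;> ring

/-- By Cayley–Hamilton, right multiplication by M acts on `domProj M` and on its complement as the
scalars `eigMax M` and `eigMin M`. -/
theorem pow_eq_domProj {M : Mat2} (h : 0 < disc M) (n : ℕ) :
    M ^ n = eigMax M ^ n • domProj M + eigMin M ^ n • (1 - domProj M) := by
  have hne : eigMax M - eigMin M ≠ 0 := by linarith [eigMin_lt_eigMax h]
  have hP : (eigMax M - eigMin M) • domProj M = M - eigMin M • 1 := by
    unfold domProj
    rw [smul_smul, mul_inv_cancel₀ hne, one_smul]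
  have hMP : domProj M * M = eigMax M • domProj M := by
    unfold domProj
    rw [Matrix.smul_mul, smul_comm (eigMax M)]
    congr 1
    rw [sub_mul, cayley_hamilton, ← eigMax_mul_eigMin h.le, ← eigMax_add_eigMin]
    simp only [Matrix.smul_mul, one_mul, smul_sub, smul_smul, add_smul]
    abel
  have hMQ : (1 - domProj M) * M = eigMin M • (1 - domProj M) := by
    rw [sub_mul, hMP, one_mul, smul_sub, eq_sub_iff_add_eq, sub_add, ← sub_smul, hP]
    abel
  induction n with
  | zero => simp
  | succ n ih =>
    rw [pow_succ, ih, add_mul, Matrix.smul_mul, Matrix.smul_mul, hMP, hMQ, smul_smul, smul_smul,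
      pow_succ, pow_succ]

theorem isPowerLimit_domProj {M : Mat2} (hM : EntriesNonneg M) (hd : 0 < disc M)
    (ht : 0 < M.trace) : IsPowerLimit M (domProj M) := by
  unfold IsPowerLimit
  have hlt := abs_eigMin_lt hd ht
  have hpos : 0 < eigMax M := (abs_nonneg _).trans_lt hlt
  have h1 : ∀ n : ℕ, ((specRad M)⁻¹) ^ n • M ^ n
      = domProj M + (eigMin M / eigMax M) ^ n • (1 - domProj M) := by
    intro n
    rw [pow_eq_domProj hd n, specRad_eq hM, smul_add, smul_smul, smul_smul, ← mul_pow, ← mul_pow,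
      inv_mul_cancel₀ hpos.ne', one_pow, one_smul, inv_mul_eq_div]
  simp_rw [h1]
  have h2 : Tendsto (fun n : ℕ => (eigMin M / eigMax M) ^ n) atTop (𝓝 0) := by
    apply tendsto_pow_atTop_nhds_zero_of_abs_lt_one
    rw [abs_div, abs_of_pos hpos, div_lt_one hpos]
    exact hlt
  simpa using tendsto_const_nhds.add (h2.smul_const (1 - domProj M))

theorem det_domProj {M : Mat2} (hd : 0 < disc M) : (domProj M).det = 0 := by
  have h1 := eigMax_mul_eigMin hd.le
  have h2 := eigMax_add_eigMin M
  rw [Matrix.trace_fin_two] at h2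
  rw [Matrix.det_fin_two] at h1
  unfold domProj
  rw [Matrix.det_smul, Matrix.det_fin_two]
  simp only [Matrix.sub_apply, Matrix.smul_apply, Matrix.one_apply_eq, smul_eq_mul, mul_one,
    ne_eq, zero_ne_one, one_ne_zero, not_false_eq_true, Matrix.one_apply_ne, mul_zero, sub_zero]
  apply mul_eq_zero_of_right
  linear_combination -h1 + eigMin M * h2

theorem domProj_nonneg {M : Mat2} (hM : EntriesNonneg M) (hd : 0 < disc M)
    (ht : 0 < M.trace) : EntriesNonneg (domProj M) := fun i j =>
  ge_of_tendsto' ((continuous_id.matrix_elem i j).continuousAt.tendsto.comp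
    (isPowerLimit_domProj hM hd ht)) fun n =>
      mul_nonneg (pow_nonneg (inv_nonneg.2 (specRad_nonneg _)) _) (hM.pow n i j)

theorem specRad_domProj_mul {M N : Mat2} (hM : EntriesNonneg M) (hd : 0 < disc M)
    (ht : 0 < M.trace) (hN : EntriesNonneg N) :
    specRad (domProj M * N) = ((M * N).trace - eigMin M * N.trace) / (eigMax M - eigMin M) := by
  rw [specRad_eq_trace_of_det_eq_zero ((domProj_nonneg hM hd ht).mul hN)
    (by rw [Matrix.det_mul, det_domProj hd, zero_mul])]
  unfold domProj
  rw [Matrix.smul_mul, Matrix.trace_smul, sub_mul, Matrix.trace_sub, Matrix.smul_mul, one_mul,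
    Matrix.trace_smul, smul_eq_mul, smul_eq_mul, inv_mul_eq_div]

/-- Homogeneity and continuity of the spectral radius. This limit is the source of every projection
in the endpoint formulae. -/
theorem tendsto_specRad_pow_mul {M N : Mat2} (hM : EntriesNonneg M) (hd : 0 < disc M)
    (ht : 0 < M.trace) (hN : EntriesNonneg N) :
    Tendsto (fun n : ℕ => specRad (M ^ n * N) / specRad M ^ n) atTop
      (𝓝 (specRad (domProj M * N))) := by
  have h1 : ∀ n : ℕ, EntriesNonneg (((specRad M)⁻¹) ^ n • M ^ n) := fun n =>
    (hM.pow n).smul (pow_nonneg (inv_nonneg.2 (specRad_nonneg _)) _)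
  have h2 := tendsto_specRad (fun n => (h1 n).mul hN)
    ((continuous_id.matrix_mul continuous_const).continuousAt.tendsto.comp
      (isPowerLimit_domProj hM hd ht))
  refine h2.congr fun n => ?_
  rw [Matrix.smul_mul, specRad_smul ((hM.pow n).mul hN)
    (pow_nonneg (inv_nonneg.2 (specRad_nonneg _)) _), inv_pow, inv_mul_eq_div]

/-! ### The Fricke polynomial -/

/-- The Fricke polynomial of a pair of matrices, as a commutator determinant. -/
noncomputable def fricke (X Y : Mat2) : ℝ := -(X * Y - Y * X).det

theorem fricke_eq (X Y : Mat2) :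
    fricke X Y = (X * Y).trace ^ 2 - X.trace * Y.trace * (X * Y).trace + Y.det * X.trace ^ 2
      + X.det * Y.trace ^ 2 - 4 * X.det * Y.det := by
  unfold fricke
  simp only [Matrix.det_fin_two, Matrix.trace_fin_two, Matrix.mul_apply, Fin.sum_univ_two,
    Matrix.sub_apply]
  ring

/-- The two factors compare the trace of XY with the values forced by a common eigenvector:
eigenvalues paired large with large, or large with small. In `gap_le` this becomes a quadratic
equation for the trace defect. -/
theorem fricke_factor {X Y : Mat2} (hX : 0 ≤ disc X) (hY : 0 ≤ disc Y) :
    fricke X Y = ((X * Y).trace - eigMax X * eigMax Y - eigMin X * eigMin Y) *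
      ((X * Y).trace - eigMax X * eigMin Y - eigMin X * eigMax Y) := by
  rw [fricke_eq, ← eigMax_mul_eigMin hX, ← eigMax_mul_eigMin hY, ← eigMax_add_eigMin X,
    ← eigMax_add_eigMin Y]
  ring

theorem fricke_swap (X Y : Mat2) : fricke Y X = fricke X Y := by
  rw [fricke_eq, fricke_eq, Matrix.trace_mul_comm]
  ring

/-- The commutator of YX with Y is Y times the commutator of X with Y. -/
theorem fricke_mul_left (X Y : Mat2) : fricke (Y * X) Y = Y.det * fricke X Y := by
  unfold fricke
  have : Y * X * Y - Y * (Y * X) = Y * (X * Y - Y * X) := by noncomm_ring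
  rw [this, Matrix.det_mul]
  ring

/-- Both factors on the left are traces, because the projection has rank one. The Fricke polynomial
thus measures how far the two plateau endpoints are from coinciding. -/
theorem specRad_domProj_mul_mul {X Y : Mat2} (hX : EntriesNonneg X) (hY : EntriesNonneg Y)
    (hd : 0 < disc (X * Y)) (ht : 0 < (X * Y).trace) :
    specRad (domProj (X * Y) * X) * specRad (domProj (X * Y) * Y) =
      specRad (X * Y) - specRad (X * Y) * fricke X Y / (eigMax (X * Y) - eigMin (X * Y)) ^ 2 := by
  have hXY := hX.mul hY
  have hne : eigMax (X * Y) - eigMin (X * Y) ≠ 0 := by linarith [eigMin_lt_eigMax hd]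
  rw [specRad_domProj_mul hXY hd ht hX, specRad_domProj_mul hXY hd ht hY, specRad_eq hXY,
    fricke_eq, div_mul_div_comm, ← sq, eq_sub_iff_add_eq, ← add_div, div_eq_iff (pow_ne_zero _ hne)]
  have h1 := eigMax_add_eigMin (X * Y)
  have h2 := eigMax_mul_eigMin hd.le
  have h3 : (X * Y * X).trace = X.trace * (X * Y).trace - X.det * Y.trace := by
    simp only [Matrix.det_fin_two, Matrix.trace_fin_two, Matrix.mul_apply, Fin.sum_univ_two]
    ring
  have h4 : (X * Y * Y).trace = Y.trace * (X * Y).trace - Y.det * X.trace := by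
    simp only [Matrix.det_fin_two, Matrix.trace_fin_two, Matrix.mul_apply, Fin.sum_univ_two]
    ring
  rw [Matrix.det_mul] at h2
  rw [h3, h4, ← h1]
  generalize eigMax (X * Y) = l at *
  generalize eigMin (X * Y) = m at *
  generalize X.trace = x at *
  generalize Y.trace = y at *
  generalize X.det = d at *
  generalize Y.det = e at *
  linear_combination (4 * l - x * y) * h2

/-! ### Permanents -/

/-- The permanent of a `2 × 2` matrix. -/
noncomputable def perm2 (M : Mat2) : ℝ := M 0 0 * M 1 1 + M 0 1 * M 1 0

theorem perm2_nonneg {M : Mat2} (hM : EntriesNonneg M) : 0 ≤ perm2 M :=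
  add_nonneg (mul_nonneg (hM _ _) (hM _ _)) (mul_nonneg (hM _ _) (hM _ _))

/-- The permanent of the product is the product of the permanents plus non-negative cross terms.
Against the multiplicative determinant it detects contraction of directions. -/
theorem perm2_mul_le {M N : Mat2} (hM : EntriesNonneg M) (hN : EntriesNonneg N) :
    perm2 M * perm2 N ≤ perm2 (M * N) := by
  unfold perm2
  simp only [Matrix.mul_apply, Fin.sum_univ_two]
  have h1 := mul_nonneg (mul_nonneg (hM 0 0) (hM 1 0)) (mul_nonneg (hN 0 0) (hN 0 1))
  have h2 := mul_nonneg (mul_nonneg (hM 0 1) (hM 1 1)) (mul_nonneg (hN 1 0) (hN 1 1))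
  linarith

theorem abs_det_le_perm2 {M : Mat2} (hM : EntriesNonneg M) : |M.det| ≤ perm2 M := by
  have h1 := mul_nonneg (hM 0 0) (hM 1 1)
  have h2 := mul_nonneg (hM 0 1) (hM 1 0)
  rw [Matrix.det_fin_two, abs_le]
  unfold perm2
  constructor <;> linarith

theorem abs_det_lt_perm2 {M : Mat2} (hM : ∀ i j, 0 < M i j) : |M.det| < perm2 M := by
  have h1 := mul_pos (hM 0 0) (hM 1 1)
  have h2 := mul_pos (hM 0 1) (hM 1 0)
  rw [Matrix.det_fin_two, abs_lt]
  unfold perm2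
  constructor <;> linarith

theorem perm2_le {M : Mat2} (hM : EntriesNonneg M) : perm2 M ≤ 2 * specRad M ^ 2 := by
  rw [specRad_eq hM]
  have ha := hM 0 0
  have hd := hM 1 1
  have hbc := mul_nonneg (hM 0 1) (hM 1 0)
  have hs := Real.sqrt_nonneg (disc M)
  have hs2 := Real.sq_sqrt hM.disc_nonneg
  unfold eigMax perm2
  unfold disc at *
  nlinarith [mul_nonneg (add_nonneg ha hd) hs, mul_nonneg ha hd]

theorem disc_pos_of_pos {M : Mat2} (hM : ∀ i j, 0 < M i j) : 0 < disc M := by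
  have := mul_pos (hM 0 1) (hM 1 0)
  unfold disc
  nlinarith [sq_nonneg (M 0 0 - M 1 1)]

theorem trace_pos_of_pos {M : Mat2} (hM : ∀ i j, 0 < M i j) : 0 < M.trace := by
  rw [Matrix.trace_fin_two]; exact add_pos (hM 0 0) (hM 1 1)

/-! ### Irreducibility and commutators -/

/-- The quadratic form is the determinant of the pair (A(s, t), (s, t)), so its zeros are the
eigenvector directions. -/
theorem no_common_eigenvector {A : Fin 2 → Mat2} (hA : TechnicalHypotheses A) {s t : ℝ}
    (hst : s ≠ 0 ∨ t ≠ 0)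
    (h : ∀ k, A k 1 0 * s ^ 2 + (A k 1 1 - A k 0 0) * s * t - A k 0 1 * t ^ 2 = 0) : False := by
  have hinv : ∀ k, ∀ x ∈ Submodule.span ℝ {![s, t]},
      (A k).mulVec x ∈ Submodule.span ℝ {![s, t]} := by
    intro k x hx
    obtain ⟨c, rfl⟩ := Submodule.mem_span_singleton.1 hx
    rw [Matrix.mulVec_smul]
    apply Submodule.smul_mem
    rw [Submodule.mem_span_singleton]
    have hk := h k
    rcases hst with hs | ht
    · refine ⟨(A k 0 0 * s + A k 0 1 * t) / s, ?_⟩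
      ext i
      fin_cases i <;> simp [Matrix.mulVec, dotProduct, Fin.sum_univ_two]
      · field_simp
      · field_simp
        linear_combination -hk
    · refine ⟨(A k 1 0 * s + A k 1 1 * t) / t, ?_⟩
      ext i
      fin_cases i <;> simp [Matrix.mulVec, dotProduct, Fin.sum_univ_two]
      · field_simp
        linear_combination hk
      · field_simp
  rcases hA.no_common_invariant _ hinv with h0 | h1
  · rw [Submodule.span_singleton_eq_bot] at h0
    have e0 := congrFun h0 0
    have e1 := congrFun h0 1
    simp at e0 e1
    rcases hst with hs | ht
    · exact hs e0
    · exact ht e1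
  · have m0 : ![(1 : ℝ), 0] ∈ Submodule.span ℝ {![s, t]} := h1 ▸ Submodule.mem_top
    have m1 : ![(0 : ℝ), 1] ∈ Submodule.span ℝ {![s, t]} := h1 ▸ Submodule.mem_top
    obtain ⟨c, hc⟩ := Submodule.mem_span_singleton.1 m0
    obtain ⟨d, hd⟩ := Submodule.mem_span_singleton.1 m1
    have c0 := congrFun hc 0
    have c1 := congrFun hc 1
    have d0 := congrFun hd 0
    have d1 := congrFun hd 1
    simp at c0 c1 d0 d1
    rcases c1 with rfl | rfl
    · simp at c0
    · simp at d1

theorem exists_root_binary_form {c e b : ℝ} (h : 0 ≤ e ^ 2 + 4 * b * c) :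
    ∃ s t : ℝ, (s ≠ 0 ∨ t ≠ 0) ∧ c * s ^ 2 + e * s * t - b * t ^ 2 = 0 := by
  by_cases hc : c = 0
  · exact ⟨1, 0, Or.inl one_ne_zero, by simp [hc]⟩
  · refine ⟨(-e + √(e ^ 2 + 4 * b * c)) / (2 * c), 1, Or.inr one_ne_zero, ?_⟩
    have := Real.sq_sqrt h
    generalize √(e ^ 2 + 4 * b * c) = w at *
    field_simp
    linear_combination this

/-- The determinant of the commutator is, up to sign, the resultant of the two eigenvector forms. If
it vanishes the forms share a root, and the root is real because both discriminants are
non-negative. -/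
theorem fricke_ne_zero {A : Fin 2 → Mat2} (hA : TechnicalHypotheses A) :
    fricke (A 0) (A 1) ≠ 0 := by
  intro hF
  have hD : ∀ k, 0 ≤ (A k 1 1 - A k 0 0) ^ 2 + 4 * A k 0 1 * A k 1 0 := by
    intro k
    nlinarith [sq_nonneg (A k 1 1 - A k 0 0), mul_nonneg (hA.nonneg k 0 1) (hA.nonneg k 1 0)]
  have key : ∀ s t : ℝ, (s ≠ 0 ∨ t ≠ 0) →
      A 0 1 0 * s ^ 2 + (A 0 1 1 - A 0 0 0) * s * t - A 0 0 1 * t ^ 2 = 0 →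
      A 1 1 0 * s ^ 2 + (A 1 1 1 - A 1 0 0) * s * t - A 1 0 1 * t ^ 2 = 0 → False := by
    intro s t hst h0 h1
    refine no_common_eigenvector hA hst fun k => ?_
    fin_cases k
    · exact h0
    · exact h1
  have hD0 := hD 0
  have hD1 := hD 1
  unfold fricke at hF
  simp only [Matrix.det_fin_two, Matrix.mul_apply, Fin.sum_univ_two, Matrix.sub_apply] at hF
  generalize hc : A 0 1 0 = c at *
  generalize hb : A 0 0 1 = b at *
  generalize hg : A 1 1 0 = g at *
  generalize hf : A 1 0 1 = f at *
  obtain ⟨e, he⟩ : ∃ e, e = A 0 1 1 - A 0 0 0 := ⟨_, rfl⟩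
  obtain ⟨k, hk⟩ : ∃ k, k = A 1 1 1 - A 1 0 0 := ⟨_, rfl⟩
  rw [← he] at hD0 key
  rw [← hk] at hD1 key
  -- Resultant of c s² + e st − b t² and g s² + k st − f t².
  have hF' : (b * g - c * f) ^ 2 + (b * k - f * e) * (g * e - c * k) = 0 := by
    rw [he, hk]; linear_combination hF
  by_cases hm : b * k - f * e = 0
  · have hn : b * g - c * f = 0 := by
      rw [hm, zero_mul, add_zero] at hF'
      exact pow_eq_zero_iff (two_ne_zero) |>.1 hF'
    by_cases hl : g * e - c * k = 0
    -- All minors vanish, so the forms are proportional: a root of a nonzero one is a root of both.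
    · by_cases h0 : b = 0 ∧ c = 0 ∧ e = 0
      · obtain ⟨s, t, hst, h⟩ := exists_root_binary_form hD1
        exact key s t hst (by simp [h0.1, h0.2.1, h0.2.2]) h
      · obtain ⟨s, t, hst, h⟩ := exists_root_binary_form hD0
        refine key s t hst h ?_
        by_cases hb0 : b = 0
        · by_cases hc0 : c = 0
          · have he0 : e ≠ 0 := fun he0 => h0 ⟨hb0, hc0, he0⟩
            apply mul_left_cancel₀ he0
            linear_combination k * h + s ^ 2 * hl + t ^ 2 * hm
          · apply mul_left_cancel₀ hc0
            linear_combination g * h - s * t * hl + t ^ 2 * hn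
        · apply mul_left_cancel₀ hb0
          linear_combination f * h + s ^ 2 * hn + s * t * hm
    -- A single nonzero minor forces b = f = 0.
    · refine key 0 1 (Or.inr one_ne_zero) ?_ ?_
      · apply mul_left_cancel₀ hl
        linear_combination - e * hn + c * hm
      · apply mul_left_cancel₀ hl
        linear_combination - k * hn + g * hm
  -- The root obtained by eliminating t² between the two forms and dividing by s.
  · refine key (b * k - f * e) (-(b * g - c * f)) (Or.inl hm) ?_ ?_
    · linear_combination (-b) * hF'
    · linear_combination (-f) * hF'

/-! ### Diagonalisability and the discriminant -/

theorem diagonalisable_of_disc_pos {M : Mat2} (h : 0 < disc M) : Diagonalisable M := by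
  have key : ∀ V : Mat2, V.det ≠ 0 → ∀ D : Mat2, D.IsDiag → M * V = V * D → Diagonalisable M := by
    intro V hV D hD hMV
    have hu : IsUnit V := (Matrix.isUnit_iff_isUnit_det V).2 (isUnit_iff_ne_zero.2 hV)
    refine ⟨hu.unit, ?_⟩
    have : ((hu.unit⁻¹ : Mat2ˣ) * M * hu.unit : Mat2) = D := by
      rw [mul_assoc, IsUnit.unit_spec, hMV, ← mul_assoc, IsUnit.val_inv_mul, one_mul]
    rw [this]; exact hD
  have hlt := eigMin_lt_eigMax h
  have hs := eigMax_add_eigMin M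
  have hp := eigMax_mul_eigMin h.le
  rw [Matrix.trace_fin_two] at hs
  rw [Matrix.det_fin_two] at hp
  have hDiag : (!![eigMax M, 0; 0, eigMin M] : Mat2).IsDiag := by
    intro i j hij
    fin_cases i <;> fin_cases j <;> simp at hij ⊢
  by_cases hb : M 0 1 = 0
  · by_cases hc : M 1 0 = 0
    · refine ⟨1, ?_⟩
      intro i j hij
      fin_cases i <;> fin_cases j <;> simp [hb, hc] at hij ⊢
    · refine key !![eigMax M - M 1 1, eigMin M - M 1 1; M 1 0, M 1 0] ?_ _ hDiag ?_
      · rw [Matrix.det_fin_two_of]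
        have : (eigMax M - M 1 1) * M 1 0 - (eigMin M - M 1 1) * M 1 0
          = (eigMax M - eigMin M) * M 1 0 := by ring
        rw [this]
        exact mul_ne_zero (by linarith) hc
      · ext i j
        fin_cases i <;> fin_cases j <;>
          simp [Matrix.mul_apply, Fin.sum_univ_two]
        · linear_combination hp - eigMax M * hs
        · linear_combination hp - eigMin M * hs
        · ring
        · ring
  · refine key !![M 0 1, M 0 1; eigMax M - M 0 0, eigMin M - M 0 0] ?_ _ hDiag ?_
    · rw [Matrix.det_fin_two_of]
      have : M 0 1 * (eigMin M - M 0 0) - M 0 1 * (eigMax M - M 0 0)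
        = (eigMin M - eigMax M) * M 0 1 := by ring
      rw [this]
      exact mul_ne_zero (by linarith) hb
    · ext i j
      fin_cases i <;> fin_cases j <;>
        simp [Matrix.mul_apply, Fin.sum_univ_two]
      · ring
      · ring
      · linear_combination hp - eigMax M * hs
      · linear_combination hp - eigMin M * hs

theorem eq_smul_one_of_diagonalisable {M : Mat2} (h : Diagonalisable M) (hd : disc M = 0) :
    ∃ c : ℝ, M = c • 1 := by
  obtain ⟨U, hU⟩ := h
  obtain ⟨D, hDdef⟩ : ∃ D : Mat2, D = ((U⁻¹ : Mat2ˣ) * M * U : Mat2) := ⟨_, rfl⟩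
  rw [← hDdef] at hU
  have hM : M = U * D * (U⁻¹ : Mat2ˣ) := by
    rw [hDdef]
    simp only [mul_assoc, Units.mul_inv, mul_one]
    rw [← mul_assoc, Units.mul_inv, one_mul]
  have htr : M.trace = D.trace := by
    rw [hM, Matrix.trace_mul_comm, ← mul_assoc, Units.inv_mul, one_mul]
  have hdet : M.det = D.det := by
    rw [hM, Matrix.det_mul_comm, ← mul_assoc, Units.inv_mul, one_mul]
  have h01 : D 0 1 = 0 := hU (by simp)
  have h10 : D 1 0 = 0 := hU (by simp)
  rw [Matrix.trace_fin_two, Matrix.trace_fin_two] at htr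
  rw [Matrix.det_fin_two, Matrix.det_fin_two, h01, h10] at hdet
  have h2 : (D 0 0 - D 1 1) ^ 2 = 0 := by
    unfold disc at hd
    have : (D 0 0 - D 1 1) ^ 2 = (D 0 0 + D 1 1) ^ 2 - 4 * (D 0 0 * D 1 1) := by ring
    rw [this, ← htr]
    linear_combination hd + 4 * hdet
  have h3 : D 0 0 = D 1 1 := sub_eq_zero.1 (pow_eq_zero_iff two_ne_zero |>.1 h2)
  have hD1 : D = D 0 0 • (1 : Mat2) := by
    ext i j
    fin_cases i <;> fin_cases j <;> simp [h01, h10, h3]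
  refine ⟨D 0 0, ?_⟩
  rw [hM]
  nth_rewrite 1 [hD1]
  rw [Matrix.mul_smul, Matrix.smul_mul, mul_one, Units.mul_inv]

/-- A diagonalisable matrix with a double eigenvalue is scalar, hence commutes with everything. -/
theorem disc_pos_of_diagonalisable {M N : Mat2} (hM : EntriesNonneg M) (hF : fricke M N ≠ 0)
    (h : Diagonalisable M) : 0 < disc M := by
  refine lt_of_le_of_ne hM.disc_nonneg fun h0 => hF ?_
  obtain ⟨c, rfl⟩ := eq_smul_one_of_diagonalisable h h0.symm
  simp [fricke]

/-- Here M = a + T with T² = 0, so the normalised powers grow linearly. The growth rate tr(TN)/a is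
positive, since its vanishing would kill the Fricke polynomial. -/
theorem tendsto_trace_pow_mul_atTop {M N : Mat2} (hM : EntriesNonneg M) (hN : EntriesNonneg N)
    (ht : 0 < M.trace) (hd : disc M = 0) (hF : fricke M N ≠ 0) :
    Tendsto (fun n : ℕ => (M ^ n * N).trace / specRad M ^ n) atTop atTop := by
  have hbc := mul_nonneg (hM 0 1) (hM 1 0)
  have had : M 0 0 = M 1 1 := by
    unfold disc at hd
    have : (M 0 0 - M 1 1) ^ 2 = 0 := by nlinarith [sq_nonneg (M 0 0 - M 1 1)]
    exact sub_eq_zero.1 (pow_eq_zero_iff two_ne_zero |>.1 this)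
  have hbc0 : M 0 1 * M 1 0 = 0 := by
    unfold disc at hd; nlinarith [sq_nonneg (M 0 0 - M 1 1)]
  have hρ : specRad M = M 0 0 := by
    rw [specRad_eq hM]; unfold eigMax; rw [hd, Real.sqrt_zero, ← had]; ring
  have ha : 0 < M 0 0 := by
    rw [Matrix.trace_fin_two, ← had] at ht; linarith
  rw [hρ]
  have hpow : ∀ n : ℕ, M ^ n = M 0 0 ^ n • (1 : Mat2)
      + (n * M 0 0 ^ n / M 0 0) • (M - M 0 0 • (1 : Mat2)) := by
    intro n
    induction n with
    | zero => simp
    | succ n ih =>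
      have hsq : (M - M 0 0 • (1 : Mat2)) * M = M 0 0 • (M - M 0 0 • (1 : Mat2)) := by
        have h2 : M.trace = 2 * M 0 0 := by rw [Matrix.trace_fin_two, ← had]; ring
        have h3 : M.det = M 0 0 ^ 2 := by rw [Matrix.det_fin_two, ← had, hbc0]; ring
        rw [sub_mul, cayley_hamilton, h2, h3, Matrix.smul_mul, one_mul]
        module
      rw [pow_succ, ih, add_mul, Matrix.smul_mul, Matrix.smul_mul, hsq, one_mul, smul_smul]
      have : M 0 0 ^ n • M = M 0 0 ^ (n + 1) • (1 : Mat2)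
          + M 0 0 ^ n • (M - M 0 0 • (1 : Mat2)) := by
        rw [smul_sub, smul_smul, pow_succ]; abel
      rw [this, add_assoc, ← add_smul]
      congr 2
      push_cast
      field_simp
      ring
  have hpos : 0 < M 0 1 * N 1 0 + M 1 0 * N 0 1 := by
    have h1 := mul_nonneg (hM 0 1) (hN 1 0)
    have h2 := mul_nonneg (hM 1 0) (hN 0 1)
    refine lt_of_le_of_ne (add_nonneg h1 h2) fun h0 => hF ?_
    have h3 : M 0 1 * N 1 0 = 0 := by linarith
    have h4 : M 1 0 * N 0 1 = 0 := by linarith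
    unfold fricke
    simp only [Matrix.det_fin_two, Matrix.mul_apply, Fin.sum_univ_two, Matrix.sub_apply, ← had]
    linear_combination (M 0 1 * N 1 0 - M 1 0 * N 0 1) * h3 + (M 1 0 * N 0 1 - M 0 1 * N 1 0) * h4
      - (N 1 1 - N 0 0) ^ 2 * hbc0
  have hval : ∀ n : ℕ, (M ^ n * N).trace / M 0 0 ^ n
      = n * ((M 0 1 * N 1 0 + M 1 0 * N 0 1) / M 0 0) + N.trace := by
    intro n
    rw [hpow n, add_mul, Matrix.trace_add, Matrix.smul_mul, Matrix.smul_mul, Matrix.trace_smul,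
      Matrix.trace_smul, one_mul]
    have : ((M - M 0 0 • (1 : Mat2)) * N).trace = M 0 1 * N 1 0 + M 1 0 * N 0 1 := by
      simp [Matrix.trace_fin_two, Matrix.mul_apply, Fin.sum_univ_two, ← had]
    rw [this]
    simp only [smul_eq_mul]
    field_simp
    ring
  simp_rw [hval]
  exact tendsto_atTop_add_const_right _ _
    (tendsto_natCast_atTop_atTop.atTop_mul_const (div_pos hpos ha))

/-! ### Words and standard pairs -/

theorem ones_append (u v : Word) : ones (u ++ v) = ones u + ones v := List.count_append

theorem ones_le_length (u : Word) : ones u ≤ u.length := List.count_le_length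

/-- The `n`-fold repetition of a word. -/
def wordRep (u : Word) : ℕ → Word
  | 0 => []
  | n + 1 => wordRep u n ++ u

theorem ones_wordRep (u : Word) (n : ℕ) : ones (wordRep u n) = n * ones u := by
  induction n with
  | zero => simp [wordRep, ones]
  | succ n ih => rw [wordRep, ones_append, ih]; ring

theorem length_wordRep (u : Word) (n : ℕ) : (wordRep u n).length = n * u.length := by
  induction n with
  | zero => simp [wordRep]
  | succ n ih => rw [wordRep, List.length_append, ih]; ring

theorem wordProd_append (B : Fin 2 → Mat2) (u v : Word) :
    wordProd B (u ++ v) = wordProd B v * wordProd B u := by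
  simp [wordProd]

@[simp] theorem wordProd_nil (B : Fin 2 → Mat2) : wordProd B [] = 1 := by simp [wordProd]

@[simp] theorem wordProd_singleton (B : Fin 2 → Mat2) (k : Fin 2) : wordProd B [k] = B k := by
  simp [wordProd]

theorem wordProd_cons (B : Fin 2 → Mat2) (k : Fin 2) (u : Word) :
    wordProd B (k :: u) = wordProd B u * B k := by
  rw [← List.singleton_append, wordProd_append, wordProd_singleton]

theorem wordProd_wordRep (B : Fin 2 → Mat2) (u : Word) (n : ℕ) :
    wordProd B (wordRep u n) = wordProd B u ^ n := by
  induction n with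
  | zero => simp [wordRep]
  | succ n ih => rw [wordRep, wordProd_append, ih, pow_succ']

theorem wordProd_scaled (A : Fin 2 → Mat2) (α : ℝ) (u : Word) :
    wordProd (scaled A α) u = α ^ ones u • wordProd A u := by
  induction u with
  | nil => simp [ones]
  | cons k u ih =>
    rw [wordProd_cons, wordProd_cons, ih]
    fin_cases k
    · simp [scaled, ones]
    · simp only [scaled, ones, Fin.mk_one, Matrix.cons_val_one, List.count_cons_self]
      rw [Matrix.smul_mul, Matrix.cons_val_zero, Matrix.mul_smul, smul_smul, pow_succ]

theorem entriesNonneg_wordProd {B : Fin 2 → Mat2} (hB : ∀ k, EntriesNonneg (B k)) (u : Word) :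
    EntriesNonneg (wordProd B u) := by
  induction u with
  | nil => simpa using entriesNonneg_one
  | cons k u ih => rw [wordProd_cons]; exact ih.mul (hB k)

theorem det_wordProd_ne_zero {A : Fin 2 → Mat2} (hA : TechnicalHypotheses A) (u : Word) :
    (wordProd A u).det ≠ 0 := by
  induction u with
  | nil => simp
  | cons k u ih =>
    rw [wordProd_cons, Matrix.det_mul]
    exact mul_ne_zero ih ((Matrix.isUnit_iff_isUnit_det _).1 (hA.invertible k)).ne_zero

theorem wordProd_pos {A : Fin 2 → Mat2} (hA : TechnicalHypotheses A) {u : Word}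
    (h0 : 0 < ones u) (h1 : ones u < u.length) (i j : Fin 2) : 0 < wordProd A u i j := by
  refine hA.mixed_pos u (fun n k hu => ?_) i j
  subst hu
  fin_cases k <;> simp [ones, List.count_replicate] at h0 h1

namespace IsStandardPair

variable {u v : Word}

theorem length_pos (h : IsStandardPair u v) : 0 < u.length ∧ 0 < v.length := by
  induction h with
  | base => simp
  | left _ ih => simp; omega
  | right _ ih => simp; omega

/-- Adding one column of a 2 × 2 integer matrix to the other preserves its determinant; the slopes
of a standard pair are Farey neighbours. -/
theorem det_eq (h : IsStandardPair u v) :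
    ones v * u.length = ones u * v.length + 1 := by
  induction h with
  | base => simp [ones]
  | left _ ih => rw [ones_append, List.length_append]; linarith
  | right _ ih => rw [ones_append, List.length_append]; linarith

theorem ones_lt (h : IsStandardPair u v) : ones u < u.length ∧ 0 < ones v := by
  induction h with
  | base => simp [ones]
  | @left u v _ ih =>
    rw [ones_append, List.length_append]
    have := ones_le_length v
    omega
  | @right u v _ ih =>
    rw [ones_append]
    omega

theorem ones_append_pos (h : IsStandardPair u v) : 0 < ones (u ++ v) := by
  rw [ones_append]; have := h.ones_lt; omega

theorem ones_append_lt (h : IsStandardPair u v) : ones (u ++ v) < (u ++ v).length := by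
  rw [ones_append, List.length_append]
  have := h.ones_lt
  have := ones_le_length v
  omega

theorem coprime (h : IsStandardPair u v) : (ones (u ++ v)).Coprime (u ++ v).length := by
  have hd := h.det_eq
  rw [ones_append, List.length_append]
  have : IsCoprime ((ones u + ones v : ℕ) : ℤ) ((u.length + v.length : ℕ) : ℤ) := by
    refine ⟨u.length, - ones u, ?_⟩
    push_cast
    have : (ones v : ℤ) * u.length = ones u * v.length + 1 := by exact_mod_cast hd
    linear_combination this
  exact Nat.isCoprime_iff_coprime.1 this

/-- Appending the same word to both products preserves the property: uv and vu differ only in their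
first two letters. -/
theorem exists_common_tail (h : IsStandardPair u v) :
    ∃ p : Word, u ++ v = 0 :: 1 :: p ∧ v ++ u = 1 :: 0 :: p := by
  induction h with
  | base => exact ⟨[], rfl, rfl⟩
  | @left u v _ ih =>
    obtain ⟨p, h1, h2⟩ := ih
    refine ⟨p ++ v, ?_, ?_⟩
    · rw [h1]; simp
    · rw [← List.append_assoc, h2]; simp
  | @right u v _ ih =>
    obtain ⟨p, h1, h2⟩ := ih
    refine ⟨p ++ u, ?_, ?_⟩
    · rw [← List.append_assoc, h1]; simp
    · rw [h2]; simp

theorem left_eq (h : IsStandardPair u v) :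
    u = [0] ∨ ∃ x y, IsStandardPair x y ∧ u = x ++ y := by
  induction h with
  | base => exact Or.inl rfl
  | @left u v h _ => exact Or.inr ⟨u, v, h, rfl⟩
  | right _ ih => exact ih

theorem right_eq (h : IsStandardPair u v) :
    v = [1] ∨ ∃ x y, IsStandardPair x y ∧ v = y ++ x := by
  induction h with
  | base => exact Or.inl rfl
  | left _ ih => exact ih
  | @right u v h _ => exact Or.inr ⟨u, v, h, rfl⟩

theorem iterate_left (h : IsStandardPair u v) (n : ℕ) :
    IsStandardPair (u ++ wordRep v n) v := by
  induction n with
  | zero => simpa [wordRep] using h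
  | succ n ih => rw [wordRep, ← List.append_assoc]; exact ih.left

theorem iterate_right (h : IsStandardPair u v) (n : ℕ) :
    IsStandardPair u (v ++ wordRep u n) := by
  induction n with
  | zero => simpa [wordRep] using h
  | succ n ih => rw [wordRep, ← List.append_assoc]; exact ih.right

/-- The subtractive Euclidean algorithm on (a, b), each subtraction being matched by one move in the
tree of pairs. -/
theorem exists_combination (h : IsStandardPair u v) (a b : ℕ) (ha : 0 < a) (hb : 0 < b)
    (hab : a.Coprime b) : ∃ x y, IsStandardPair x y ∧
      ones (x ++ y) = a * ones u + b * ones v ∧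
      (x ++ y).length = a * u.length + b * v.length := by
  induction hn : a + b using Nat.strong_induction_on generalizing a b u v with
  | _ n ih =>
  rcases lt_trichotomy a b with hlt | rfl | hlt
  · obtain ⟨c, rfl⟩ := Nat.exists_eq_add_of_lt hlt
    have hc : a.Coprime (c + 1) := by
      rw [add_assoc] at hab
      exact Nat.coprime_add_self_right.1 (by rwa [add_comm])
    obtain ⟨x, y, hxy, h1, h2⟩ := ih (a + (c + 1)) (by omega) h.left a (c + 1) ha (by omega)
      hc rfl
    refine ⟨x, y, hxy, ?_, ?_⟩
    · rw [h1, ones_append]; ring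
    · rw [h2, List.length_append]; ring
  · have : a = 1 := by simpa using hab
    subst this
    exact ⟨u, v, h, by rw [ones_append]; ring, by rw [List.length_append]; ring⟩
  · obtain ⟨c, rfl⟩ := Nat.exists_eq_add_of_lt hlt
    have hc : (c + 1).Coprime b := by
      rw [add_assoc] at hab
      exact Nat.coprime_add_self_left.1 (by rwa [add_comm])
    obtain ⟨x, y, hxy, h1, h2⟩ := ih (c + 1 + b) (by omega) h.right (c + 1) b (by omega) hb
      hc rfl
    refine ⟨x, y, hxy, ?_, ?_⟩
    · rw [h1, ones_append]; ring
    · rw [h2, List.length_append]; ring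

end IsStandardPair

theorem exists_isStandardPair {p q : ℕ} (hp : 0 < p) (hpq : p < q) (hc : p.Coprime q) :
    ∃ u v, IsStandardPair u v ∧ ones (u ++ v) = p ∧ (u ++ v).length = q := by
  obtain ⟨d, rfl⟩ := Nat.exists_eq_add_of_lt hpq
  have hc' : (d + 1).Coprime p := by
    rw [add_assoc, add_comm] at hc
    exact (Nat.coprime_add_self_right.1 hc).symm
  obtain ⟨u, v, h, h1, h2⟩ := IsStandardPair.base.exists_combination (d + 1) p (by omega) hp hc'
  refine ⟨u, v, h, ?_, ?_⟩
  · rw [h1]; simp [ones]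
  · rw [h2]; simp; omega

/-- Each move multiplies both sides by the determinant of the word product that is appended, so the
Fricke polynomial divided by the two determinants is constant on the whole tree. -/
theorem fricke_wordProd (A : Fin 2 → Mat2) {u v : Word} (h : IsStandardPair u v) :
    fricke (wordProd A u) (wordProd A v) * ((A 0).det * (A 1).det) =
      fricke (A 0) (A 1) * ((wordProd A u).det * (wordProd A v).det) := by
  induction h with
  | base => simp
  | left _ ih =>
    rw [wordProd_append, fricke_mul_left, Matrix.det_mul]
    linear_combination (wordProd A _).det * ih
  | right _ ih =>
    rw [wordProd_append, fricke_swap, fricke_mul_left, fricke_swap, Matrix.det_mul]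
    linear_combination (wordProd A _).det * ih

/-! ### Counting ones in prefixes of standard words -/

theorem ones_take_append (u v : Word) (n : ℕ) :
    ones ((u ++ v).take n) = ones (u.take n) + ones (v.take (n - u.length)) := by
  rw [List.take_append, ones_append]

/-- Integrality absorbs the error made when a discrepancy bound is transferred between neighbouring
slopes, after multiplication by the old denominator. -/
theorem nonneg_of_neg_lt_mul {q y : ℤ} (hq : 0 < q) (h : -q < q * y) : 0 ≤ y := by
  by_contra hy
  have : y ≤ -1 := by omega
  nlinarith

/-- The discrepancies of all prefixes of `uv` lie in a window of length `|uv|`. -/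
def PrefixBound (u v : Word) : Prop := ∀ n : ℕ, n ≤ (u ++ v).length →
  -(ones (u ++ v) : ℤ) ≤ (u ++ v).length * ones ((u ++ v).take n) - ones (u ++ v) * n ∧
  ((u ++ v).length : ℤ) * ones ((u ++ v).take n) - ones (u ++ v) * n
    ≤ (u ++ v).length - ones (u ++ v) - 1

theorem PrefixBound.swap {u v : Word} (h : IsStandardPair u v) (hb : PrefixBound u v) (n : ℕ)
    (hn : n ≤ (u ++ v).length) :
    1 - (ones (u ++ v) : ℤ) ≤ (u ++ v).length * ones ((v ++ u).take n) - ones (u ++ v) * n ∧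
    ((u ++ v).length : ℤ) * ones ((v ++ u).take n) - ones (u ++ v) * n
      ≤ (u ++ v).length - ones (u ++ v) := by
  have hp := h.ones_append_pos
  have hpq := h.ones_append_lt
  obtain ⟨t, h1, h2⟩ := h.exists_common_tail
  have hbn := hb n hn
  have hc := h.coprime
  rcases n with _ | _ | n
  · have h0 : ones ((v ++ u).take 0) = 0 := by simp [ones]
    rw [h0]
    push_cast
    constructor <;> linarith
  · have h1 : ones ((v ++ u).take (0 + 1)) = 1 := by rw [h2]; simp [ones]
    rw [h1]
    push_cast
    constructor <;> linarith
  · have he : ones ((v ++ u).take (n + 1 + 1)) = ones ((u ++ v).take (n + 1 + 1)) := by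
      rw [h1, h2]; simp [ones]
    rw [he]
    refine ⟨?_, by linarith [hbn.2]⟩
    -- Equality would make the length divide ones · (n + 1), hence by coprimality n + 1, which is
    -- smaller than the length.
    rcases hbn.1.lt_or_eq with hlt | heq
    · linarith
    · exfalso
      push_cast at heq
      have hdvd : ((u ++ v).length : ℤ) ∣ (ones (u ++ v) : ℤ) * (n + 1 : ℕ) :=
        ⟨ones ((u ++ v).take (n + 1 + 1)), by push_cast; linarith⟩
      have hdvd' : (u ++ v).length ∣ ones (u ++ v) * (n + 1) := by exact_mod_cast hdvd
      have := Nat.le_of_dvd (Nat.succ_pos n) (hc.symm.dvd_of_dvd_mul_left hdvd')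
      omega

/-- Induction on the tree: a prefix of the longer word is either a prefix of uv, or uv followed by a
prefix of the appended word. In the left move that second piece is a prefix of vu, which is why the
sharpened bounds for vu are needed. -/
theorem IsStandardPair.prefixBound {u v : Word} (h : IsStandardPair u v) : PrefixBound u v := by
  induction h with
  | base =>
    intro n hn
    simp at hn
    interval_cases n <;> simp [ones]
  | @left u v h ih =>
    intro n hn
    have hsw := PrefixBound.swap h ih
    have hq := h.length_pos
    have hd := h.det_eq
    rw [ones_take_append (u ++ v) v, ones_append (u ++ v) v, List.length_append (as := u ++ v)]
    rw [List.length_append] at hn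
    have hd' : (ones v : ℤ) * (u ++ v).length = ones (u ++ v) * v.length + 1 := by
      rw [ones_append, List.length_append]; push_cast
      have : (ones v : ℤ) * u.length = ones u * v.length + 1 := by exact_mod_cast hd
      linear_combination this
    have hqq : (2 : ℤ) ≤ (u ++ v).length := by rw [List.length_append]; push_cast; omega
    have hq2 : (1 : ℤ) ≤ v.length := by omega
    rcases le_total n (u ++ v).length with hle | hle
    · obtain ⟨hb1, hb2⟩ := ih n hle
      rw [Nat.sub_eq_zero_of_le hle]
      have hz : ones (v.take 0) = 0 := by simp [ones]
      rw [hz]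
      have hle' : (n : ℤ) ≤ (u ++ v).length := by exact_mod_cast hle
      have hn0 : (0 : ℤ) ≤ n := by positivity
      generalize ((u ++ v).length : ℕ) = q at *
      generalize (ones (u ++ v)) = p at *
      generalize ones (List.take n (u ++ v)) = k at *
      push_cast
      rw [← sub_nonneg, ← sub_nonneg (b := ((q : ℤ) + _) * _ - _)]
      constructor
      · apply nonneg_of_neg_lt_mul (q := q) (by omega)
        nlinarith [mul_nonneg (show (0 : ℤ) ≤ q + v.length by omega) (sub_nonneg.2 hb1)]
      · apply nonneg_of_neg_lt_mul (q := q) (by omega)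
        nlinarith [mul_nonneg (show (0 : ℤ) ≤ q + v.length by omega) (sub_nonneg.2 hb2)]
    · obtain ⟨m, rfl⟩ := Nat.exists_eq_add_of_le hle
      have hm : m ≤ v.length := by omega
      have hmq : m ≤ (u ++ v).length := by rw [List.length_append]; omega
      obtain ⟨hb1, hb2⟩ := hsw m hmq
      rw [ones_take_append v u m, Nat.sub_eq_zero_of_le hm] at hb1 hb2
      have hz : ones (u.take 0) = 0 := by simp [ones]
      rw [hz, add_zero] at hb1 hb2
      rw [List.take_of_length_le (by omega : (u ++ v).length ≤ (u ++ v).length + m),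
        Nat.add_sub_cancel_left]
      have hm' : (m : ℤ) ≤ v.length := by exact_mod_cast hm
      have hm0 : (0 : ℤ) ≤ m := by positivity
      generalize ((u ++ v).length : ℕ) = q at *
      generalize (ones (u ++ v)) = p at *
      generalize ones (List.take m v) = k at *
      push_cast
      rw [← sub_nonneg, ← sub_nonneg (b := ((q : ℤ) + _) * _ - _)]
      constructor
      · apply nonneg_of_neg_lt_mul (q := q) (by omega)
        nlinarith [mul_nonneg (show (0 : ℤ) ≤ q + v.length by omega) (sub_nonneg.2 hb1)]
      · apply nonneg_of_neg_lt_mul (q := q) (by omega)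
        nlinarith [mul_nonneg (show (0 : ℤ) ≤ q + v.length by omega) (sub_nonneg.2 hb2)]
  | @right u v h ih =>
    intro n hn
    have hq := h.length_pos
    have hd := h.det_eq
    rw [← List.append_assoc] at hn ⊢
    rw [ones_take_append (u ++ v) u, ones_append (u ++ v) u, List.length_append (as := u ++ v)]
    rw [List.length_append] at hn
    have hd' : (ones (u ++ v) : ℤ) * u.length = ones u * (u ++ v).length + 1 := by
      rw [ones_append, List.length_append]; push_cast
      have : (ones v : ℤ) * u.length = ones u * v.length + 1 := by exact_mod_cast hd
      linear_combination this
    have hqq : (2 : ℤ) ≤ (u ++ v).length := by rw [List.length_append]; push_cast; omega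
    have hq2 : (1 : ℤ) ≤ u.length := by omega
    rcases le_total n (u ++ v).length with hle | hle
    · obtain ⟨hb1, hb2⟩ := ih n hle
      rw [Nat.sub_eq_zero_of_le hle]
      have hz : ones (u.take 0) = 0 := by simp [ones]
      rw [hz]
      have hle' : (n : ℤ) ≤ (u ++ v).length := by exact_mod_cast hle
      have hn0 : (0 : ℤ) ≤ n := by positivity
      generalize ((u ++ v).length : ℕ) = q at *
      generalize (ones (u ++ v)) = p at *
      generalize ones (List.take n (u ++ v)) = k at *
      push_cast
      rw [← sub_nonneg, ← sub_nonneg (b := ((q : ℤ) + _) * _ - _)]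
      constructor
      · apply nonneg_of_neg_lt_mul (q := q) (by omega)
        nlinarith [mul_nonneg (show (0 : ℤ) ≤ q + u.length by omega) (sub_nonneg.2 hb1)]
      · apply nonneg_of_neg_lt_mul (q := q) (by omega)
        nlinarith [mul_nonneg (show (0 : ℤ) ≤ q + u.length by omega) (sub_nonneg.2 hb2)]
    · obtain ⟨m, rfl⟩ := Nat.exists_eq_add_of_le hle
      have hm : m ≤ u.length := by omega
      have hmq : m ≤ (u ++ v).length := by rw [List.length_append]; omega
      obtain ⟨hb1, hb2⟩ := ih m hmq
      rw [ones_take_append u v m, Nat.sub_eq_zero_of_le hm] at hb1 hb2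
      have hz : ones (v.take 0) = 0 := by simp [ones]
      rw [hz, add_zero] at hb1 hb2
      rw [List.take_of_length_le (by omega : (u ++ v).length ≤ (u ++ v).length + m),
        Nat.add_sub_cancel_left]
      have hm' : (m : ℤ) ≤ u.length := by exact_mod_cast hm
      have hm0 : (0 : ℤ) ≤ m := by positivity
      generalize ((u ++ v).length : ℕ) = q at *
      generalize (ones (u ++ v)) = p at *
      generalize ones (List.take m u) = k at *
      push_cast
      rw [← sub_nonneg, ← sub_nonneg (b := ((q : ℤ) + _) * _ - _)]
      constructor
      · apply nonneg_of_neg_lt_mul (q := q) (by omega)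
        nlinarith [mul_nonneg (show (0 : ℤ) ≤ q + u.length by omega) (sub_nonneg.2 hb1)]
      · apply nonneg_of_neg_lt_mul (q := q) (by omega)
        nlinarith [mul_nonneg (show (0 : ℤ) ≤ q + u.length by omega) (sub_nonneg.2 hb2)]

/-! ### Infinite sequences and Sturmian words -/

/-- The number of ones among the first `n` letters of an infinite word. -/
def onesUpTo (x : ℕ → Fin 2) (n : ℕ) : ℕ := ((Finset.range n).filter fun i => x i = 1).card

@[simp] theorem onesUpTo_zero (x : ℕ → Fin 2) : onesUpTo x 0 = 0 := by simp [onesUpTo]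

theorem onesUpTo_succ (x : ℕ → Fin 2) (n : ℕ) :
    onesUpTo x (n + 1) = onesUpTo x n + (x n : ℕ) := by
  unfold onesUpTo
  rw [Finset.range_add_one, Finset.filter_insert]
  rcases Fin.exists_fin_two.1 ⟨x n, rfl⟩ with h | h
  · simp [h]
  · rw [h, if_pos rfl, Finset.card_insert_of_notMem (by simp)]
    simp

theorem ofFn_succ_eq_append (x : ℕ → Fin 2) (n : ℕ) :
    (List.ofFn fun i : Fin (n + 1) => x i) = (List.ofFn fun i : Fin n => x i) ++ [x n] := by
  rw [List.ofFn_succ', List.concat_eq_append]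
  simp

theorem ones_ofFn (x : ℕ → Fin 2) (n : ℕ) :
    ones (List.ofFn fun i : Fin n => x i) = onesUpTo x n := by
  induction n with
  | zero => simp [ones]
  | succ n ih =>
    rw [ofFn_succ_eq_append, ones_append, ih, onesUpTo_succ]
    congr 1
    rcases Fin.exists_fin_two.1 ⟨x n, rfl⟩ with h | h <;> simp [h, ones]

@[simp] theorem seqProd_zero (B : Fin 2 → Mat2) (x : ℕ → Fin 2) : seqProd B x 0 = 1 := by
  simp [seqProd]

theorem seqProd_succ (B : Fin 2 → Mat2) (x : ℕ → Fin 2) (n : ℕ) :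
    seqProd B x (n + 1) = B (x n) * seqProd B x n := by
  rw [seqProd, ofFn_succ_eq_append, wordProd_append, wordProd_singleton, seqProd]

theorem seqProd_add (B : Fin 2 → Mat2) (x : ℕ → Fin 2) (m n : ℕ) :
    seqProd B x (m + n) = seqProd B (fun i => x (m + i)) n * seqProd B x m := by
  induction n with
  | zero => simp
  | succ n ih => rw [← add_assoc, seqProd_succ, ih, seqProd_succ, mul_assoc]

theorem seqProd_congr (B : Fin 2 → Mat2) {x y : ℕ → Fin 2} {n : ℕ} (h : ∀ i < n, x i = y i) :
    seqProd B x n = seqProd B y n := by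
  unfold seqProd
  congr 2
  ext i
  rw [h i i.2]

theorem onesUpTo_congr {x y : ℕ → Fin 2} {n : ℕ} (h : ∀ i < n, x i = y i) :
    onesUpTo x n = onesUpTo y n := by
  unfold onesUpTo
  congr 1
  apply Finset.filter_congr
  intro i hi
  rw [h i (Finset.mem_range.1 hi)]

theorem seqProd_scaled (A : Fin 2 → Mat2) (α : ℝ) (x : ℕ → Fin 2) (n : ℕ) :
    seqProd (scaled A α) x n = α ^ onesUpTo x n • seqProd A x n := by
  rw [seqProd, wordProd_scaled, ones_ofFn, seqProd]

/-- The periodic sequence `www…`. -/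
def perSeq (w : Word) (n : ℕ) : Fin 2 := w.getD (n % w.length) 0

theorem perSeq_add_length (w : Word) (n : ℕ) : perSeq w (w.length + n) = perSeq w n := by
  simp [perSeq]

theorem ofFn_perSeq (w : Word) (n : ℕ) (hn : n ≤ w.length) :
    (List.ofFn fun i : Fin n => perSeq w i) = w.take n := by
  apply List.ext_getElem
  · simp [hn]
  · intro i h1 h2
    have hi : i < w.length := by simp at h2; omega
    simp [perSeq, Nat.mod_eq_of_lt hi, hi]

theorem seqProd_perSeq (B : Fin 2 → Mat2) (w : Word) (n : ℕ) :
    seqProd B (perSeq w) (n * w.length) = wordProd B w ^ n := by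
  induction n with
  | zero => simp
  | succ n ih =>
    rw [add_mul, one_mul, add_comm, seqProd_add]
    simp_rw [perSeq_add_length]
    rw [ih, pow_succ]
    congr 1
    rw [seqProd, ofFn_perSeq w _ le_rfl, List.take_length]

theorem onesUpTo_perSeq (w : Word) {n : ℕ} (hn : n ≤ w.length) :
    onesUpTo (perSeq w) n = ones (w.take n) := by
  rw [← ones_ofFn, ofFn_perSeq w n hn]

theorem onesUpTo_add (x : ℕ → Fin 2) (m n : ℕ) :
    onesUpTo x (m + n) = onesUpTo x m + onesUpTo (fun i => x (m + i)) n := by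
  induction n with
  | zero => simp
  | succ n ih => rw [← add_assoc, onesUpTo_succ, ih, onesUpTo_succ, add_assoc]

theorem onesUpTo_perSeq_add_mul (w : Word) (n j : ℕ) :
    onesUpTo (perSeq w) (w.length * n + j) = n * ones w + onesUpTo (perSeq w) j := by
  induction n with
  | zero => simp
  | succ n ih =>
    have : w.length * (n + 1) + j = w.length + (w.length * n + j) := by ring
    rw [this, onesUpTo_add]
    simp_rw [perSeq_add_length]
    rw [ih, onesUpTo_perSeq w le_rfl, List.take_length]
    ring

/-- With q the length and p the number of ones, the prefix discrepancies times q lie in {−p, …, q −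
p − 1}, a window of q integers; the offset (q − p − 1)/q is its upper end. -/
theorem onesUpTo_perSeq_eq_floor {u v : Word} (h : IsStandardPair u v) (n : ℕ) :
    (onesUpTo (perSeq (u ++ v)) n : ℤ) = ⌊wordSlope (u ++ v) * n +
      (((u ++ v).length : ℝ) - ones (u ++ v) - 1) / (u ++ v).length⌋ := by
  have hq : 0 < (u ++ v).length := by
    rw [List.length_append]; have := h.length_pos; omega
  have hj := Nat.mod_lt n hq
  obtain ⟨hb1, hb2⟩ := h.prefixBound (n % (u ++ v).length) hj.le
  rw [← onesUpTo_perSeq _ hj.le] at hb1 hb2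
  have hk := onesUpTo_perSeq_add_mul (u ++ v) (n / (u ++ v).length) (n % (u ++ v).length)
  have hn : (u ++ v).length * (n / (u ++ v).length) + n % (u ++ v).length = n :=
    Nat.div_add_mod _ _
  rw [hn] at hk
  rw [hk]
  have hqR : (0 : ℝ) < (u ++ v).length := by exact_mod_cast hq
  have hnR : ((u ++ v).length : ℝ) * (n / (u ++ v).length : ℕ) + (n % (u ++ v).length : ℕ) = n := by
    exact_mod_cast hn
  symm
  rw [Int.floor_eq_iff]
  unfold wordSlope
  have hb1' : -(ones (u ++ v) : ℝ) ≤ (u ++ v).length *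
      onesUpTo (perSeq (u ++ v)) (n % (u ++ v).length) - ones (u ++ v) *
        (n % (u ++ v).length : ℕ) := by exact_mod_cast hb1
  have hb2' : ((u ++ v).length : ℝ) *
      onesUpTo (perSeq (u ++ v)) (n % (u ++ v).length) - ones (u ++ v) *
        (n % (u ++ v).length : ℕ) ≤ (u ++ v).length - ones (u ++ v) - 1 := by exact_mod_cast hb2
  rw [← hnR]
  generalize ((n / (u ++ v).length : ℕ)) = a at *
  generalize ((n % (u ++ v).length : ℕ)) = j at *
  generalize onesUpTo (perSeq (u ++ v)) j = k at *
  generalize ones (u ++ v) = p at *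
  generalize (u ++ v).length = q at *
  push_cast
  have he : (p : ℝ) / q * (q * a + j) + (q - p - 1) / q
      = a * p + (p * j + (q - p - 1)) / q := by
    field_simp
    ring
  rw [he]
  constructor
  · have : (k : ℝ) ≤ (p * j + (q - p - 1)) / q := by
      rw [le_div_iff₀ hqR]; linarith
    linarith
  · have : (p * j + (q - p - 1)) / q < (k : ℝ) + 1 := by
      rw [div_lt_iff₀ hqR]; linarith
    linarith

theorem perSeq_mem_sturmianSet {u v : Word} (h : IsStandardPair u v) :
    perSeq (u ++ v) ∈ sturmianSet (wordSlope (u ++ v)) := by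
  refine ⟨(((u ++ v).length : ℝ) - ones (u ++ v) - 1) / (u ++ v).length, Or.inl fun n => ?_⟩
  have h1 := onesUpTo_perSeq_eq_floor h n
  have h2 := onesUpTo_perSeq_eq_floor h (n + 1)
  rw [onesUpTo_succ] at h2
  push_cast at h2
  rw [← h1, ← h2]
  ring

theorem const_zero_mem_sturmianSet : (fun _ => 0) ∈ sturmianSet 0 :=
  ⟨0, Or.inl fun n => by simp⟩

theorem const_one_mem_sturmianSet : (fun _ => 1) ∈ sturmianSet 1 := by
  refine ⟨0, Or.inl fun n => ?_⟩
  have h1 : ⌊(1 : ℝ) * (n + 1) + 0⌋ = n + 1 := by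
    rw [show (1 : ℝ) * (n + 1) + 0 = ((n + 1 : ℤ) : ℝ) by push_cast; ring, Int.floor_intCast]
  have h2 : ⌊(1 : ℝ) * n + 0⌋ = n := by
    rw [show (1 : ℝ) * n + 0 = ((n : ℤ) : ℝ) by push_cast; ring, Int.floor_intCast]
  rw [h1, h2]
  simp

theorem sturmianSet_nonempty {γ : ℝ} (h0 : 0 ≤ γ) (h1 : γ ≤ 1) : (sturmianSet γ).Nonempty := by
  have hlo : ∀ n : ℕ, ⌊γ * n + 0⌋ ≤ ⌊γ * ((n : ℝ) + 1) + 0⌋ := fun n =>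
    Int.floor_mono (by linarith)
  have hhi : ∀ n : ℕ, ⌊γ * ((n : ℝ) + 1) + 0⌋ ≤ ⌊γ * n + 0⌋ + 1 := fun n => by
    rw [← Int.floor_add_one]
    exact Int.floor_mono (by linarith)
  refine ⟨fun n => if ⌊γ * ((n : ℝ) + 1) + 0⌋ = ⌊γ * n + 0⌋ then 0 else 1, 0, Or.inl fun n => ?_⟩
  have := hlo n
  have := hhi n
  by_cases h : ⌊γ * ((n : ℝ) + 1) + 0⌋ = ⌊γ * n + 0⌋
  · simp only [h, if_true, sub_self, Fin.val_zero, Nat.cast_zero]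
  · simp only [if_neg h, Fin.val_one, Nat.cast_one]
    omega

theorem shift_mem_sturmianSet {γ : ℝ} {x : ℕ → Fin 2} (hx : x ∈ sturmianSet γ) (j : ℕ) :
    (fun i => x (j + i)) ∈ sturmianSet γ := by
  obtain ⟨δ, h | h⟩ := hx
  · refine ⟨γ * j + δ, Or.inl fun n => ?_⟩
    have := h (j + n)
    push_cast at this
    rw [this]
    congr 2 <;> ring
  · refine ⟨γ * j + δ, Or.inr fun n => ?_⟩
    have := h (j + n)
    push_cast at this
    rw [this]
    congr 2 <;> ring

/-- The floor or ceiling differences telescope. Uniformity in the sequence lets the frequency pass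
to limits of Sturmian sequences. -/
theorem abs_onesUpTo_sub_le {γ : ℝ} {x : ℕ → Fin 2} (hx : x ∈ sturmianSet γ) (n : ℕ) :
    |(onesUpTo x n : ℝ) - γ * n| ≤ 1 := by
  obtain ⟨δ, h | h⟩ := hx
  · have key : ∀ n : ℕ, (onesUpTo x n : ℤ) = ⌊γ * n + δ⌋ - ⌊δ⌋ := by
      intro n
      induction n with
      | zero => simp
      | succ n ih => rw [onesUpTo_succ]; push_cast; rw [ih, h n]; ring
    have hk : (onesUpTo x n : ℝ) = ⌊γ * n + δ⌋ - ⌊δ⌋ := by exact_mod_cast key n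
    rw [hk, abs_le]
    have := Int.floor_le (γ * n + δ)
    have := Int.lt_floor_add_one (γ * n + δ)
    have := Int.floor_le δ
    have := Int.lt_floor_add_one δ
    constructor <;> linarith
  · have key : ∀ n : ℕ, (onesUpTo x n : ℤ) = ⌈γ * n + δ⌉ - ⌈δ⌉ := by
      intro n
      induction n with
      | zero => simp
      | succ n ih => rw [onesUpTo_succ]; push_cast; rw [ih, h n]; ring
    have hk : (onesUpTo x n : ℝ) = ⌈γ * n + δ⌉ - ⌈δ⌉ := by exact_mod_cast key n
    rw [hk, abs_le]
    have := Int.le_ceil (γ * n + δ)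
    have := Int.ceil_lt_add_one (γ * n + δ)
    have := Int.le_ceil δ
    have := Int.ceil_lt_add_one δ
    constructor <;> linarith

theorem hasOneFrequency_of_bound {γ : ℝ} {x : ℕ → Fin 2}
    (h : ∀ n : ℕ, |(onesUpTo x n : ℝ) - γ * n| ≤ 1) : HasOneFrequency x γ := by
  change Tendsto (fun n : ℕ => (onesUpTo x n : ℝ) / n) atTop (𝓝 γ)
  rw [tendsto_iff_norm_sub_tendsto_zero]
  refine squeeze_zero' (Eventually.of_forall fun _ => norm_nonneg _) ?_
    tendsto_one_div_atTop_nhds_zero_nat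
  filter_upwards [eventually_gt_atTop 0] with n hn
  have hn' : (0 : ℝ) < n := by exact_mod_cast hn
  have : (onesUpTo x n : ℝ) / n - γ = (onesUpTo x n - γ * n) / n := by field_simp
  rw [this, Real.norm_eq_abs, abs_div, abs_of_pos hn']
  exact div_le_div_of_nonneg_right (h n) hn'.le

theorem HasOneFrequency.unique {x : ℕ → Fin 2} {γ γ' : ℝ} (h : HasOneFrequency x γ)
    (h' : HasOneFrequency x γ') : γ = γ' := tendsto_nhds_unique h h'

/-! ### The joint spectral radius -/

/-- The largest norm of a product of length `n`. -/
noncomputable def maxNorm (B : Fin 2 → Mat2) (n : ℕ) : ℝ :=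
  ⨆ w : Fin n → Fin 2, matNorm (wordProd B (List.ofFn w))

theorem matNorm_wordProd_le (B : Fin 2 → Mat2) (u : Word) :
    matNorm (wordProd B u) ≤ maxNorm B u.length := by
  have h := le_ciSup (f := fun w : Fin u.length → Fin 2 => matNorm (wordProd B (List.ofFn w)))
    (Set.finite_range _).bddAbove u.get
  rw [List.ofFn_get] at h
  exact h

theorem exists_maxNorm_eq (B : Fin 2 → Mat2) (n : ℕ) :
    ∃ u : Word, u.length = n ∧ matNorm (wordProd B u) = maxNorm B n := by
  obtain ⟨w, hw⟩ := exists_eq_ciSup_of_finite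
    (f := fun w : Fin n → Fin 2 => matNorm (wordProd B (List.ofFn w)))
  exact ⟨List.ofFn w, by simp, hw⟩

theorem maxNorm_nonneg (B : Fin 2 → Mat2) (n : ℕ) : 0 ≤ maxNorm B n := by
  obtain ⟨u, -, h⟩ := exists_maxNorm_eq B n
  exact h ▸ matNorm_nonneg _

theorem maxNorm_add_le (B : Fin 2 → Mat2) (m n : ℕ) :
    maxNorm B (m + n) ≤ maxNorm B m * maxNorm B n := by
  obtain ⟨u, hu, h⟩ := exists_maxNorm_eq B (m + n)
  rw [← h, ← List.take_append_drop m u, wordProd_append, mul_comm]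
  refine (matNorm_mul_le _ _).trans (mul_le_mul ?_ ?_ (matNorm_nonneg _) (maxNorm_nonneg _ _))
  · have := matNorm_wordProd_le B (u.drop m)
    rwa [List.length_drop, hu, Nat.add_sub_cancel_left] at this
  · have := matNorm_wordProd_le B (u.take m)
    rwa [List.length_take, hu, min_eq_left (by omega)] at this

theorem abs_det_le_matNorm_sq (M : Mat2) : |M.det| ≤ matNorm M ^ 2 := by
  rw [matNorm_eq, Matrix.det_fin_two, sq]
  have h1 : |M 0 0 * M 1 1 - M 0 1 * M 1 0| ≤ (|M 0 0| + |M 0 1|) * (|M 1 0| + |M 1 1|) := by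
    refine (abs_sub _ _).trans ?_
    rw [abs_mul, abs_mul]
    nlinarith [mul_nonneg (abs_nonneg (M 0 0)) (abs_nonneg (M 1 0)),
      mul_nonneg (abs_nonneg (M 0 1)) (abs_nonneg (M 1 1))]
  refine h1.trans (mul_le_mul (le_max_left _ _) (le_max_right _ _) (by positivity) (by positivity))

/-- Powers of an invertible matrix cannot decay faster than geometrically. This supplies the lower
bound for Fekete's lemma and the positivity of the joint spectral radius. -/
theorem half_log_det_le (B : Fin 2 → Mat2) (hB : (B 0).det ≠ 0) (n : ℕ) :
    0 < maxNorm B n ∧ n * (Real.log |(B 0).det| / 2) ≤ Real.log (maxNorm B n) := by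
  have h1 := matNorm_wordProd_le B (wordRep [0] n)
  rw [wordProd_wordRep, length_wordRep, wordProd_singleton, List.length_singleton, mul_one] at h1
  have h2 := abs_det_le_matNorm_sq (B 0 ^ n)
  rw [Matrix.det_pow, abs_pow] at h2
  have h3 : 0 < |(B 0).det| ^ n := pow_pos (abs_pos.2 hB) n
  have h4 : 0 < matNorm (B 0 ^ n) := by
    rcases (matNorm_nonneg (B 0 ^ n)).eq_or_lt with h | h
    · rw [← h] at h2; norm_num at h2; linarith
    · exact h
  refine ⟨h4.trans_le h1, ?_⟩
  have h5 := Real.log_le_log h3 h2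
  rw [Real.log_pow, Real.log_pow] at h5
  have h6 := Real.log_le_log h4 h1
  push_cast at h5
  linarith

/-- Fekete's lemma for the subadditive sequence of logarithms of `maxNorm`. -/
theorem tendsto_maxNorm (B : Fin 2 → Mat2) (hB : (B 0).det ≠ 0) :
    0 < jsr B ∧ Tendsto (fun n : ℕ => maxNorm B n ^ ((1 : ℝ) / n)) atTop (𝓝 (jsr B)) := by
  have hpos := fun n => (half_log_det_le B hB n).1
  have hsub : Subadditive fun n => Real.log (maxNorm B n) := fun m n => by
    rw [← Real.log_mul (hpos m).ne' (hpos n).ne']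
    exact Real.log_le_log (hpos _) (maxNorm_add_le B m n)
  have hbdd : BddBelow (Set.range fun n : ℕ => Real.log (maxNorm B n) / n) := by
    refine ⟨min 0 (Real.log |(B 0).det| / 2), ?_⟩
    rintro _ ⟨n, rfl⟩
    rcases Nat.eq_zero_or_pos n with rfl | hn
    · simp
    · have hn' : (0 : ℝ) < n := by exact_mod_cast hn
      refine (min_le_right _ _).trans ?_
      change _ ≤ Real.log (maxNorm B n) / n
      rw [le_div_iff₀ hn', mul_comm]
      exact (half_log_det_le B hB n).2
  have hlim := (Real.continuous_exp.tendsto _).comp (hsub.tendsto_lim hbdd)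
  have hlim' : Tendsto (fun n : ℕ => maxNorm B n ^ ((1 : ℝ) / n)) atTop
      (𝓝 (Real.exp hsub.lim)) := by
    refine hlim.congr fun n => ?_
    simp only [Function.comp]
    rw [Real.rpow_def_of_pos (hpos n), mul_one_div]
  have heq : jsr B = Real.exp hsub.lim := by
    refine Tendsto.limUnder_eq (hlim'.congr fun n => ?_)
    obtain ⟨u, hu, h⟩ := exists_maxNorm_eq B n
    refine le_antisymm ?_ (ciSup_le fun w => ?_)
    · have h1 := le_ciSup (f := fun w : Fin u.length → Fin 2 =>
        matNorm (wordProd B (List.ofFn w)) ^ ((1 : ℝ) / n)) (Set.finite_range _).bddAbove u.get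
      subst hu
      rw [← h]
      simpa using h1
    · refine Real.rpow_le_rpow (matNorm_nonneg _) ?_ (by positivity)
      simpa using matNorm_wordProd_le B (List.ofFn w)
  rw [heq]
  exact ⟨Real.exp_pos _, hlim'⟩

theorem matNorm_seqProd_le (B : Fin 2 → Mat2) (x : ℕ → Fin 2) (n : ℕ) :
    matNorm (seqProd B x n) ≤ maxNorm B n := by
  simpa [seqProd] using matNorm_wordProd_le B (List.ofFn fun i : Fin n => x i)

theorem le_jsr_of_tendsto {B : Fin 2 → Mat2} (hB : (B 0).det ≠ 0) {x : ℕ → Fin 2} {c : ℝ}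
    (h : Tendsto (fun n : ℕ => matNorm (seqProd B x n) ^ ((1 : ℝ) / n)) atTop (𝓝 c)) :
    c ≤ jsr B :=
  le_of_tendsto_of_tendsto' h (tendsto_maxNorm B hB).2 fun n =>
    Real.rpow_le_rpow (matNorm_nonneg _) (matNorm_seqProd_le B x n) (by positivity)

theorem tendsto_const_rpow_one_div {c : ℝ} (hc : 0 < c) :
    Tendsto (fun n : ℕ => c ^ ((1 : ℝ) / n)) atTop (𝓝 1) := by
  have h := (tendsto_const_nhds (x := c)).rpow tendsto_one_div_atTop_nhds_zero_nat (Or.inl hc.ne')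
  simpa using h

theorem weaklyExtremal_of_le {B : Fin 2 → Mat2} (hB : (B 0).det ≠ 0) {x : ℕ → Fin 2} {c : ℝ}
    (hc : 0 < c) (h : ∀ n, c * jsr B ^ n ≤ matNorm (seqProd B x n)) : WeaklyExtremal B x := by
  obtain ⟨hpos, ht⟩ := tendsto_maxNorm B hB
  refine tendsto_of_tendsto_of_tendsto_of_le_of_le'
    (g := fun n : ℕ => c ^ ((1 : ℝ) / n) * jsr B) ?_ ht ?_ ?_
  · simpa using (tendsto_const_rpow_one_div hc).mul_const (jsr B)
  · filter_upwards [eventually_gt_atTop 0] with n hn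
    have h1 := Real.rpow_le_rpow (by positivity) (h n) (show (0 : ℝ) ≤ 1 / n by positivity)
    rwa [Real.mul_rpow hc.le (by positivity), one_div (n : ℝ),
      Real.pow_rpow_inv_natCast hpos.le hn.ne', ← one_div] at h1
  · exact Eventually.of_forall fun n =>
      Real.rpow_le_rpow (matNorm_nonneg _) (matNorm_seqProd_le B x n) (by positivity)

theorem tendsto_rpow_mul {f : ℕ → ℝ} (hf : ∀ n, 0 ≤ f n) {c : ℝ} {q : ℕ} (hq : 0 < q)
    (h : Tendsto (fun n : ℕ => f n ^ ((1 : ℝ) / n)) atTop (𝓝 c)) :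
    Tendsto (fun n : ℕ => f (n * q) ^ ((1 : ℝ) / n)) atTop (𝓝 (c ^ q)) := by
  have h1 : Tendsto (fun n : ℕ => n * q) atTop atTop :=
    tendsto_id.atTop_mul_const' hq
  refine ((h.comp h1).pow q).congr fun n => ?_
  simp only [Function.comp]
  rw [← Real.rpow_natCast, ← Real.rpow_mul (hf _)]
  congr 1
  have hq' : (q : ℝ) ≠ 0 := by exact_mod_cast hq.ne'
  push_cast
  rcases Nat.eq_zero_or_pos n with rfl | hn
  · simp
  · have : (n : ℝ) ≠ 0 := by exact_mod_cast hn.ne'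
    field_simp

theorem specRad_wordProd_le {B : Fin 2 → Mat2} (hB : (B 0).det ≠ 0) {u : Word}
    (hu : 0 < u.length) : specRad (wordProd B u) ≤ jsr B ^ u.length := by
  have h1 := tendsto_rpow_mul (maxNorm_nonneg B) hu (tendsto_maxNorm B hB).2
  refine le_of_tendsto_of_tendsto' (tendsto_matNorm_pow_specRad (wordProd B u)) h1 fun n => ?_
  refine Real.rpow_le_rpow (matNorm_nonneg _) ?_ (by positivity)
  rw [← wordProd_wordRep, ← length_wordRep]
  exact matNorm_wordProd_le B _

theorem WeaklyExtremal.specRad_eq {B : Fin 2 → Mat2} {u : Word} (hu : 0 < u.length)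
    (h : WeaklyExtremal B (perSeq u)) : specRad (wordProd B u) = jsr B ^ u.length := by
  have h1 := tendsto_rpow_mul (fun n => matNorm_nonneg (seqProd B (perSeq u) n)) hu h
  refine tendsto_nhds_unique (tendsto_matNorm_pow_specRad (wordProd B u)) (h1.congr fun n => ?_)
  rw [seqProd_perSeq]

/-- Along a weakly extremal sequence there are arbitrarily long stretches without a drop of the
normalised norm below one half. -/
theorem WeaklyExtremal.exists_shift {B : Fin 2 → Mat2} (hB : (B 0).det ≠ 0) {x : ℕ → Fin 2}
    (hx : WeaklyExtremal B x) (M : ℕ) :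
    ∃ j, ∀ m ≤ M, 1 / 2 * jsr B ^ m ≤ matNorm (seqProd B (fun i => x (j + i)) m) := by
  by_contra! hcon
  obtain ⟨hpos, -⟩ := tendsto_maxNorm B hB
  have hM : M ≠ 0 := by
    rintro rfl
    obtain ⟨m, hm, hlt⟩ := hcon 0
    obtain rfl : m = 0 := by omega
    rw [seqProd_zero, matNorm_one] at hlt
    norm_num at hlt
  -- If every starting point met a drop within M steps, concatenating the drops would give decay at
  -- rate η < 1 relative to the joint spectral radius.
  set η : ℝ := (1 / 2 : ℝ) ^ ((M : ℝ)⁻¹) with hη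
  have hη0 : 0 < η := by positivity
  have hη1 : η < 1 := Real.rpow_lt_one (by norm_num) (by norm_num) (by positivity)
  have hηM : η ^ M = 1 / 2 := Real.rpow_inv_natCast_pow (by norm_num) hM
  have hs : 0 < jsr B * η := by positivity
  obtain ⟨K, hK⟩ : ∃ K : ℝ, ∀ n < M, maxNorm B n / (jsr B * η) ^ n ≤ K := by
    obtain ⟨K, hK⟩ := ((Finset.range M).image fun n => maxNorm B n / (jsr B * η) ^ n).bddAbove
    exact ⟨K, fun n hn => hK (by
      rw [Finset.coe_image]; exact ⟨n, by simpa using hn, rfl⟩)⟩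
  have hKpos : 0 < K := by
    have := hK 0 (Nat.pos_of_ne_zero hM)
    rw [pow_zero, div_one] at this
    exact (half_log_det_le B hB 0).1.trans_le this
  have key : ∀ n j, matNorm (seqProd B (fun i => x (j + i)) n) ≤ K * (jsr B * η) ^ n := by
    intro n
    induction n using Nat.strong_induction_on with
    | _ n ih =>
    intro j
    rcases lt_or_ge n M with hn | hn
    · refine (matNorm_seqProd_le B _ n).trans ?_
      rw [← div_le_iff₀ (by positivity)]
      exact hK n hn
    -- Split off the first drop, which has length between 1 and M; there 1/2 = η ^ M ≤ η ^ m.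
    · obtain ⟨m, hm, hlt⟩ := hcon j
      have hm0 : 0 < m := by
        rcases Nat.eq_zero_or_pos m with rfl | h
        · rw [seqProd_zero, matNorm_one] at hlt
          norm_num at hlt
        · exact h
      obtain ⟨l, rfl⟩ := Nat.exists_eq_add_of_le (hm.trans hn)
      rw [seqProd_add]
      have h1 := ih l (by omega) (j + m)
      have h2 : (1 : ℝ) / 2 ≤ η ^ m := hηM ▸ pow_le_pow_of_le_one hη0.le hη1.le hm
      simp_rw [← add_assoc]
      calc _ ≤ _ := matNorm_mul_le _ _
        _ ≤ K * (jsr B * η) ^ l * (η ^ m * jsr B ^ m) := by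
          refine mul_le_mul h1 (hlt.le.trans ?_) (matNorm_nonneg _) (by positivity)
          exact mul_le_mul_of_nonneg_right h2 (by positivity)
        _ = _ := by rw [pow_add, mul_pow, mul_pow]; ring
  have hle : jsr B ≤ jsr B * η := by
    have hlim : Tendsto (fun n : ℕ => K ^ ((1 : ℝ) / n) * (jsr B * η)) atTop
        (𝓝 (jsr B * η)) := by
      simpa using (tendsto_const_rpow_one_div hKpos).mul_const (jsr B * η)
    refine le_of_tendsto_of_tendsto hx hlim ?_
    filter_upwards [eventually_gt_atTop 0] with n hn
    have h0 := key n 0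
    simp only [zero_add] at h0
    have h1 := Real.rpow_le_rpow (matNorm_nonneg _) h0 (show (0 : ℝ) ≤ 1 / n by positivity)
    rwa [Real.mul_rpow hKpos.le (by positivity), one_div (n : ℝ),
      Real.pow_rpow_inv_natCast hs.le hn.ne', ← one_div] at h1
  nlinarith

/-! ### Monotonicity and continuity of the 1-ratio function -/

theorem det_scaled_ne_zero {A : Fin 2 → Mat2} (hA : TechnicalHypotheses A) (α : ℝ) :
    (scaled A α 0).det ≠ 0 := by
  have := det_wordProd_ne_zero hA [0]
  rwa [wordProd_singleton] at this

theorem jsr_pos {A : Fin 2 → Mat2} (hA : TechnicalHypotheses A) (α : ℝ) :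
    0 < jsr (scaled A α) := (tendsto_maxNorm _ (det_scaled_ne_zero hA α)).1

theorem entriesNonneg_word {A : Fin 2 → Mat2} (hA : TechnicalHypotheses A) (u : Word) :
    EntriesNonneg (wordProd A u) := entriesNonneg_wordProd hA.nonneg u

theorem specRad_scaled {A : Fin 2 → Mat2} (hA : TechnicalHypotheses A) {α : ℝ} (hα : 0 ≤ α)
    (u : Word) :
    specRad (wordProd (scaled A α) u) = α ^ ones u * specRad (wordProd A u) := by
  rw [wordProd_scaled, specRad_smul (entriesNonneg_word hA u) (by positivity)]

theorem specRad_le_jsr {A : Fin 2 → Mat2} (hA : TechnicalHypotheses A) {α : ℝ} (hα : 0 ≤ α)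
    {u : Word} (hu : 0 < u.length) :
    α ^ ones u * specRad (wordProd A u) ≤ jsr (scaled A α) ^ u.length := by
  rw [← specRad_scaled hA hα]
  exact specRad_wordProd_le (det_scaled_ne_zero hA α) hu

namespace IsOneRatioFunction

variable {A : Fin 2 → Mat2} {r : ℝ → ℝ}

theorem nonneg (hr : IsOneRatioFunction A r) {α : ℝ} (hα : 0 ≤ α) : 0 ≤ r α := (hr.mapsTo hα).1

theorem le_one (hr : IsOneRatioFunction A r) {α : ℝ} (hα : 0 ≤ α) : r α ≤ 1 := (hr.mapsTo hα).2

/-- Passing from α to β multiplies the norm along a fixed sequence by (β/α) to the number of ones;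
for a sequence extremal at α the exponent is asymptotically n · r α. -/
theorem rpow_mul_jsr_le (hr : IsOneRatioFunction A r) (hA : TechnicalHypotheses A) {α β : ℝ}
    (hα : 0 < α) (hβ : 0 < β) :
    (β / α) ^ r α * jsr (scaled A α) ≤ jsr (scaled A β) := by
  obtain ⟨x, hx⟩ := sturmianSet_nonempty (hr.nonneg hα.le) (hr.le_one hα.le)
  have hw := hr.extremal α hα.le x hx
  have hf : Tendsto (fun n : ℕ => (onesUpTo x n : ℝ) / n) atTop (𝓝 (r α)) :=
    hr.frequency α hα.le x hw
  have hpos : 0 < β / α := div_pos hβ hα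
  refine le_jsr_of_tendsto (x := x) (det_scaled_ne_zero hA β) ?_
  refine ((tendsto_const_nhds.rpow hf (Or.inl hpos.ne')).mul hw).congr fun n => ?_
  have h1 : matNorm (seqProd (scaled A β) x n)
      = (β / α) ^ onesUpTo x n * matNorm (seqProd (scaled A α) x n) := by
    rw [seqProd_scaled, seqProd_scaled, matNorm_smul, matNorm_smul, abs_of_nonneg (by positivity),
      abs_of_nonneg (by positivity), ← mul_assoc, div_pow, div_mul_cancel₀ _ (by positivity)]
  rw [h1, Real.mul_rpow (by positivity) (matNorm_nonneg _), ← Real.rpow_natCast,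
    ← Real.rpow_mul hpos.le, mul_one_div]

/-- The subgradient inequalities at α and at β, each tested at the other point. -/
theorem monotoneOn_Ioi (hr : IsOneRatioFunction A r) (hA : TechnicalHypotheses A) {α β : ℝ}
    (hα : 0 < α) (h : α < β) : r α ≤ r β := by
  have hβ := hα.trans h
  have h1 := hr.rpow_mul_jsr_le hA hα hβ
  have h2 := hr.rpow_mul_jsr_le hA hβ hα
  have hj := jsr_pos hA α
  have hd : 1 < β / α := (one_lt_div hα).2 h
  have h3 : (β / α) ^ r α * jsr (scaled A α) ≤ (β / α) ^ r β * jsr (scaled A α) := by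
    refine h1.trans ?_
    rw [← inv_div, Real.inv_rpow (by positivity), inv_mul_le_iff₀ (by positivity)] at h2
    exact h2
  exact (Real.rpow_le_rpow_left_iff hd).1 (le_of_mul_le_mul_right h3 hj)

/-- At α = 0 any occurrence of 1 annihilates the product, while the joint spectral radius stays
positive. -/
theorem map_zero (hr : IsOneRatioFunction A r) (hA : TechnicalHypotheses A) : r 0 = 0 := by
  obtain ⟨x, hx⟩ := sturmianSet_nonempty (hr.nonneg le_rfl) (hr.le_one le_rfl)
  have hw := hr.extremal 0 le_rfl x hx
  have hz : ∀ n, onesUpTo x n = 0 := by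
    by_contra! hcon
    obtain ⟨n, hn⟩ := hcon
    have hlim : Tendsto (fun n : ℕ => matNorm (seqProd (scaled A 0) x n) ^ ((1 : ℝ) / n)) atTop
        (𝓝 0) := by
      refine tendsto_const_nhds.congr' ?_
      filter_upwards [eventually_ge_atTop n, eventually_gt_atTop 0] with m hm hm0
      have h1 : onesUpTo x m ≠ 0 := by
        obtain ⟨l, rfl⟩ := Nat.exists_eq_add_of_le hm
        rw [onesUpTo_add]; omega
      rw [seqProd_scaled, zero_pow h1, zero_smul]
      have : matNorm 0 = 0 := by simp [matNorm_eq]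
      rw [this, Real.zero_rpow]
      have : (m : ℝ) ≠ 0 := by exact_mod_cast hm0.ne'
      positivity
    exact (jsr_pos hA 0).ne (tendsto_nhds_unique hlim hw)
  have hf : Tendsto (fun n : ℕ => (onesUpTo x n : ℝ) / n) atTop (𝓝 (r 0)) :=
    hr.frequency 0 le_rfl x hw
  simp only [hz, Nat.cast_zero, zero_div] at hf
  exact (tendsto_nhds_unique hf tendsto_const_nhds)

theorem monotoneOn (hr : IsOneRatioFunction A r) (hA : TechnicalHypotheses A) :
    MonotoneOn r (Set.Ici 0) := by
  intro α hα β hβ h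
  rcases (show 0 ≤ α from hα).eq_or_lt with rfl | hα0
  · rw [hr.map_zero hA]; exact hr.nonneg hβ
  · rcases h.eq_or_lt with rfl | hlt
    · exact le_rfl
    · exact hr.monotoneOn_Ioi hA hα0 hlt

theorem jsr_eq_specRad_zero (hr : IsOneRatioFunction A r) {α : ℝ}
    (hα : 0 ≤ α) (h : r α = 0) : jsr (scaled A α) = specRad (A 0) := by
  have h1 := hr.extremal α hα _ (by rw [h]; exact const_zero_mem_sturmianSet)
  have h2 : (fun _ => 0 : ℕ → Fin 2) = perSeq [0] := by
    ext n; simp [perSeq, Nat.mod_one]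
  rw [h2] at h1
  have h3 := h1.specRad_eq (by simp)
  rw [wordProd_singleton, List.length_singleton, pow_one] at h3
  exact h3.symm

theorem jsr_eq_specRad_one (hr : IsOneRatioFunction A r) {α : ℝ}
    (hα : 0 ≤ α) (h : r α = 1) : jsr (scaled A α) = specRad (α • A 1) := by
  have h1 := hr.extremal α hα _ (by rw [h]; exact const_one_mem_sturmianSet)
  have h2 : (fun _ => 1 : ℕ → Fin 2) = perSeq [1] := by
    ext n; simp [perSeq, Nat.mod_one]
  rw [h2] at h1
  have h3 := h1.specRad_eq (by simp)
  rw [wordProd_singleton, List.length_singleton, pow_one] at h3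
  exact h3.symm

theorem jsr_eq_specRad (hr : IsOneRatioFunction A r) (hA : TechnicalHypotheses A) {u v : Word}
    (h : IsStandardPair u v) {α : ℝ} (hα : 0 ≤ α) (hs : r α = wordSlope (u ++ v)) :
    α ^ ones (u ++ v) * specRad (wordProd A (u ++ v))
      = jsr (scaled A α) ^ (u ++ v).length := by
  rw [← specRad_scaled hA hα]
  refine WeaklyExtremal.specRad_eq ?_ (hr.extremal α hα _ (hs ▸ perSeq_mem_sturmianSet h))
  have := h.length_pos
  rw [List.length_append]; omega

/-- The word 1 gives ϱ(α) ≥ α ρ(A₁), whereas the subgradient inequality gives ϱ(α) ≤ α ^ r α · ϱ(1);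
so 1 − r α is O(1 / log α). -/
theorem tendsto_atTop (hr : IsOneRatioFunction A r) (hA : TechnicalHypotheses A) :
    Tendsto r atTop (𝓝 1) := by
  have hρ : 0 < specRad (A 1) := specRad_pos_of_trace_pos (hA.nonneg 1) (hA.trace_pos 1)
  have hj := jsr_pos hA 1
  set C := Real.log (jsr (scaled A 1)) - Real.log (specRad (A 1)) with hC
  have key : ∀ α : ℝ, 1 < α → 1 - C / Real.log α ≤ r α := by
    intro α hα
    have hα0 : 0 < α := by linarith
    have h1 : α * specRad (A 1) ≤ jsr (scaled A α) := by
      have := specRad_le_jsr hA hα0.le (u := [1]) (by simp)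
      simpa [ones] using this
    have h2 := hr.rpow_mul_jsr_le hA hα0 one_pos
    rw [one_div, Real.inv_rpow hα0.le, inv_mul_le_iff₀ (by positivity)] at h2
    have h3 := Real.log_le_log (by positivity) (h1.trans h2)
    rw [Real.log_mul hα0.ne' hρ.ne', Real.log_mul (by positivity) hj.ne', Real.log_rpow hα0] at h3
    have hl := Real.log_pos hα
    have : 1 - r α ≤ C / Real.log α := by
      rw [le_div_iff₀ hl]; linarith
    linarith
  have hlim : Tendsto (fun α : ℝ => 1 - C / Real.log α) atTop (𝓝 1) := by
    simpa using tendsto_const_nhds.sub (Real.tendsto_log_atTop.const_div_atTop C)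
  refine tendsto_of_tendsto_of_tendsto_of_le_of_le' hlim tendsto_const_nhds ?_ ?_
  · filter_upwards [eventually_gt_atTop 1] with α hα using key α hα
  · filter_upwards [eventually_ge_atTop 0] with α hα using hr.le_one hα

/-- Lower semicontinuity of ϱ: for positive α from the subgradient inequality, and at 0 because ϱ(0)
= ρ(A₀) bounds every ϱ(α) from below. -/
theorem eventually_lt_jsr (hr : IsOneRatioFunction A r) (hA : TechnicalHypotheses A) {α : ℝ}
    (hα : 0 ≤ α) {a : ℕ → ℝ} (ha : ∀ n, 0 ≤ a n) (hlim : Tendsto a atTop (𝓝 α)) {c : ℝ}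
    (hc : c < jsr (scaled A α)) : ∀ᶠ n in atTop, c < jsr (scaled A (a n)) := by
  rcases hα.eq_or_lt with rfl | hpos
  · refine Eventually.of_forall fun n => hc.trans_le ?_
    rw [hr.jsr_eq_specRad_zero le_rfl (hr.map_zero hA)]
    have := specRad_le_jsr hA (ha n) (u := [0]) (by simp)
    simpa [ones] using this
  · have h1 : Tendsto (fun n => (a n / α) ^ r α * jsr (scaled A α)) atTop
        (𝓝 (jsr (scaled A α))) := by
      have := ((hlim.div_const α).rpow_const (p := r α)
        (Or.inl (by rw [div_self hpos.ne']; exact one_ne_zero))).mul_const (jsr (scaled A α))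
      simpa [div_self hpos.ne'] using this
    filter_upwards [h1.eventually_const_lt hc, hlim.eventually_const_lt hpos] with n hn hn0
    exact hn.trans_le (hr.rpow_mul_jsr_le hA hpos hn0)

/-- Sequences extremal at `a n`, shifted so as not to drop for n steps, have a limit point in
{0,1}^ℕ. The limit inherits both the frequency γ and the absence of drops, so it is extremal at α.
-/
theorem eq_of_tendsto (hr : IsOneRatioFunction A r) (hA : TechnicalHypotheses A) {α γ : ℝ}
    (hα : 0 ≤ α) {a : ℕ → ℝ} (ha : ∀ n, 0 ≤ a n) (hlim : Tendsto a atTop (𝓝 α))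
    (hγ : Tendsto (fun n => r (a n)) atTop (𝓝 γ)) : r α = γ := by
  have hex : ∀ n, ∃ y ∈ sturmianSet (r (a n)), ∀ m ≤ n,
      1 / 2 * jsr (scaled A (a n)) ^ m ≤ matNorm (seqProd (scaled A (a n)) y m) := by
    intro n
    obtain ⟨x, hx⟩ := sturmianSet_nonempty (hr.nonneg (ha n)) (hr.le_one (ha n))
    obtain ⟨j, hj⟩ := (hr.extremal _ (ha n) x hx).exists_shift (det_scaled_ne_zero hA _) n
    exact ⟨_, shift_mem_sturmianSet hx j, hj⟩
  choose y hy hyn using hex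
  obtain ⟨z, -, φ, hφ, hz⟩ := isCompact_univ.tendsto_subseq (x := y) fun n => Set.mem_univ _
  have hev : ∀ m : ℕ, ∀ᶠ n in atTop, ∀ i < m, y (φ n) i = z i := by
    intro m
    have h1 : ∀ i ∈ Finset.range m, ∀ᶠ n in atTop, y (φ n) i = z i := by
      intro i _
      have := (tendsto_pi_nhds.1 hz i)
      rw [nhds_discrete, tendsto_pure] at this
      exact this
    filter_upwards [(Filter.eventually_all_finset _).2 h1] with n hn i hi
    exact hn i (Finset.mem_range.2 hi)
  have hφt := hφ.tendsto_atTop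
  have hlim' := hlim.comp hφt
  have hγ' := hγ.comp hφt
  have hfreq : HasOneFrequency z γ := by
    refine hasOneFrequency_of_bound fun m => ?_
    have h1 : Tendsto (fun n => |(onesUpTo z m : ℝ) - r (a (φ n)) * m|) atTop
        (𝓝 |(onesUpTo z m : ℝ) - γ * m|) :=
      (tendsto_const_nhds.sub (hγ'.mul_const (m : ℝ))).abs
    refine le_of_tendsto h1 ?_
    filter_upwards [hev m] with n hn
    rw [← onesUpTo_congr hn]
    exact abs_onesUpTo_sub_le (hy _) m
  have hext : WeaklyExtremal (scaled A α) z := by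
    refine weaklyExtremal_of_le (det_scaled_ne_zero hA α) one_half_pos fun m => ?_
    have h1 : Tendsto (fun n => matNorm (seqProd (scaled A (a (φ n))) z m)) atTop
        (𝓝 (matNorm (seqProd (scaled A α) z m))) := by
      simp_rw [seqProd_scaled]
      have hc : Continuous fun b : ℝ => matNorm (b ^ onesUpTo z m • seqProd A z m) :=
        continuous_matNorm.comp (by fun_prop)
      exact hc.continuousAt.tendsto.comp hlim'
    have h2 : ∀ c, 0 ≤ c → c < jsr (scaled A α) →
        1 / 2 * c ^ m ≤ matNorm (seqProd (scaled A α) z m) := by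
      intro c hc0 hc
      refine ge_of_tendsto h1 ?_
      filter_upwards [hev m, hr.eventually_lt_jsr hA hα (fun n => ha (φ n)) hlim' hc,
        hφt.eventually_ge_atTop m] with n hn hcn hmn
      rw [← seqProd_congr _ hn]
      refine le_trans ?_ (hyn (φ n) m hmn)
      exact mul_le_mul_of_nonneg_left (pow_le_pow_left₀ hc0 hcn.le m) (by norm_num)
    -- Semicontinuity only yields bounds strictly below the joint spectral radius; let c increase to
    -- it.
    have h3 : Tendsto (fun c : ℝ => 1 / 2 * c ^ m) (𝓝[<] (jsr (scaled A α)))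
        (𝓝 (1 / 2 * jsr (scaled A α) ^ m)) :=
      (Continuous.tendsto (by fun_prop) _).mono_left nhdsWithin_le_nhds
    refine le_of_tendsto h3 ?_
    filter_upwards [Ioo_mem_nhdsLT (jsr_pos hA α)] with c hc using h2 c hc.1.le hc.2
  exact (hr.frequency α hα z hext).unique hfreq

theorem continuousOn (hr : IsOneRatioFunction A r) (hA : TechnicalHypotheses A) :
    ContinuousOn r (Set.Ici 0) := by
  intro α hα
  rw [ContinuousWithinAt, tendsto_iff_seq_tendsto]
  intro a ha
  rw [tendsto_nhdsWithin_iff] at ha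
  obtain ⟨ha1, ha2⟩ := ha
  rw [eventually_atTop] at ha2
  obtain ⟨N, hN⟩ := ha2
  rw [← tendsto_add_atTop_iff_nat N]
  refine tendsto_of_subseq_tendsto fun ns hns => ?_
  obtain ⟨γ, -, φ, hφ, hγ⟩ := (isCompact_Icc (a := (0 : ℝ)) (b := 1)).tendsto_subseq
    (x := fun n => r (a (ns n + N))) fun n => hr.mapsTo (hN _ (by omega))
  have h1 : Tendsto (fun n => a (ns (φ n) + N)) atTop (𝓝 α) :=
    ha1.comp ((tendsto_add_atTop_nat N).comp (hns.comp hφ.tendsto_atTop))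
  have := hr.eq_of_tendsto hA hα (fun n => hN _ (by omega)) h1 hγ
  exact ⟨φ, this ▸ hγ⟩

theorem exists_eq (hr : IsOneRatioFunction A r) (hA : TechnicalHypotheses A) {γ : ℝ}
    (h0 : 0 ≤ γ) (h1 : γ < 1) : ∃ α, 0 ≤ α ∧ r α = γ := by
  obtain ⟨b, hb0, hb⟩ := ((eventually_ge_atTop (0 : ℝ)).and
    ((hr.tendsto_atTop hA).eventually_const_lt h1)).exists
  have := intermediate_value_Icc hb0 ((hr.continuousOn hA).mono Set.Icc_subset_Ici_self)
  obtain ⟨α, hα, hα'⟩ := this ⟨by rw [hr.map_zero hA]; exact h0, hb.le⟩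
  exact ⟨α, hα.1, hα'⟩

end IsOneRatioFunction

/-! ### Comparison of neighbouring slopes -/

theorem wordSlope_eq_add {u v : Word} (h : IsStandardPair u v) :
    wordSlope v = wordSlope u + 1 / (u.length * v.length) := by
  have h1 := h.length_pos
  have hu : (u.length : ℝ) ≠ 0 := by exact_mod_cast h1.1.ne'
  have hv : (v.length : ℝ) ≠ 0 := by exact_mod_cast h1.2.ne'
  have hd : (ones v : ℝ) * u.length = ones u * v.length + 1 := by exact_mod_cast h.det_eq
  unfold wordSlope
  field_simp
  linear_combination hd

theorem wordSlope_append_comm (u v : Word) : wordSlope (u ++ v) = wordSlope (v ++ u) := by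
  unfold wordSlope
  rw [ones_append, ones_append, List.length_append, List.length_append, add_comm (ones u),
    add_comm u.length]

theorem wordSlope_lt_one {u : Word} (h : ones u < u.length) : wordSlope u < 1 := by
  unfold wordSlope
  rw [div_lt_one (by exact_mod_cast (Nat.zero_le _).trans_lt h)]
  exact_mod_cast h

theorem wordSlope_pos {u : Word} (h : 0 < ones u) : 0 < wordSlope u := by
  have := ones_le_length u
  exact div_pos (by exact_mod_cast h) (by exact_mod_cast h.trans_le this)

theorem specRad_word_pos {A : Fin 2 → Mat2} (hA : TechnicalHypotheses A) {u : Word}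
    (ht : 0 < (wordProd A u).trace) : 0 < specRad (wordProd A u) :=
  specRad_pos_of_trace_pos (entriesNonneg_word hA u) ht

theorem trace_left_pos {A : Fin 2 → Mat2} (hA : TechnicalHypotheses A) {u v : Word}
    (h : IsStandardPair u v) : 0 < (wordProd A u).trace := by
  rcases h.left_eq with rfl | ⟨x, y, hxy, rfl⟩
  · rw [wordProd_singleton]; exact hA.trace_pos 0
  · exact trace_pos_of_pos (wordProd_pos hA hxy.ones_append_pos hxy.ones_append_lt)

theorem trace_right_pos {A : Fin 2 → Mat2} (hA : TechnicalHypotheses A) {u v : Word}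
    (h : IsStandardPair u v) : 0 < (wordProd A v).trace := by
  rcases h.right_eq with rfl | ⟨x, y, hxy, rfl⟩
  · rw [wordProd_singleton]; exact hA.trace_pos 1
  · rw [wordProd_append, Matrix.trace_mul_comm, ← wordProd_append]
    exact trace_pos_of_pos (wordProd_pos hA hxy.ones_append_pos hxy.ones_append_lt)

theorem specRad_append_comm {A : Fin 2 → Mat2} (hA : TechnicalHypotheses A) (u v : Word) :
    specRad (wordProd A (u ++ v)) = specRad (wordProd A (v ++ u)) := by
  rw [wordProd_append, wordProd_append,
    specRad_mul_comm (entriesNonneg_word hA v) (entriesNonneg_word hA u)]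

namespace IsOneRatioFunction

variable {A : Fin 2 → Mat2} {r : ℝ → ℝ} {u v : Word}

theorem jsr_eq_specRad_left (hr : IsOneRatioFunction A r) (hA : TechnicalHypotheses A)
    (h : IsStandardPair u v) {α : ℝ} (hα : 0 ≤ α) (hs : r α = wordSlope u) :
    α ^ ones u * specRad (wordProd A u) = jsr (scaled A α) ^ u.length := by
  rcases h.left_eq with rfl | ⟨x, y, hxy, rfl⟩
  · rw [hr.jsr_eq_specRad_zero hα (by simpa [wordSlope, ones] using hs)]
    simp [ones]
  · exact hr.jsr_eq_specRad hA hxy hα hs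

theorem jsr_eq_specRad_right (hr : IsOneRatioFunction A r) (hA : TechnicalHypotheses A)
    (h : IsStandardPair u v) {α : ℝ} (hα : 0 ≤ α) (hs : r α = wordSlope v) :
    α ^ ones v * specRad (wordProd A v) = jsr (scaled A α) ^ v.length := by
  rcases h.right_eq with rfl | ⟨x, y, hxy, rfl⟩
  · rw [hr.jsr_eq_specRad_one hα (by simpa [wordSlope, ones] using hs),
      specRad_smul (hA.nonneg 1) hα]
    simp [ones]
  · have := hr.jsr_eq_specRad hA hxy hα (by rw [hs, wordSlope_append_comm])
    rw [specRad_append_comm hA, ones_append, List.length_append, add_comm (ones y),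
      add_comm y.length, ← ones_append, ← List.length_append, this]

theorem pos_of_pos (hr : IsOneRatioFunction A r) (hA : TechnicalHypotheses A) {α : ℝ}
    (hα : 0 ≤ α) (h : 0 < r α) : 0 < α := by
  refine hα.lt_of_ne ?_
  rintro rfl
  rw [hr.map_zero hA] at h
  exact h.false

/-- Test the word vuⁿ against ϱ, which here is realised by u, and raise to the power |u|. The Farey
identity cancels all powers of α but one. -/
theorem left_constraint (hr : IsOneRatioFunction A r) (hA : TechnicalHypotheses A)
    (h : IsStandardPair u v) {α : ℝ} (hα : 0 < α) (hs : r α = wordSlope u) (n : ℕ) :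
    α * specRad (wordProd A u ^ n * wordProd A v) ^ u.length
      ≤ specRad (wordProd A u) ^ (v.length + n * u.length) := by
  have h1 := specRad_le_jsr hA hα.le (u := v ++ wordRep u n)
    (by rw [List.length_append]; have := h.length_pos; omega)
  rw [wordProd_append, wordProd_wordRep, ones_append, ones_wordRep, List.length_append,
    length_wordRep] at h1
  have h2 := pow_le_pow_left₀ (mul_nonneg (by positivity) (specRad_nonneg _)) h1 u.length
  rw [← pow_mul, mul_comm _ u.length, pow_mul (jsr _),
    ← hr.jsr_eq_specRad_left hA h hα.le hs, mul_pow, mul_pow, ← pow_mul, ← pow_mul] at h2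
  have h3 : (ones v + n * ones u) * u.length = ones u * (v.length + n * u.length) + 1 := by
    have := h.det_eq
    rw [add_mul, this]; ring
  rw [h3, pow_succ, mul_assoc] at h2
  exact le_of_mul_le_mul_left h2 (by positivity)

/-- The comparison of `left_constraint` with the roles exchanged: now vuⁿ⁺¹ realises ϱ and u is the
competitor. -/
theorem left_attained (hr : IsOneRatioFunction A r) (hA : TechnicalHypotheses A)
    (h : IsStandardPair u v) {α : ℝ} (hα : 0 < α) (n : ℕ)
    (hs : r α = wordSlope (v ++ wordRep u (n + 1))) :
    specRad (wordProd A u) ^ (v.length + (n + 1) * u.length)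
      ≤ α * specRad (wordProd A u ^ (n + 1) * wordProd A v) ^ u.length := by
  have h1 := hr.jsr_eq_specRad_right hA (h.iterate_right (n + 1)) hα.le hs
  rw [wordProd_append, wordProd_wordRep, ones_append, ones_wordRep, List.length_append,
    length_wordRep] at h1
  have h2 := specRad_le_jsr hA hα.le (u := u) h.length_pos.1
  have h3 := pow_le_pow_left₀ (mul_nonneg (by positivity) (specRad_nonneg _)) h2
    (v.length + (n + 1) * u.length)
  rw [← pow_mul, mul_comm u.length, pow_mul (jsr _), ← h1, mul_pow, mul_pow, ← pow_mul,
    ← pow_mul] at h3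
  have h4 : (ones v + (n + 1) * ones u) * u.length
      = ones u * (v.length + (n + 1) * u.length) + 1 := by
    have := h.det_eq
    rw [add_mul, this]; ring
  rw [h4, pow_succ, mul_assoc] at h3
  exact le_of_mul_le_mul_left h3 (by positivity)

theorem right_constraint (hr : IsOneRatioFunction A r) (hA : TechnicalHypotheses A)
    (h : IsStandardPair u v) {α : ℝ} (hα : 0 < α) (hs : r α = wordSlope v) (n : ℕ) :
    specRad (wordProd A v ^ n * wordProd A u) ^ v.length
      ≤ α * specRad (wordProd A v) ^ (u.length + n * v.length) := by
  have h1 := specRad_le_jsr hA hα.le (u := u ++ wordRep v n)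
    (by rw [List.length_append]; have := h.length_pos; omega)
  rw [wordProd_append, wordProd_wordRep, ones_append, ones_wordRep, List.length_append,
    length_wordRep] at h1
  have h2 := pow_le_pow_left₀ (mul_nonneg (by positivity) (specRad_nonneg _)) h1 v.length
  rw [← pow_mul, mul_comm _ v.length, pow_mul (jsr _),
    ← hr.jsr_eq_specRad_right hA h hα.le hs, mul_pow, mul_pow, ← pow_mul, ← pow_mul] at h2
  have h3 : ones v * (u.length + n * v.length) = (ones u + n * ones v) * v.length + 1 := by
    have := h.det_eq
    rw [mul_add, this]; ring
  rw [h3, pow_succ, mul_assoc] at h2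
  exact le_of_mul_le_mul_left h2 (by positivity)

theorem right_attained (hr : IsOneRatioFunction A r) (hA : TechnicalHypotheses A)
    (h : IsStandardPair u v) {α : ℝ} (hα : 0 < α) (n : ℕ)
    (hs : r α = wordSlope (u ++ wordRep v (n + 1))) :
    α * specRad (wordProd A v) ^ (u.length + (n + 1) * v.length)
      ≤ specRad (wordProd A v ^ (n + 1) * wordProd A u) ^ v.length := by
  have h1 := hr.jsr_eq_specRad_left hA (h.iterate_left (n + 1)) hα.le hs
  rw [wordProd_append, wordProd_wordRep, ones_append, ones_wordRep, List.length_append,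
    length_wordRep] at h1
  have h2 := specRad_le_jsr hA hα.le (u := v) h.length_pos.2
  have h3 := pow_le_pow_left₀ (mul_nonneg (by positivity) (specRad_nonneg _)) h2
    (u.length + (n + 1) * v.length)
  rw [← pow_mul, mul_comm v.length, pow_mul (jsr _), ← h1, mul_pow, mul_pow, ← pow_mul,
    ← pow_mul] at h3
  have h4 : ones v * (u.length + (n + 1) * v.length)
      = (ones u + (n + 1) * ones v) * v.length + 1 := by
    have := h.det_eq
    rw [mul_add, this]; ring
  rw [h4, pow_succ, mul_assoc] at h3
  exact le_of_mul_le_mul_left h3 (by positivity)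

/-! ### Endpoints of the plateaus -/

theorem exists_subseq_limit (hr : IsOneRatioFunction A r) (hA : TechnicalHypotheses A)
    {a : ℕ → ℝ} {M γ : ℝ} (ha : ∀ n, 0 ≤ a n) (haM : ∀ n, a n ≤ M)
    (hγ : Tendsto (fun n => r (a n)) atTop (𝓝 γ)) :
    ∃ α, 0 ≤ α ∧ r α = γ ∧ ∃ φ : ℕ → ℕ, StrictMono φ ∧ Tendsto (a ∘ φ) atTop (𝓝 α) := by
  obtain ⟨α, hα, φ, hφ, hlim⟩ := (isCompact_Icc (a := (0 : ℝ)) (b := M)).tendsto_subseq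
    (x := a) fun n => ⟨ha n, haM n⟩
  exact ⟨α, hα.1, hr.eq_of_tendsto hA hα.1 (fun n => ha _) hlim (hγ.comp hφ.tendsto_atTop),
    φ, hφ, hlim⟩

theorem exists_bound (hr : IsOneRatioFunction A r) (hA : TechnicalHypotheses A) {γ : ℝ}
    (hγ : γ < 1) : ∃ M, ∀ α, 0 ≤ α → r α ≤ γ → α ≤ M := by
  obtain ⟨M, hM0, hM⟩ := ((eventually_ge_atTop (0 : ℝ)).and
    ((hr.tendsto_atTop hA).eventually_const_lt hγ)).exists
  refine ⟨M, fun α hα h => ?_⟩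
  by_contra hlt
  exact (hM.trans_le (hr.monotoneOn hA hM0 hα (not_le.1 hlt).le)).not_ge h

/-- Letting n → ∞ in `left_constraint` bounds the plateau from above. Parameters with slopes
ς(vuⁿ⁺¹) ↓ ς(u) have a limit point on the plateau by continuity, and `left_attained` shows that it
reaches the bound. -/
theorem isGreatest_preimage (hr : IsOneRatioFunction A r) (hA : TechnicalHypotheses A)
    (h : IsStandardPair u v) (hd : 0 < disc (wordProd A u)) :
    0 < specRad (domProj (wordProd A u) * wordProd A v) ∧
    IsGreatest (preimageOf r {wordSlope u}) (specRad (wordProd A u) ^ v.length /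
      specRad (domProj (wordProd A u) * wordProd A v) ^ u.length) := by
  have hlen := h.length_pos
  have hρ := specRad_word_pos hA (trace_left_pos hA h)
  have htend := (tendsto_specRad_pow_mul (entriesNonneg_word hA u) hd (trace_left_pos hA h)
    (entriesNonneg_word hA v)).pow u.length
  have hdiv : ∀ n : ℕ, ∀ c : ℝ, (c / specRad (wordProd A u) ^ n) ^ u.length
      = c ^ u.length / specRad (wordProd A u) ^ (n * u.length) := by
    intro n c; rw [div_pow, pow_mul]
  have hup : ∀ α, 0 ≤ α → r α = wordSlope u →
      α * specRad (domProj (wordProd A u) * wordProd A v) ^ u.length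
        ≤ specRad (wordProd A u) ^ v.length := by
    intro α hα hs
    rcases hα.eq_or_lt with rfl | hpos
    · rw [zero_mul]; positivity
    · refine le_of_tendsto' (htend.const_mul α) fun n => ?_
      rw [hdiv, ← mul_div_assoc, div_le_iff₀ (by positivity), ← pow_add]
      exact hr.left_constraint hA h hpos hs n
  have hslope : ∀ n : ℕ, wordSlope (v ++ wordRep u (n + 1))
      = wordSlope u + 1 / (u.length * (v.length + (n + 1) * u.length)) := by
    intro n
    rw [wordSlope_eq_add (h.iterate_right (n + 1)), List.length_append, length_wordRep]
    push_cast; rfl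
  have hslope1 : ∀ n : ℕ, wordSlope (v ++ wordRep u (n + 1)) < 1 := fun n => by
    have h1 := (h.iterate_right n).ones_append_lt
    have h2 := wordSlope_lt_one h1
    rwa [wordSlope_append_comm, List.append_assoc] at h2
  have hslope0 : ∀ n : ℕ, 0 ≤ wordSlope (v ++ wordRep u (n + 1)) := fun n => by
    unfold wordSlope; positivity
  choose a ha0 ha using fun n => hr.exists_eq hA (hslope0 n) (hslope1 n)
  have hapos : ∀ n, 0 < a n := fun n => by
    refine hr.pos_of_pos hA (ha0 n) ?_
    rw [ha]
    apply wordSlope_pos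
    rw [ones_append]
    have := h.ones_lt
    omega
  have huR : (0 : ℝ) < u.length := by exact_mod_cast hlen.1
  have hvR : (0 : ℝ) < v.length := by exact_mod_cast hlen.2
  obtain ⟨M, hM⟩ := hr.exists_bound hA (hslope1 0)
  have haM : ∀ n, a n ≤ M := fun n => by
    refine hM _ (ha0 n) ?_
    rw [ha, hslope, hslope]
    gcongr
    simp
  have hlimr : Tendsto (fun n => r (a n)) atTop (𝓝 (wordSlope u)) := by
    simp_rw [ha, hslope]
    have h1 : Tendsto (fun n : ℕ => (u.length : ℝ) * (v.length + (n + 1) * u.length)) atTop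
        atTop := by
      apply Tendsto.const_mul_atTop huR
      apply tendsto_atTop_add_const_left
      exact (tendsto_atTop_add_const_right _ _ tendsto_natCast_atTop_atTop).atTop_mul_const huR
    simpa using tendsto_const_nhds.add (h1.const_div_atTop 1)
  obtain ⟨α, hα0, hα, φ, hφ, hlim⟩ := hr.exists_subseq_limit hA ha0 haM hlimr
  have hlow : specRad (wordProd A u) ^ v.length
      ≤ α * specRad (domProj (wordProd A u) * wordProd A v) ^ u.length := by
    have h1 := hlim.mul (htend.comp ((tendsto_add_atTop_nat 1).comp hφ.tendsto_atTop))
    refine ge_of_tendsto' h1 fun n => ?_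
    simp only [Function.comp]
    rw [hdiv, ← mul_div_assoc, le_div_iff₀ (by positivity), ← pow_add]
    exact hr.left_attained hA h (hapos _) _ (ha _)
  -- A vanishing limit would contradict the lower bound, whose left side is positive.
  have hP : 0 < specRad (domProj (wordProd A u) * wordProd A v) := by
    refine (specRad_nonneg _).lt_of_ne fun h0 => ?_
    rw [← h0, zero_pow hlen.1.ne', mul_zero] at hlow
    exact absurd hlow (not_le.2 (by positivity))
  refine ⟨hP, ?_, ?_⟩
  · have : specRad (wordProd A u) ^ v.length /
      specRad (domProj (wordProd A u) * wordProd A v) ^ u.length = α := by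
      rw [div_eq_iff (by positivity)]
      exact le_antisymm hlow (hup α hα0 hα)
    rw [this]
    exact ⟨hα0, hα⟩
  · rintro β ⟨hβ0, hβ⟩
    rw [le_div_iff₀ (by positivity)]
    exact hup β hβ0 hβ

theorem isLeast_preimage (hr : IsOneRatioFunction A r) (hA : TechnicalHypotheses A)
    (h : IsStandardPair u v) (hd : 0 < disc (wordProd A v)) :
    IsLeast (preimageOf r {wordSlope v}) (specRad (domProj (wordProd A v) * wordProd A u) ^ v.length
      / specRad (wordProd A v) ^ u.length) := by
  have hlen := h.length_pos
  have hρ := specRad_word_pos hA (trace_right_pos hA h)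
  have htend := (tendsto_specRad_pow_mul (entriesNonneg_word hA v) hd (trace_right_pos hA h)
    (entriesNonneg_word hA u)).pow v.length
  have hdiv : ∀ n : ℕ, ∀ c : ℝ, (c / specRad (wordProd A v) ^ n) ^ v.length
      = c ^ v.length / specRad (wordProd A v) ^ (n * v.length) := by
    intro n c; rw [div_pow, pow_mul]
  have hup : ∀ α, 0 ≤ α → r α = wordSlope v →
      specRad (domProj (wordProd A v) * wordProd A u) ^ v.length
        ≤ α * specRad (wordProd A v) ^ u.length := by
    intro α hα hs
    have hpos : 0 < α := hr.pos_of_pos hA hα (by rw [hs]; exact wordSlope_pos h.ones_lt.2)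
    refine le_of_tendsto' htend fun n => ?_
    rw [hdiv, div_le_iff₀ (by positivity), mul_assoc, ← pow_add]
    exact hr.right_constraint hA h hpos hs n
  have huR : (0 : ℝ) < u.length := by exact_mod_cast hlen.1
  have hvR : (0 : ℝ) < v.length := by exact_mod_cast hlen.2
  have hslope : ∀ n : ℕ, wordSlope (u ++ wordRep v (n + 1))
      = wordSlope v - 1 / ((u.length + (n + 1) * v.length) * v.length) := by
    intro n
    rw [wordSlope_eq_add (h.iterate_left (n + 1)), List.length_append, length_wordRep]
    push_cast; ring
  have hslope1 : ∀ n : ℕ, wordSlope (u ++ wordRep v (n + 1)) < 1 := fun n => by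
    have h2 := wordSlope_lt_one (h.iterate_left n).ones_append_lt
    rwa [List.append_assoc] at h2
  have hslope0 : ∀ n : ℕ, 0 < wordSlope (u ++ wordRep v (n + 1)) := fun n => by
    have h2 := wordSlope_pos (h.iterate_left n).ones_append_pos
    rwa [List.append_assoc] at h2
  choose a ha0 ha using fun n => hr.exists_eq hA (hslope0 n).le (hslope1 n)
  have hapos : ∀ n, 0 < a n := fun n =>
    hr.pos_of_pos hA (ha0 n) (by rw [ha]; exact hslope0 n)
  have hle : ∀ n, a n * specRad (wordProd A v) ^ u.length
      ≤ (specRad (wordProd A v ^ (n + 1) * wordProd A u) / specRad (wordProd A v) ^ (n + 1))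
        ^ v.length := by
    intro n
    rw [hdiv, le_div_iff₀ (by positivity), mul_assoc, ← pow_add]
    exact hr.right_attained hA h (hapos _) _ (ha _)
  have htend' := htend.comp (tendsto_add_atTop_nat 1)
  -- `exists_bound` is not available in general because the slope of v may be 1; the attained
  -- inequalities themselves bound the parameters.
  obtain ⟨K, hK⟩ := htend'.bddAbove_range
  have haM : ∀ n, a n ≤ K / specRad (wordProd A v) ^ u.length := fun n => by
    rw [le_div_iff₀ (by positivity)]
    exact (hle n).trans (hK ⟨n, rfl⟩)
  have hlimr : Tendsto (fun n => r (a n)) atTop (𝓝 (wordSlope v)) := by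
    simp_rw [ha, hslope]
    have h1 : Tendsto (fun n : ℕ => ((u.length : ℝ) + (n + 1) * v.length) * v.length) atTop
        atTop := by
      apply Tendsto.atTop_mul_const hvR
      apply tendsto_atTop_add_const_left
      exact (tendsto_atTop_add_const_right _ _ tendsto_natCast_atTop_atTop).atTop_mul_const hvR
    simpa using tendsto_const_nhds.sub (h1.const_div_atTop 1)
  obtain ⟨α, hα0, hα, φ, hφ, hlim⟩ := hr.exists_subseq_limit hA ha0 haM hlimr
  have hlow : α * specRad (wordProd A v) ^ u.length
      ≤ specRad (domProj (wordProd A v) * wordProd A u) ^ v.length :=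
    le_of_tendsto_of_tendsto' (hlim.mul_const _) (htend'.comp hφ.tendsto_atTop) fun n => hle _
  constructor
  · have : specRad (domProj (wordProd A v) * wordProd A u) ^ v.length
      / specRad (wordProd A v) ^ u.length = α := by
      rw [div_eq_iff (by positivity)]
      exact le_antisymm (hup α hα0 hα) hlow
    rw [this]
    exact ⟨hα0, hα⟩
  · rintro β ⟨hβ0, hβ⟩
    rw [div_le_iff₀ (by positivity)]
    exact hup β hβ0 hβ

end IsOneRatioFunction

/-! ### Plateaus at rational slopes -/

theorem disc_eq_trace_det (M : Mat2) : disc M = M.trace ^ 2 - 4 * M.det := by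
  rw [Matrix.trace_fin_two, Matrix.det_fin_two]; unfold disc; ring

theorem disc_mul_comm (X Y : Mat2) : disc (X * Y) = disc (Y * X) := by
  rw [disc_eq_trace_det, disc_eq_trace_det, Matrix.trace_mul_comm, Matrix.det_mul_comm]

theorem specRad_domProj_mul_comm {X Y : Mat2} (hX : EntriesNonneg X) (hY : EntriesNonneg Y)
    (hd : 0 < disc (X * Y)) (ht : 0 < (X * Y).trace) :
    specRad (domProj (Y * X) * Y) = specRad (domProj (X * Y) * Y) := by
  have htr : Matrix.trace (Y * X) = Matrix.trace (X * Y) := Matrix.trace_mul_comm Y X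
  rw [specRad_domProj_mul (hY.mul hX) (disc_mul_comm X Y ▸ hd) (htr ▸ ht) hY,
    specRad_domProj_mul (hX.mul hY) hd ht hY]
  have h1 : (Y * X * Y).trace = (X * Y * Y).trace := by
    rw [mul_assoc, Matrix.trace_mul_comm]
  have h2 : eigMax (Y * X) = eigMax (X * Y) := by
    unfold eigMax
    rw [← Matrix.trace_fin_two, ← Matrix.trace_fin_two, htr, disc_mul_comm]
  have h3 : eigMin (Y * X) = eigMin (X * Y) := by
    unfold eigMin
    rw [← Matrix.trace_fin_two, ← Matrix.trace_fin_two, htr, disc_mul_comm]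
  rw [h1, h2, h3]

theorem fricke_wordProd_ne_zero {A : Fin 2 → Mat2} (hA : TechnicalHypotheses A) {u v : Word}
    (h : IsStandardPair u v) : fricke (wordProd A u) (wordProd A v) ≠ 0 := by
  intro h0
  have h1 := fricke_wordProd A h
  rw [h0, zero_mul] at h1
  exact mul_ne_zero (fricke_ne_zero hA)
    (mul_ne_zero (det_wordProd_ne_zero hA u) (det_wordProd_ne_zero hA v)) h1.symm

theorem length_and_ones_of_wordSlope {u v : Word} (h : IsStandardPair u v) {p q : ℕ} (hq : 0 < q)
    (hpq : p.Coprime q) (hs : wordSlope (u ++ v) = (p : ℝ) / q) :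
    ones (u ++ v) = p ∧ (u ++ v).length = q := by
  have hl : 0 < (u ++ v).length := by
    rw [List.length_append]; have := h.length_pos; omega
  have hlR : ((u ++ v).length : ℝ) ≠ 0 := by exact_mod_cast hl.ne'
  have hqR : (q : ℝ) ≠ 0 := by exact_mod_cast hq.ne'
  unfold wordSlope at hs
  rw [div_eq_div_iff hlR hqR] at hs
  have hs' : ones (u ++ v) * q = p * (u ++ v).length := by exact_mod_cast hs
  have h1 : q ∣ (u ++ v).length :=
    hpq.symm.dvd_of_dvd_mul_left ⟨ones (u ++ v), by rw [← hs', mul_comm]⟩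
  have h2 : (u ++ v).length ∣ q :=
    h.coprime.symm.dvd_of_dvd_mul_left ⟨p, by rw [hs', mul_comm]⟩
  have h3 := Nat.dvd_antisymm h2 h1
  refine ⟨?_, h3⟩
  rw [h3] at hs'
  exact Nat.eq_of_mul_eq_mul_right hq hs'

namespace IsOneRatioFunction

variable {A : Fin 2 → Mat2} {r : ℝ → ℝ} {u v : Word}

theorem preimage_eq_Icc (hr : IsOneRatioFunction A r) (hA : TechnicalHypotheses A) {γ a b : ℝ}
    (ha : IsLeast (preimageOf r {γ}) a) (hb : IsGreatest (preimageOf r {γ}) b) :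
    preimageOf r {γ} = Set.Icc a b := by
  ext α
  constructor
  · exact fun h => ⟨ha.2 h, hb.2 h⟩
  · rintro ⟨h1, h2⟩
    have h0 : 0 ≤ α := ha.1.1.trans h1
    refine ⟨h0, ?_⟩
    have e1 : r a = γ := ha.1.2
    have e2 : r b = γ := hb.1.2
    exact le_antisymm (e2 ▸ hr.monotoneOn hA h0 hb.1.1 h2) (e1 ▸ hr.monotoneOn hA ha.1.1 h0 h1)

/-- The left end comes from the pair (u, vu), the right end from (uv, v). The product along uv is
the reverse product, which cyclic invariance of trace and determinant repairs. -/
theorem preimage_standardPair (hr : IsOneRatioFunction A r) (hA : TechnicalHypotheses A)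
    (h : IsStandardPair u v) :
    (∀ i j, 0 < (wordProd A u * wordProd A v) i j) ∧
    ∃ P : Mat2, IsPowerLimit (wordProd A u * wordProd A v) P ∧
      specRad (wordProd A u * P) ^ (u ++ v).length /
        specRad (wordProd A u * wordProd A v) ^ u.length <
      specRad (wordProd A u * wordProd A v) ^ v.length /
        specRad (P * wordProd A v) ^ (u ++ v).length ∧
      preimageOf r {wordSlope (u ++ v)} = Set.Icc
        (specRad (wordProd A u * P) ^ (u ++ v).length /
          specRad (wordProd A u * wordProd A v) ^ u.length)
        (specRad (wordProd A u * wordProd A v) ^ v.length /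
          specRad (P * wordProd A v) ^ (u ++ v).length) := by
  have hU := entriesNonneg_word hA u
  have hV := entriesNonneg_word hA v
  have hpos : ∀ i j, 0 < (wordProd A u * wordProd A v) i j := by
    rw [← wordProd_append]
    refine wordProd_pos hA ?_ ?_
    · rw [ones_append, add_comm, ← ones_append]; exact h.ones_append_pos
    · rw [ones_append, add_comm, ← ones_append, List.length_append, add_comm,
        ← List.length_append]
      exact h.ones_append_lt
  have hd := disc_pos_of_pos hpos
  have ht := trace_pos_of_pos hpos
  have hP := domProj_nonneg (hU.mul hV) hd ht
  have hρ := specRad_pos_of_trace_pos (hU.mul hV) ht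
  have hmin := hr.isLeast_preimage hA h.right (by rw [wordProd_append]; exact hd)
  obtain ⟨hmax0, hmax⟩ := hr.isGreatest_preimage hA h.left
    (by rw [wordProd_append, disc_mul_comm]; exact hd)
  rw [wordProd_append] at hmin hmax0 hmax
  rw [specRad_domProj_mul_comm hU hV hd ht] at hmax0 hmax
  rw [specRad_mul_comm hV hU] at hmax
  rw [specRad_mul_comm hP hU, ← wordSlope_append_comm u v, List.length_append, add_comm v.length,
    ← List.length_append] at hmin
  refine ⟨hpos, domProj (wordProd A u * wordProd A v),
    isPowerLimit_domProj (hU.mul hV) hd ht, ?_, hr.preimage_eq_Icc hA hmin hmax⟩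
  -- If the ends agreed, cross-multiplying would equate two powers with exponent |u| + |v|, and
  -- their bases would agree only if the Fricke polynomial vanished.
  refine (hmin.2 hmax.1).lt_of_ne fun heq => ?_
  rw [div_eq_div_iff (by positivity) (by positivity), ← mul_pow, ← pow_add, add_comm,
    ← List.length_append] at heq
  have hq : (u ++ v).length ≠ 0 := by
    rw [List.length_append]; have := h.length_pos; omega
  have h1 := (pow_left_inj₀ (mul_nonneg (specRad_nonneg _) (specRad_nonneg _)) hρ.le hq).1 heq
  rw [specRad_mul_comm hU hP, specRad_domProj_mul_mul hU hV hd ht, sub_eq_self, div_eq_zero_iff]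
    at h1
  have hne : eigMax (wordProd A u * wordProd A v) - eigMin (wordProd A u * wordProd A v) ≠ 0 := by
    linarith [eigMin_lt_eigMax hd]
  rcases h1 with h1 | h1
  · exact mul_ne_zero hρ.ne' (fricke_wordProd_ne_zero hA h) h1
  · exact pow_ne_zero 2 hne h1

theorem disc_pos_of_preimage_zero (hr : IsOneRatioFunction A r) (hA : TechnicalHypotheses A)
    {α : ℝ} (hα : 0 < α) (h : r α = 0) : 0 < disc (A 0) := by
  refine (EntriesNonneg.disc_nonneg (hA.nonneg 0)).lt_of_ne fun h0 => ?_
  have hρ := specRad_pos_of_trace_pos (hA.nonneg 0) (hA.trace_pos 0)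
  -- Linear growth of the trace defeats the constraint for large n; the factor 2 is lost in bounding
  -- the trace by the spectral radius.
  obtain ⟨n, hn⟩ := ((tendsto_trace_pow_mul_atTop (hA.nonneg 0) (hA.nonneg 1) (hA.trace_pos 0)
    h0.symm (fricke_ne_zero hA)).eventually_gt_atTop (2 * (specRad (A 0) / α))).exists
  have h1 := hr.left_constraint hA IsStandardPair.base hα
    (by rw [h]; simp [wordSlope, ones]) n
  simp only [wordProd_singleton, List.length_singleton, pow_one, mul_one] at h1
  have h2 := trace_le_two_mul_specRad
    ((EntriesNonneg.pow (hA.nonneg 0) n).mul (hA.nonneg 1))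
  rw [lt_div_iff₀ (by positivity)] at hn
  have h3 := hn.trans_le h2
  have h4 : specRad (A 0) ^ (1 + n) = specRad (A 0) / α * specRad (A 0) ^ n * α := by
    field_simp
    ring
  rw [h4] at h1
  have h5 : specRad (A 0 ^ n * A 1) ≤ specRad (A 0) / α * specRad (A 0) ^ n :=
    le_of_mul_le_mul_right (by linarith) hα
  linarith

theorem disc_pos_of_preimage_one (hr : IsOneRatioFunction A r) (hA : TechnicalHypotheses A)
    {α : ℝ} (hα : 0 ≤ α) (h : r α = 1) : 0 < disc (A 1) := by
  have hpos : 0 < α := hr.pos_of_pos hA hα (by rw [h]; exact one_pos)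
  refine (EntriesNonneg.disc_nonneg (hA.nonneg 1)).lt_of_ne fun h0 => ?_
  have hρ := specRad_pos_of_trace_pos (hA.nonneg 1) (hA.trace_pos 1)
  obtain ⟨n, hn⟩ := ((tendsto_trace_pow_mul_atTop (hA.nonneg 1) (hA.nonneg 0) (hA.trace_pos 1)
    h0.symm (by rw [fricke_swap]; exact fricke_ne_zero hA)).eventually_gt_atTop
      (2 * (α * specRad (A 1)))).exists
  have h1 := hr.right_constraint hA IsStandardPair.base hpos
    (by rw [h]; simp [wordSlope, ones]) n
  simp only [wordProd_singleton, List.length_singleton, pow_one, mul_one] at h1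
  have h2 := trace_le_two_mul_specRad
    ((EntriesNonneg.pow (hA.nonneg 1) n).mul (hA.nonneg 0))
  rw [lt_div_iff₀ (by positivity)] at hn
  rw [add_comm, pow_succ] at h1
  linarith

theorem preimage_zero (hr : IsOneRatioFunction A r) (hA : TechnicalHypotheses A)
    (hD : Diagonalisable (A 0)) : ∃ P₀ : Mat2, IsPowerLimit (A 0) P₀ ∧
      0 < specRad (A 0) / specRad (P₀ * A 1) ∧
      preimageOf r {0} = Set.Icc 0 (specRad (A 0) / specRad (P₀ * A 1)) := by
  have hd := disc_pos_of_diagonalisable (hA.nonneg 0) (fricke_ne_zero hA) hD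
  obtain ⟨hP, hmax⟩ := hr.isGreatest_preimage hA IsStandardPair.base
    (by rw [wordProd_singleton]; exact hd)
  have hs : wordSlope [0] = 0 := by simp [wordSlope, ones]
  simp only [wordProd_singleton, List.length_singleton, pow_one, hs] at hP hmax
  refine ⟨domProj (A 0), isPowerLimit_domProj (hA.nonneg 0) hd (hA.trace_pos 0),
    div_pos (specRad_pos_of_trace_pos (hA.nonneg 0) (hA.trace_pos 0)) hP,
    hr.preimage_eq_Icc hA ⟨⟨le_rfl, hr.map_zero hA⟩, fun _ h => h.1⟩ hmax⟩

theorem preimage_one (hr : IsOneRatioFunction A r) (hA : TechnicalHypotheses A)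
    (hD : Diagonalisable (A 1)) : ∃ P₁ : Mat2, IsPowerLimit (A 1) P₁ ∧
      preimageOf r {1} = Set.Ici (specRad (P₁ * A 0) / specRad (A 1)) := by
  have hd := disc_pos_of_diagonalisable (N := A 0) (hA.nonneg 1)
    (by rw [fricke_swap]; exact fricke_ne_zero hA) hD
  have hmin := hr.isLeast_preimage hA IsStandardPair.base
    (by rw [wordProd_singleton]; exact hd)
  have hs : wordSlope [1] = 1 := by simp [wordSlope, ones]
  simp only [wordProd_singleton, List.length_singleton, pow_one, hs] at hmin
  refine ⟨domProj (A 1), isPowerLimit_domProj (hA.nonneg 1) hd (hA.trace_pos 1), ?_⟩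
  ext α
  refine ⟨fun h => hmin.2 h, fun h => ?_⟩
  have h0 : 0 ≤ α := hmin.1.1.trans h
  refine ⟨h0, le_antisymm (hr.le_one h0) ?_⟩
  have e : r _ = 1 := hmin.1.2
  rw [← e]
  exact hr.monotoneOn hA hmin.1.1 h0 h

theorem preimage_zero_nonempty_iff (hr : IsOneRatioFunction A r) (hA : TechnicalHypotheses A) :
    (preimageOf r {0} ∩ Set.Ioi 0).Nonempty ↔ Diagonalisable (A 0) := by
  constructor
  · rintro ⟨α, ⟨-, h⟩, hα⟩
    exact diagonalisable_of_disc_pos (hr.disc_pos_of_preimage_zero hA hα h)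
  · intro hD
    obtain ⟨P, -, hpos, h⟩ := hr.preimage_zero hA hD
    exact ⟨_, h ▸ Set.right_mem_Icc.2 hpos.le, hpos⟩

theorem preimage_one_nonempty_iff (hr : IsOneRatioFunction A r) (hA : TechnicalHypotheses A) :
    (preimageOf r {1}).Nonempty ↔ Diagonalisable (A 1) := by
  constructor
  · rintro ⟨α, hα, h⟩
    exact diagonalisable_of_disc_pos (hr.disc_pos_of_preimage_one hA hα h)
  · intro hD
    obtain ⟨P, -, h⟩ := hr.preimage_one hA hD
    exact ⟨_, h ▸ Set.self_mem_Ici⟩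

end IsOneRatioFunction

/-! ### Exponential decay of eigenvalue ratios -/

/-- All contiguous subwords of length `L` contain both letters. -/
def WindowsMixed (L : ℕ) (w : Word) : Prop := ∀ a, a + L ≤ w.length →
  0 < ones ((w.drop a).take L) ∧ ones ((w.drop a).take L) < L

/-- The prefix discrepancies at a and at a + L lie in one window shorter than the word length, so a
constant block of length L would force too large a jump. -/
theorem IsStandardPair.windowsMixed {x y : Word} (h : IsStandardPair x y) {L : ℕ}
    (h0 : (x ++ y).length ≤ ones (x ++ y) * L)
    (h1 : (x ++ y).length + ones (x ++ y) * L ≤ (x ++ y).length * L) :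
    WindowsMixed L (x ++ y) := by
  intro a ha
  have hq : 0 < (x ++ y).length := by
    rw [List.length_append]; have := h.length_pos; omega
  obtain ⟨b1, b2⟩ := h.prefixBound a (by omega)
  obtain ⟨b3, b4⟩ := h.prefixBound (a + L) ha
  rw [List.take_add, ones_append ((x ++ y).take a)] at b3 b4
  generalize ones (((x ++ y).drop a).take L) = c at *
  generalize ones ((x ++ y).take a) = k at *
  generalize ones (x ++ y) = p at *
  generalize (x ++ y).length = q at *
  push_cast at *
  zify at *
  constructor
  · by_contra hc
    have : (c : ℤ) = 0 := by omega
    rw [this] at b3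
    nlinarith
  · by_contra hc
    have : (q : ℤ) * L ≤ q * c := mul_le_mul_of_nonneg_left (by omega) hq.le
    nlinarith

/-- There are finitely many mixed words of length L, each with positive entries and hence permanent
strictly above |det|. The least ratio τ is gained once per disjoint block. -/
theorem exists_rate_windowsMixed {A : Fin 2 → Mat2} (hA : TechnicalHypotheses A) (L : ℕ) :
    ∃ τ : ℝ, 1 < τ ∧ ∀ n : ℕ, ∀ w : Word, n * L ≤ w.length → WindowsMixed L w →
      τ ^ n * |(wordProd A w).det| ≤ perm2 (wordProd A w) := by
  obtain ⟨τ, hτ, hmin⟩ : ∃ τ : ℝ, 1 < τ ∧ ∀ w : Word, w.length = L → 0 < ones w → ones w < L →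
      τ * |(wordProd A w).det| ≤ perm2 (wordProd A w) := by
    have hfin : {w : Word | w.length = L ∧ 0 < ones w ∧ ones w < L}.Finite :=
      (List.finite_length_eq (Fin 2) L).subset fun w hw => hw.1
    have hpos : ∀ w : Word, 0 < |(wordProd A w).det| := fun w =>
      abs_pos.2 (det_wordProd_ne_zero hA w)
    rcases Set.eq_empty_or_nonempty {w : Word | w.length = L ∧ 0 < ones w ∧ ones w < L}
      with he | hne
    -- No mixed word of length L exists, so any value above 1 serves.
    · refine ⟨2, by norm_num, fun w h1 h2 h3 => ?_⟩
      exact absurd (show w ∈ {w : Word | w.length = L ∧ 0 < ones w ∧ ones w < L} from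
        ⟨h1, h2, h3⟩) (by rw [he]; exact Set.notMem_empty w)
    · obtain ⟨w₀, hw₀, hle⟩ := Set.exists_min_image _
        (fun w : Word => perm2 (wordProd A w) / |(wordProd A w).det|) hfin hne
      refine ⟨perm2 (wordProd A w₀) / |(wordProd A w₀).det|, ?_, fun w h1 h2 h3 => ?_⟩
      · rw [one_lt_div (hpos _)]
        obtain ⟨e1, e2, e3⟩ := hw₀
        exact abs_det_lt_perm2 (wordProd_pos hA e2 (by rw [e1]; exact e3))
      · have := hle w ⟨h1, h2, h3⟩
        rwa [le_div_iff₀ (hpos _)] at this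
  refine ⟨τ, hτ, fun n => ?_⟩
  induction n with
  | zero =>
    intro w _ _
    rw [pow_zero, one_mul]
    exact abs_det_le_perm2 (entriesNonneg_word hA w)
  | succ n ih =>
    intro w hw hmix
    rw [add_mul, one_mul] at hw
    obtain ⟨h1, h2⟩ := hmix 0 (by omega)
    rw [List.drop_zero] at h1 h2
    have h3 := hmin (w.take L) (by rw [List.length_take]; omega) h1 h2
    have h4 := ih (w.drop L) (by rw [List.length_drop]; omega) fun a ha => by
      rw [List.length_drop] at ha
      have := hmix (L + a) (by omega)
      rwa [← List.drop_drop] at this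
    have h5 := perm2_mul_le (entriesNonneg_word hA (w.drop L)) (entriesNonneg_word hA (w.take L))
    rw [← List.take_append_drop L w, wordProd_append]
    refine le_trans ?_ h5
    rw [Matrix.det_mul, abs_mul, pow_succ]
    calc _ = τ ^ n * |(wordProd A (w.drop L)).det| * (τ * |(wordProd A (w.take L)).det|) := by ring
      _ ≤ _ := mul_le_mul h4 h3 (by positivity) (perm2_nonneg (entriesNonneg_word hA _))

/-- The permanent is at most twice the square of the large eigenvalue and |det| is the product of
the two moduli; cancel one factor. -/
theorem abs_eigMin_le_of_perm2 {M : Mat2} (hM : EntriesNonneg M) (ht : 0 < M.trace) {c : ℝ}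
    (hc : c * |M.det| ≤ perm2 M) : c * |eigMin M| ≤ 2 * eigMax M := by
  have hρ := specRad_pos_of_trace_pos hM ht
  rw [specRad_eq hM] at hρ
  have h1 := hc.trans (perm2_le hM)
  rw [specRad_eq hM, ← eigMax_mul_eigMin hM.disc_nonneg, abs_mul, abs_of_pos hρ] at h1
  have h2 : eigMax M * (c * |eigMin M|) ≤ eigMax M * (2 * eigMax M) := by linarith
  exact le_of_mul_le_mul_left h2 hρ

/-- The slope of `u` lies in `[1 / L, 1 - 1 / L]`. -/
def SlopeInside (L : ℕ) (u : Word) : Prop :=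
  u.length ≤ ones u * L ∧ u.length + ones u * L ≤ u.length * L

theorem exists_rate_eigMin {A : Fin 2 → Mat2} (hA : TechnicalHypotheses A) (L : ℕ) :
    ∃ τ : ℝ, 1 < τ ∧ ∀ u v : Word, IsStandardPair u v →
      (SlopeInside L u → 0 < disc (wordProd A u) ∧
        τ ^ (u.length / L) * |eigMin (wordProd A u)| ≤ 2 * eigMax (wordProd A u)) ∧
      (SlopeInside L v → 0 < disc (wordProd A v) ∧
        τ ^ (v.length / L) * |eigMin (wordProd A v)| ≤ 2 * eigMax (wordProd A v)) := by
  obtain ⟨τ, hτ, H⟩ := exists_rate_windowsMixed hA L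
  refine ⟨τ, hτ, fun u v h => ⟨fun hs => ?_, fun hs => ?_⟩⟩
  · rcases h.left_eq with rfl | ⟨x, y, hxy, rfl⟩
    · simp [SlopeInside, ones] at hs
    · have hp := wordProd_pos hA hxy.ones_append_pos hxy.ones_append_lt
      exact ⟨disc_pos_of_pos hp, abs_eigMin_le_of_perm2 (entriesNonneg_word hA _)
        (trace_pos_of_pos hp) (H _ _ (Nat.div_mul_le_self _ _) (hxy.windowsMixed hs.1 hs.2))⟩
  · rcases h.right_eq with rfl | ⟨x, y, hxy, rfl⟩
    · simp [SlopeInside, ones] at hs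
    · have hp := wordProd_pos hA hxy.ones_append_pos hxy.ones_append_lt
      have hlen : (y ++ x).length = (x ++ y).length := by simp [add_comm]
      have hones : ones (y ++ x) = ones (x ++ y) := by
        rw [ones_append, ones_append, add_comm]
      have hs' : SlopeInside L (x ++ y) := by
        unfold SlopeInside at *
        rwa [hlen, hones] at hs
      have key := abs_eigMin_le_of_perm2 (entriesNonneg_word hA _)
        (trace_pos_of_pos hp) (H _ _ (Nat.div_mul_le_self _ _) (hxy.windowsMixed hs'.1 hs'.2))
      have hdisc : disc (wordProd A (y ++ x)) = disc (wordProd A (x ++ y)) := by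
        rw [wordProd_append, wordProd_append, disc_mul_comm]
      have htr : (wordProd A (y ++ x)).trace = (wordProd A (x ++ y)).trace := by
        rw [wordProd_append, wordProd_append, Matrix.trace_mul_comm]
      rw [hlen]
      unfold eigMin eigMax at *
      rw [← Matrix.trace_fin_two] at *
      rw [hdisc, htr]
      exact ⟨disc_pos_of_pos hp, key⟩

/-! ### Gaps between neighbouring plateaus -/

/-- Everything is governed by the defect E = z − l1 l2 − m1 m2: T1 and T2 exceed l2 and l1 by E/(l1
− m1) and E/(l2 − m2), and the Fricke identity bounds E by a multiple of |m1 m2|. -/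
theorem sub_le_of_trace_defect {l1 l2 m1 m2 T1 T2 z K : ℝ} {p q : ℕ} (hq : q ≠ 0)
    (hl1 : 0 < l1) (hl2 : 0 < l2) (hu2 : 2 * |m1| ≤ l1) (hv2 : 2 * |m2| ≤ l2)
    (hT1 : T1 = (z - m1 * (l2 + m2)) / (l1 - m1)) (hT2 : T2 = (z - m2 * (l1 + m1)) / (l2 - m2))
    (hT1pos : 0 < T1) (hT2nn : 0 ≤ T2)
    (hfac : K * (l1 * m1 * (l2 * m2)) =
      (z - l1 * l2 - m1 * m2) * (z - l1 * m2 - m1 * l2))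
    (hle : l1 ^ q / T1 ^ p ≤ T2 ^ q / l2 ^ p) :
    T2 ^ q / l2 ^ p - l1 ^ q / T1 ^ p ≤
      T2 ^ q / l2 ^ p * ((p + q) * (8 * |K| * (|m1| / l1) * (|m2| / l2))) := by
  have ha0 : 0 ≤ T2 ^ q / l2 ^ p := by positivity
  obtain ⟨E, hE⟩ : ∃ E, E = z - l1 * l2 - m1 * m2 := ⟨_, rfl⟩
  have hm1 := le_abs_self m1
  have hm2 := le_abs_self m2
  have hD1 : l1 / 2 ≤ l1 - m1 := by linarith
  have hD2 : l2 / 2 ≤ l2 - m2 := by linarith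
  have hD1p : 0 < l1 - m1 := by linarith
  have hD2p : 0 < l2 - m2 := by linarith
  have hT1' : T1 = l2 + E / (l1 - m1) := by
    rw [hT1, hE]; field_simp; ring
  have hT2' : T2 = l1 + E / (l2 - m2) := by
    rw [hT2, hE]; field_simp; ring
  -- A negative defect would reverse the order of the two endpoints.
  have hE0 : 0 ≤ E := by
    by_contra hneg
    have hneg := not_le.1 hneg
    have e1 : T1 < l2 := by
      rw [hT1']; have := div_neg_of_neg_of_pos hneg hD1p; linarith
    have e2 : T2 < l1 := by
      rw [hT2']; have := div_neg_of_neg_of_pos hneg hD2p; linarith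
    have e3 : T2 ^ q / l2 ^ p < l1 ^ q / T1 ^ p := by
      apply div_lt_div₀ (pow_lt_pow_left₀ e2 hT2nn hq)
        (pow_le_pow_left₀ hT1pos.le e1.le _) (by positivity) (by positivity)
    linarith
  have hEF : E * (E + (l1 - m1) * (l2 - m2)) = K * (l1 * m1 * (l2 * m2)) := by
    rw [hfac, hE]; ring
  obtain ⟨t, ht⟩ : ∃ t, t = 8 * |K| * (|m1| / l1) * (|m2| / l2) := ⟨_, rfl⟩
  rw [← ht]
  have hEt : 2 * E ≤ t * (l1 * l2) := by
    have e1 : E * ((l1 / 2) * (l2 / 2)) ≤ |K| * (l1 * |m1| * (l2 * |m2|)) := by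
      calc E * ((l1 / 2) * (l2 / 2)) ≤ E * (E + (l1 - m1) * (l2 - m2)) := by
            refine mul_le_mul_of_nonneg_left ?_ hE0
            have := mul_le_mul hD1 hD2 (by positivity) hD1p.le
            linarith
        _ = K * (l1 * m1 * (l2 * m2)) := hEF
        _ ≤ |K * (l1 * m1 * (l2 * m2))| := le_abs_self _
        _ = _ := by rw [abs_mul, abs_mul, abs_mul, abs_mul, abs_of_pos hl1, abs_of_pos hl2]
    have e2 : t * (l1 * l2) = 8 * |K| * |m1| * |m2| := by
      rw [ht]; field_simp
    rw [e2]
    have hl12 : 0 < l1 * l2 := mul_pos hl1 hl2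
    refine le_of_mul_le_mul_right ?_ hl12
    nlinarith
  have ht1 : E / (l1 - m1) ≤ l2 * t := by
    rw [div_le_iff₀ hD1p]
    have : 0 ≤ l2 * t := by rw [ht]; positivity
    nlinarith [mul_le_mul_of_nonneg_left hD1 this]
  have ht2 : E / (l2 - m2) ≤ l1 * t := by
    rw [div_le_iff₀ hD2p]
    have : 0 ≤ l1 * t := by rw [ht]; positivity
    nlinarith [mul_le_mul_of_nonneg_left hD2 this]
  have hexp := Real.add_one_le_exp t
  have hT1e : T1 ≤ l2 * Real.exp t := by
    have := mul_le_mul_of_nonneg_left hexp hl2.le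
    rw [hT1']; linarith
  have hT2e : T2 ≤ l1 * Real.exp t := by
    have := mul_le_mul_of_nonneg_left hexp hl1.le
    rw [hT2']; linarith
  -- The relative errors in T1 and T2 are at most t, so the p + q factors cost at most exp((p + q)
  -- t).
  have hab : T2 ^ q / l2 ^ p ≤
      l1 ^ q / T1 ^ p * Real.exp ((p + q) * t) := by
    rw [div_le_iff₀ (by positivity), div_mul_eq_mul_div, div_mul_eq_mul_div,
      le_div_iff₀ (by positivity)]
    have e1 := pow_le_pow_left₀ hT2nn hT2e q
    have e2 := pow_le_pow_left₀ hT1pos.le hT1e p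
    refine (mul_le_mul e1 e2 (by positivity) (by positivity)).trans_eq ?_
    rw [mul_pow, mul_pow, ← Real.exp_nat_mul, ← Real.exp_nat_mul, add_mul, Real.exp_add]
    ring
  generalize T2 ^ q / l2 ^ p = a at *
  generalize l1 ^ q / T1 ^ p = b at *
  have e1 := Real.add_one_le_exp (-(((p : ℝ) + q) * t))
  have e2 : a * Real.exp (-(((p : ℝ) + q) * t)) ≤ b := by
    rw [Real.exp_neg, ← div_eq_mul_inv, div_le_iff₀ (Real.exp_pos _)]
    exact hab
  have e3 := mul_le_mul_of_nonneg_left e1 ha0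
  linarith

theorem IsOneRatioFunction.gap_le {A : Fin 2 → Mat2} {r : ℝ → ℝ} (hr : IsOneRatioFunction A r)
    (hA : TechnicalHypotheses A) {u v : Word} (h : IsStandardPair u v)
    (hu : 0 < disc (wordProd A u)) (hv : 0 < disc (wordProd A v))
    (hu2 : 2 * |eigMin (wordProd A u)| ≤ eigMax (wordProd A u))
    (hv2 : 2 * |eigMin (wordProd A v)| ≤ eigMax (wordProd A v)) :
    ∃ a b : ℝ, b ∈ preimageOf r {wordSlope u} ∧ a ∈ preimageOf r {wordSlope v} ∧
      a - b ≤ a * ((u.length + v.length) * (8 * |fricke (A 0) (A 1) / ((A 0).det * (A 1).det)| *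
        (|eigMin (wordProd A u)| / eigMax (wordProd A u)) *
        (|eigMin (wordProd A v)| / eigMax (wordProd A v)))) := by
  have hX := entriesNonneg_word hA u
  have hY := entriesNonneg_word hA v
  have htu := trace_left_pos hA h
  have htv := trace_right_pos hA h
  obtain ⟨hT1pos, hb⟩ := hr.isGreatest_preimage hA h hu
  have ha := hr.isLeast_preimage hA h hv
  refine ⟨_, _, hb.1, ha.1, ?_⟩
  obtain ⟨hb0, hb1⟩ := hb.1
  obtain ⟨ha0, ha1⟩ := ha.1
  have hlen := h.length_pos
  have hslope : wordSlope u < wordSlope v := by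
    rw [wordSlope_eq_add h]
    have : (0 : ℝ) < u.length := by exact_mod_cast hlen.1
    have : (0 : ℝ) < v.length := by exact_mod_cast hlen.2
    have : (0 : ℝ) < 1 / (u.length * v.length) := by positivity
    linarith
  have hle : specRad (wordProd A u) ^ v.length /
      specRad (domProj (wordProd A u) * wordProd A v) ^ u.length ≤
      specRad (domProj (wordProd A v) * wordProd A u) ^ v.length /
        specRad (wordProd A v) ^ u.length := by
    by_contra hlt
    have h1 := hr.monotoneOn hA ha0 hb0 (not_le.1 hlt).le
    rw [Set.mem_singleton_iff.1 ha1, Set.mem_singleton_iff.1 hb1] at h1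
    exact h1.not_gt hslope
  have hF := fricke_wordProd A h
  have hfac := fricke_factor hu.le hv.le
  have hT1 := specRad_domProj_mul hX hu htu hY
  have hT2 := specRad_domProj_mul hY hv htv hX
  have hT2nn := specRad_nonneg (domProj (wordProd A v) * wordProd A u)
  have hdets : (A 0).det * (A 1).det ≠ 0 := by
    have h0 := det_wordProd_ne_zero hA [0]
    have h1 := det_wordProd_ne_zero hA [1]
    rw [wordProd_singleton] at h0 h1
    exact mul_ne_zero h0 h1
  have hl1 := specRad_word_pos hA htu
  have hl2 := specRad_word_pos hA htv
  have hdu := eigMax_mul_eigMin hu.le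
  have hdv := eigMax_mul_eigMin hv.le
  rw [Matrix.trace_mul_comm (wordProd A v)] at hT2
  rw [← eigMax_add_eigMin (wordProd A v)] at hT1
  rw [← eigMax_add_eigMin (wordProd A u)] at hT2
  rw [← hdu, ← hdv] at hF
  rw [specRad_eq hX] at *
  rw [specRad_eq hY] at *
  obtain ⟨K, hK⟩ : ∃ K, K = fricke (A 0) (A 1) / ((A 0).det * (A 1).det) := ⟨_, rfl⟩
  have hFK : fricke (wordProd A u) (wordProd A v) = K * (eigMax (wordProd A u) *
      eigMin (wordProd A u) * (eigMax (wordProd A v) * eigMin (wordProd A v))) := by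
    rw [hK, div_mul_eq_mul_div, eq_div_iff hdets]
    exact hF
  rw [← hK]
  rw [hFK] at hfac
  clear hF hFK hdu hdv hK hb ha ha1 hb1
  generalize specRad (domProj (wordProd A u) * wordProd A v) = T1 at *
  generalize specRad (domProj (wordProd A v) * wordProd A u) = T2 at *
  generalize (wordProd A u * wordProd A v).trace = z at *
  generalize eigMax (wordProd A u) = l1 at *
  generalize eigMin (wordProd A u) = m1 at *
  generalize eigMax (wordProd A v) = l2 at *
  generalize eigMin (wordProd A v) = m2 at *
  exact sub_le_of_trace_defect hlen.2.ne' hl1 hl2 hu2 hv2 hT1 hT2 hT1pos hT2nn hfac hle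

/-! ### Hausdorff dimension -/

open scoped ENNReal NNReal MeasureTheory in
-- For any exponent d > 0 the covering sum is dominated by ρ^(dn) times a product of four convergent
-- geometric series, so the d-dimensional measure vanishes.
theorem dimH_eq_zero_of_geometric_covers {s : Set ℝ} {C ρ : ℝ≥0∞} (hC : C ≠ ⊤) (hρ : ρ < 1)
    (t : ℕ → ℕ × ℕ × ℕ × ℕ → Set ℝ)
    (hdiam : ∀ᶠ n in atTop, ∀ i, Metric.ediam (t n i) ≤
      C * ρ ^ (n + (i.1 + i.2.1 + i.2.2.1 + i.2.2.2)))
    (hst : ∀ᶠ n in atTop, s ⊆ ⋃ i, t n i) : dimH s = 0 := by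
  have key : ∀ d : ℝ≥0, 0 < d → dimH s ≤ d := by
    intro d hd
    have hd' : (0 : ℝ) < d := by exact_mod_cast hd
    apply dimH_le_of_hausdorffMeasure_ne_top
    set σ : ℝ≥0∞ := ρ ^ (d : ℝ) with hσ
    have hσ1 : σ < 1 := ENNReal.rpow_lt_one hρ hd'
    have hgeo : ∑' n : ℕ, σ ^ n ≠ ⊤ := by
      rw [ENNReal.tsum_geometric]
      exact ENNReal.inv_ne_top.2 (tsub_pos_of_lt hσ1).ne'
    have hsum : ∑' i : ℕ × ℕ × ℕ × ℕ, σ ^ (i.1 + i.2.1 + i.2.2.1 + i.2.2.2) ≠ ⊤ := by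
      have : ∀ i : ℕ × ℕ × ℕ × ℕ, σ ^ (i.1 + i.2.1 + i.2.2.1 + i.2.2.2)
          = σ ^ i.1 * (σ ^ i.2.1 * (σ ^ i.2.2.1 * σ ^ i.2.2.2)) := fun i => by
        rw [pow_add, pow_add, pow_add]; ring
      simp_rw [this]
      rw [ENNReal.tsum_prod']
      simp_rw [ENNReal.tsum_mul_left]
      rw [ENNReal.tsum_mul_right, ENNReal.tsum_prod']
      simp_rw [ENNReal.tsum_mul_left]
      rw [ENNReal.tsum_mul_right, ENNReal.tsum_prod']
      simp_rw [ENNReal.tsum_mul_left]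
      rw [ENNReal.tsum_mul_right]
      exact ENNReal.mul_ne_top hgeo (ENNReal.mul_ne_top hgeo (ENNReal.mul_ne_top hgeo hgeo))
    have hr : Tendsto (fun n : ℕ => C * ρ ^ n) atTop (𝓝 0) := by
      have := ENNReal.Tendsto.const_mul (ENNReal.tendsto_pow_atTop_nhds_zero_of_lt_one hρ)
        (Or.inr hC)
      simpa using this
    have hle := MeasureTheory.Measure.hausdorffMeasure_le_liminf_tsum (d : ℝ) s _ hr t
      (hdiam.mono fun n hn i => (hn i).trans 
        (mul_le_mul_right (pow_le_pow_right_of_le_one' hρ.le (Nat.le_add_right _ _)) C)) hst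
    have hzero : Tendsto (fun n : ℕ => C ^ (d : ℝ) * σ ^ n *
        ∑' i : ℕ × ℕ × ℕ × ℕ, σ ^ (i.1 + i.2.1 + i.2.2.1 + i.2.2.2)) atTop (𝓝 0) := by
      have h1 := ENNReal.Tendsto.const_mul (a := C ^ (d : ℝ))
        (ENNReal.tendsto_pow_atTop_nhds_zero_of_lt_one hσ1)
        (Or.inr (ENNReal.rpow_ne_top_of_nonneg hd'.le hC))
      have h2 := ENNReal.Tendsto.mul_const h1 (Or.inr hsum)
      simpa using h2
    have hbound : ∀ᶠ n in atTop, ∑' i, Metric.ediam (t n i) ^ (d : ℝ) ≤ C ^ (d : ℝ) * σ ^ n *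
        ∑' i : ℕ × ℕ × ℕ × ℕ, σ ^ (i.1 + i.2.1 + i.2.2.1 + i.2.2.2) := by
      filter_upwards [hdiam] with n hn
      rw [← ENNReal.tsum_mul_left]
      refine ENNReal.tsum_le_tsum fun i => ?_
      refine (ENNReal.rpow_le_rpow (hn i) hd'.le).trans_eq ?_
      rw [ENNReal.mul_rpow_of_nonneg _ _ hd'.le, hσ, mul_assoc, ← pow_add, ← ENNReal.rpow_natCast,
        ← ENNReal.rpow_natCast, ← ENNReal.rpow_mul, ← ENNReal.rpow_mul, mul_comm (d : ℝ)]
    have hlim := tendsto_of_tendsto_of_tendsto_of_le_of_le' tendsto_const_nhds hzero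
      (Eventually.of_forall fun _ => zero_le) hbound
    rw [hlim.liminf_eq] at hle
    exact (hle.trans_lt ENNReal.zero_lt_top).ne
  refine le_antisymm ?_ (zero_le)
  refine le_of_forall_gt fun c hc => ?_
  obtain ⟨d, hd0, hdc⟩ := ENNReal.lt_iff_exists_nnreal_btwn.1 hc
  exact (key d (by exact_mod_cast hd0)).trans_lt hdc

theorem exists_dist_lower_bound {γ : ℝ} (hγ : Irrational γ) (N : ℕ) :
    ∃ δ : ℝ, 0 < δ ∧ ∀ q : ℕ, 0 < q → q < N → ∀ p : ℕ, δ ≤ |q * γ - p| := by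
  induction N with
  | zero => exact ⟨1, one_pos, fun q _ h => absurd h (Nat.not_lt_zero q)⟩
  | succ N ih =>
    obtain ⟨δ, hδ, h⟩ := ih
    rcases Nat.eq_zero_or_pos N with rfl | hN
    · exact ⟨1, one_pos, fun q h1 h2 => by omega⟩
    · have hirr : Irrational (N * γ) := hγ.natCast_mul hN.ne'
      have hpos : 0 < |N * γ - round (N * γ)| := by
        rw [abs_pos, sub_ne_zero]
        exact hirr.ne_int _
      refine ⟨min δ |N * γ - round (N * γ)|, lt_min hδ hpos, fun q h1 h2 p => ?_⟩
      rcases (Nat.lt_succ_iff.1 h2).lt_or_eq with h3 | rfl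
      · exact (min_le_left _ _).trans (h q h1 h3 p)
      · refine (min_le_right _ _).trans ?_
        exact_mod_cast round_le ((q : ℝ) * γ) (p : ℤ)

theorem exists_standardPair_around {γ : ℝ} (hγ : Irrational γ) (h0 : 0 < γ) (h1 : γ < 1) (N : ℕ) :
    ∃ u v, IsStandardPair u v ∧ wordSlope u < γ ∧ γ < wordSlope v ∧ N ≤ u.length + v.length := by
  induction N with
  | zero => exact ⟨[0], [1], .base, by simpa [wordSlope, ones], by simpa [wordSlope, ones],
      Nat.zero_le _⟩
  | succ N ih =>
    obtain ⟨u, v, h, hu, hv, hN⟩ := ih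
    have hl := h.length_pos
    have hne : γ ≠ wordSlope (u ++ v) := by
      have := hγ.ne_rat ((ones (u ++ v) : ℚ) / (u ++ v).length)
      intro he
      apply this
      rw [he]
      simp [wordSlope]
    rcases lt_or_gt_of_ne hne with hlt | hgt
    · exact ⟨u, v ++ u, h.right, hu, by rwa [← wordSlope_append_comm],
        by rw [List.length_append]; omega⟩
    · exact ⟨u ++ v, v, h.left, hgt, hv, by rw [List.length_append]; omega⟩

/-- An enclosing pair satisfies |u| (γ − ς(u)) < 1/|v|, and symmetrically. A short word would
therefore approximate γ better than the finitely many small denominators allow. -/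
theorem exists_standardPair_around_long {γ : ℝ} (hγ : Irrational γ) (h0 : 0 < γ) (h1 : γ < 1)
    (N : ℕ) : ∃ u v, IsStandardPair u v ∧ wordSlope u < γ ∧ γ < wordSlope v ∧
      N ≤ u.length ∧ N ≤ v.length := by
  obtain ⟨δ, hδ, H⟩ := exists_dist_lower_bound hγ N
  obtain ⟨Q, hQ⟩ := exists_nat_gt (1 / δ)
  obtain ⟨u, v, h, hu, hv, hN⟩ := exists_standardPair_around hγ h0 h1 (N + Q)
  have hl := h.length_pos
  have huR : (0 : ℝ) < u.length := by exact_mod_cast hl.1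
  have hvR : (0 : ℝ) < v.length := by exact_mod_cast hl.2
  have hs := wordSlope_eq_add h
  have hsmall : ∀ n : ℕ, Q ≤ n → 1 / (n : ℝ) < δ := fun n hn => by
    have hQn : (Q : ℝ) ≤ n := by exact_mod_cast hn
    have : 0 < 1 / δ := by positivity
    rw [one_div_lt (by linarith) hδ]
    linarith
  have hones : ∀ w : Word, (0 : ℝ) < w.length → (ones w : ℝ) = w.length * wordSlope w := by
    intro w hw
    unfold wordSlope
    field_simp
  refine ⟨u, v, h, hu, hv, ?_, ?_⟩
  · by_contra hlt
    have e1 := H u.length hl.1 (not_le.1 hlt) (ones u)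
    have e2 := hsmall v.length (by omega)
    rw [hones u huR, ← mul_sub, abs_of_pos (by apply mul_pos huR; linarith)] at e1
    have e3 : (u.length : ℝ) * (γ - wordSlope u) ≤ u.length * (1 / (u.length * v.length)) :=
      mul_le_mul_of_nonneg_left (by linarith) huR.le
    have e4 : (u.length : ℝ) * (1 / (u.length * v.length)) = 1 / v.length := by field_simp
    linarith
  · by_contra hlt
    have e1 := H v.length hl.2 (not_le.1 hlt) (ones v)
    have e2 := hsmall u.length (by omega)
    rw [hones v hvR, ← mul_sub, abs_mul, abs_of_pos hvR, abs_sub_comm,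
      abs_of_pos (by linarith)] at e1
    have e3 : (v.length : ℝ) * (wordSlope v - γ) ≤ v.length * (1 / (u.length * v.length)) :=
      mul_le_mul_of_nonneg_left (by linarith) hvR.le
    have e4 : (v.length : ℝ) * (1 / (u.length * v.length)) = 1 / u.length := by field_simp
    linarith

theorem slopeInside_of_mem {L : ℕ} (hL : 0 < L) {u : Word} (hu : 0 < u.length)
    (h0 : 1 / (L : ℝ) ≤ wordSlope u) (h1 : wordSlope u ≤ 1 - 1 / (L : ℝ)) : SlopeInside L u := by
  have hLR : (0 : ℝ) < L := by exact_mod_cast hL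
  have huR : (0 : ℝ) < u.length := by exact_mod_cast hu
  unfold wordSlope at *
  rw [div_le_div_iff₀ hLR huR] at h0
  rw [div_le_iff₀ huR] at h1
  constructor
  · have : (u.length : ℝ) ≤ ones u * L := by linarith
    exact_mod_cast this
  · have : (u.length : ℝ) + ones u * L ≤ u.length * L := by
      have h2 := mul_le_mul_of_nonneg_right h1 hLR.le
      have h3 : (1 - 1 / (L : ℝ)) * u.length * L = u.length * L - u.length := by
        field_simp
      linarith
    exact_mod_cast this

/-- With ρ a 6L-th root of 1/τ, half of ρ^(6(m + n)) absorbs the linear factor and half remains for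
summation; each rounded-down quotient costs one factor τ. -/
theorem exists_decay_constants {τ : ℝ} (hτ : 1 < τ) {L : ℕ} (hL : 0 < L) :
    ∃ ρ C : ℝ, 0 < ρ ∧ ρ < 1 ∧ 0 ≤ C ∧ ∀ m n k : ℕ, k ≤ 3 * (m + n) →
      ((m : ℝ) + n) * ((1 / τ ^ (m / L)) * (1 / τ ^ (n / L))) ≤ C * ρ ^ k := by
  have hτ0 : 0 < τ := by linarith
  set ρ : ℝ := (1 / τ) ^ (((6 * L : ℕ) : ℝ)⁻¹) with hρ
  have hinv : 1 / τ < 1 := by rw [div_lt_one hτ0]; exact hτ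
  have hρ0 : 0 < ρ := by positivity
  have hρ1 : ρ < 1 := Real.rpow_lt_one (by positivity) hinv (by positivity)
  have hρL : ρ ^ (6 * L) = 1 / τ := Real.rpow_inv_natCast_pow (by positivity) (by omega)
  have hρ31 : ρ ^ 3 < 1 := pow_lt_one₀ hρ0.le hρ1 (by norm_num)
  obtain ⟨K, hK⟩ := (tendsto_self_mul_const_pow_of_lt_one (by positivity) hρ31).bddAbove_range
  have hK' : ∀ n : ℕ, (n : ℝ) * (ρ ^ 3) ^ n ≤ K := fun n => hK ⟨n, rfl⟩
  have hK0 : 0 ≤ K := by simpa using hK' 0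
  have hone : ∀ n : ℕ, 1 / τ ^ (n / L) ≤ τ * ρ ^ (6 * n) := by
    intro n
    have e1 : 1 / τ ^ (n / L) = ρ ^ (6 * L * (n / L)) := by
      rw [pow_mul, hρL, one_div_pow]
    have e2 : τ * ρ ^ (6 * n) = τ * ρ ^ (6 * L) * (ρ ^ (6 * n) / ρ ^ (6 * L)) := by
      field_simp
    rw [e2, hρL, mul_one_div_cancel hτ0.ne', one_mul, le_div_iff₀ (by rw [← hρL]; positivity),
      ← hρL, e1, ← pow_add]
    apply pow_le_pow_of_le_one hρ0.le hρ1.le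
    have := Nat.div_add_mod n L
    have := Nat.mod_lt n hL
    nlinarith
  refine ⟨ρ, K * τ ^ 2, hρ0, hρ1, by positivity, fun m n k hk => ?_⟩
  calc ((m : ℝ) + n) * ((1 / τ ^ (m / L)) * (1 / τ ^ (n / L)))
      ≤ ((m : ℝ) + n) * ((τ * ρ ^ (6 * m)) * (τ * ρ ^ (6 * n))) := by
        refine mul_le_mul_of_nonneg_left ?_ (by positivity)
        exact mul_le_mul (hone m) (hone n) (by positivity) (by positivity)
    _ = (((m + n : ℕ) : ℝ) * (ρ ^ 3) ^ (m + n)) * τ ^ 2 * ρ ^ (3 * (m + n)) := by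
        push_cast; ring
    _ ≤ K * τ ^ 2 * ρ ^ k := by
        refine mul_le_mul (mul_le_mul_of_nonneg_right (hK' _) (by positivity))
          (pow_le_pow_of_le_one hρ0.le hρ1.le hk) (by positivity) (by positivity)

namespace IsOneRatioFunction

variable {A : Fin 2 → Mat2} {r : ℝ → ℝ}

theorem dimH_preimage_inside (hr : IsOneRatioFunction A r) (hA : TechnicalHypotheses A) {L : ℕ}
    (hL : 0 < L) :
    dimH (preimageOf r {γ | Irrational γ ∧ 1 / (L : ℝ) < γ ∧ γ < 1 - 1 / (L : ℝ)}) = 0 := by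
  have hLR : (0 : ℝ) < L := by exact_mod_cast hL
  obtain ⟨τ, hτ, hdec⟩ := exists_rate_eigMin hA L
  obtain ⟨ρ, C, hρ0, hρ1, hC0, hρC⟩ := exists_decay_constants hτ hL
  have hτ0 : 0 < τ := by linarith
  obtain ⟨M, hM⟩ := hr.exists_bound hA (γ := 1 - 1 / (L : ℝ)) (by
    have : 0 < 1 / (L : ℝ) := by positivity
    linarith)
  obtain ⟨K, hK⟩ : ∃ K, K = 8 * |fricke (A 0) (A 1) / ((A 0).det * (A 1).det)| := ⟨_, rfl⟩
  have hK0 : 0 ≤ K := by rw [hK]; positivity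
  -- A factor 4 turns τ ^ (m / L) · |x| ≤ 2y into the 2|x| ≤ y required by `gap_le`.
  obtain ⟨k₀, hk₀⟩ := pow_unbounded_of_one_lt 4 hτ
  -- The four counts determine both slopes, hence the gap; the cap on the slope of v keeps its
  -- endpoint below the common bound M.
  let Good : ℕ → ℕ × ℕ × ℕ × ℕ → Word → Word → Prop := fun n i u v =>
    IsStandardPair u v ∧ SlopeInside L u ∧ SlopeInside L v ∧ wordSlope v ≤ 1 - 1 / (L : ℝ) ∧
      n ≤ u.length ∧ n ≤ v.length ∧ i = (ones u, u.length, ones v, v.length)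
  let t : ℕ → ℕ × ℕ × ℕ × ℕ → Set ℝ := fun n i =>
    {α | 0 ≤ α ∧ ∃ u v, Good n i u v ∧ wordSlope u < r α ∧ r α < wordSlope v}
  refine dimH_eq_zero_of_geometric_covers (C := ENNReal.ofReal (|M| * (4 * K * C)))
    (ρ := ENNReal.ofReal ρ) ENNReal.ofReal_ne_top (by simpa using hρ1) t ?_ ?_
  · filter_upwards [eventually_ge_atTop (L * k₀)] with n hn i
    rw [← ENNReal.ofReal_pow hρ0.le, ← ENNReal.ofReal_mul (by positivity)]
    apply Metric.ediam_le_of_forall_dist_le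
    rintro α ⟨hα0, u, v, ⟨h, hsu, hsv, hsl, hnu, hnv, hi⟩, hαu, hαv⟩ β
      ⟨hβ0, u', v', ⟨-, -, -, -, -, -, hi'⟩, hβu, hβv⟩
    have hslopes : wordSlope u' = wordSlope u ∧ wordSlope v' = wordSlope v := by
      rw [hi] at hi'
      simp only [Prod.mk.injEq] at hi'
      unfold wordSlope
      rw [hi'.1, hi'.2.1, hi'.2.2.1, hi'.2.2.2]
      exact ⟨rfl, rfl⟩
    rw [hslopes.1] at hβu
    rw [hslopes.2] at hβv
    obtain ⟨hdu, hmu⟩ := (hdec u v h).1 hsu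
    obtain ⟨hdv, hmv⟩ := (hdec u v h).2 hsv
    have hfour : ∀ m, n ≤ m → 4 ≤ τ ^ (m / L) := fun m hm =>
      hk₀.le.trans (pow_le_pow_right₀ hτ.le
        ((Nat.le_div_iff_mul_le hL).2 (by rw [mul_comm]; exact hn.trans hm)))
    have htwo : ∀ (m : ℕ) (x y : ℝ), n ≤ m → τ ^ (m / L) * |x| ≤ 2 * y → 2 * |x| ≤ y := by
      intro m x y hm hxy
      have := mul_le_mul_of_nonneg_right (hfour m hm) (abs_nonneg x)
      linarith
    obtain ⟨a, b, ⟨hb0, hb⟩, ⟨ha0, ha⟩, hab⟩ :=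
      hr.gap_le hA h hdu hdv (htwo _ _ _ hnu hmu) (htwo _ _ _ hnv hmv)
    rw [← hK] at hab
    have hb : r b = wordSlope u := hb
    have ha : r a = wordSlope v := ha
    have hlo : ∀ x, 0 ≤ x → wordSlope u < r x → b ≤ x := fun x hx hlt => by
      by_contra hbx
      have := hr.monotoneOn hA hx hb0 (not_le.1 hbx).le
      linarith
    have hhi : ∀ x, 0 ≤ x → r x < wordSlope v → x ≤ a := fun x hx hlt => by
      by_contra hbx
      have := hr.monotoneOn hA ha0 hx (not_le.1 hbx).le
      linarith
    have haM : a ≤ |M| := (hM a ha0 (by rw [ha]; exact hsl)).trans (le_abs_self M)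
    have hratio : ∀ (m : ℕ) (x y : ℝ), 0 < y → τ ^ (m / L) * |x| ≤ 2 * y →
        |x| / y ≤ 2 * (1 / τ ^ (m / L)) := by
      intro m x y hy hxy
      rw [div_le_iff₀ hy, mul_one_div, div_mul_eq_mul_div, le_div_iff₀ (by positivity), mul_comm]
      exact hxy
    have hl1 := specRad_word_pos hA (trace_left_pos hA h)
    have hl2 := specRad_word_pos hA (trace_right_pos hA h)
    rw [specRad_eq (entriesNonneg_word hA _)] at hl1 hl2
    have hk : n + (i.1 + i.2.1 + i.2.2.1 + i.2.2.2) ≤ 3 * (u.length + v.length) := by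
      rw [hi]
      have := ones_le_length u
      have := ones_le_length v
      simp only
      omega
    have hmain : a - b ≤ |M| * (4 * K * C) * ρ ^ (n + (i.1 + i.2.1 + i.2.2.1 + i.2.2.2)) := by
      refine hab.trans ?_
      have h1 := hρC u.length v.length _ hk
      have h2 := mul_le_mul (hratio _ _ _ hl1 hmu) (hratio _ _ _ hl2 hmv) (by positivity)
        (by positivity)
      calc _ = a * (K * ((u.length + v.length) * (|eigMin (wordProd A u)| / eigMax (wordProd A u) *
              (|eigMin (wordProd A v)| / eigMax (wordProd A v))))) := by ring
        _ ≤ |M| * (K * ((u.length + v.length) * (2 * (1 / τ ^ (u.length / L)) *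
              (2 * (1 / τ ^ (v.length / L)))))) := by gcongr
        _ = |M| * (4 * K) * ((u.length + v.length) *
              ((1 / τ ^ (u.length / L)) * (1 / τ ^ (v.length / L)))) := by ring
        _ ≤ |M| * (4 * K) * (C * ρ ^ (n + (i.1 + i.2.1 + i.2.2.1 + i.2.2.2))) := by gcongr
        _ = _ := by ring
    rw [Real.dist_eq, abs_le]
    have := hlo α hα0 hαu
    have := hhi α hα0 hαv
    have := hlo β hβ0 hβu
    have := hhi β hβ0 hβv
    constructor <;> linarith
  · refine Eventually.of_forall fun n => ?_
    rintro α ⟨hα0, hirr, hlow, hhigh⟩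
    have hL' : 0 < 1 / (L : ℝ) := by positivity
    -- Length N makes the slope difference 1/(|u||v|) smaller than the margin, so both slopes stay
    -- in [1/L, 1 − 1/L].
    obtain ⟨N, hN⟩ := exists_nat_gt (1 / min (r α - 1 / L) (1 - 1 / L - r α))
    have hmin : 0 < min (r α - 1 / L) (1 - 1 / L - r α) := lt_min (by linarith) (by linarith)
    obtain ⟨u, v, h, hu, hv, hnu, hnv⟩ := exists_standardPair_around_long hirr
      (by linarith) (by linarith) (n + N)
    have hl := h.length_pos
    have huR : (1 : ℝ) ≤ u.length := by exact_mod_cast hl.1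
    have hvR : (N : ℝ) ≤ v.length := by exact_mod_cast (by omega : N ≤ v.length)
    have hgap : 1 / ((u.length : ℝ) * v.length) < min (r α - 1 / L) (1 - 1 / L - r α) := by
      have h0 : 0 < 1 / min (r α - 1 / L) (1 - 1 / L - r α) := by positivity
      rw [one_div_lt (by nlinarith) hmin]
      nlinarith
    have hs := wordSlope_eq_add h
    have h1 := hgap.trans_le (min_le_left _ _)
    have h2 := hgap.trans_le (min_le_right _ _)
    have hsl : wordSlope v ≤ 1 - 1 / (L : ℝ) := by linarith
    rw [Set.mem_iUnion]
    refine ⟨(ones u, u.length, ones v, v.length), hα0, u, v, ⟨h, ?_, ?_, hsl, by omega, by omega,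
      rfl⟩, hu, hv⟩
    · exact slopeInside_of_mem hL hl.1 (by linarith) (by linarith)
    · exact slopeInside_of_mem hL hl.2 (by linarith) hsl

theorem dimH_preimage_irrational (hr : IsOneRatioFunction A r) (hA : TechnicalHypotheses A) :
    dimH (preimageOf r (Set.Ico (0 : ℝ) 1 \ Set.range ((↑) : ℚ → ℝ))) = 0 := by
  have hsub : preimageOf r (Set.Ico (0 : ℝ) 1 \ Set.range ((↑) : ℚ → ℝ)) ⊆
      ⋃ L : ℕ, preimageOf r {γ | Irrational γ ∧ 1 / ((L + 1 : ℕ) : ℝ) < γ ∧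
        γ < 1 - 1 / ((L + 1 : ℕ) : ℝ)} := by
    rintro α ⟨hα0, ⟨h0, h1⟩, hirr⟩
    have hirr : Irrational (r α) := hirr
    have hpos : 0 < r α := h0.lt_of_ne' hirr.ne_zero
    obtain ⟨L, hL⟩ := exists_nat_one_div_lt (lt_min hpos (sub_pos.2 h1))
    rw [Set.mem_iUnion]
    refine ⟨L, hα0, hirr, ?_, ?_⟩
    · push_cast; exact hL.trans_le (min_le_left _ _)
    · push_cast
      have := hL.trans_le (min_le_right _ _)
      linarith
  refine le_antisymm ((dimH_mono hsub).trans ?_) (zero_le)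
  rw [dimH_iUnion]
  exact iSup_le fun L => (hr.dimH_preimage_inside hA (Nat.succ_pos L)).le

/-- Two distinct preimages would, by monotonicity, bound an interval of preimages, which has
dimension one rather than zero. -/
theorem preimage_irrational (hr : IsOneRatioFunction A r) (hA : TechnicalHypotheses A) {γ : ℝ}
    (h0 : 0 < γ) (h1 : γ < 1) (hγ : Irrational γ) : ∃ α : ℝ, preimageOf r {γ} = {α} := by
  obtain ⟨α, hα0, hα⟩ := hr.exists_eq hA h0.le h1
  have hno : ∀ a b, 0 ≤ a → r a = γ → r b = γ → ¬ a < b := by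
    intro a b ha0 ha hb hab
    have hsub : Set.Icc a b ⊆
        preimageOf r (Set.Ico (0 : ℝ) 1 \ Set.range ((↑) : ℚ → ℝ)) := by
      rintro x ⟨hx1, hx2⟩
      have hx0 := ha0.trans hx1
      have hx : r x = γ := le_antisymm (hb ▸ hr.monotoneOn hA hx0 (ha0.trans hab.le) hx2)
        (ha ▸ hr.monotoneOn hA ha0 hx0 hx1)
      refine ⟨hx0, ?_, ?_⟩
      · rw [hx]; exact ⟨h0.le, h1⟩
      · rw [hx]; exact hγ
    have hdim := dimH_mono hsub
    rw [hr.dimH_preimage_irrational hA,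
      Real.dimH_of_nonempty_interior (by rw [interior_Icc]; exact Set.nonempty_Ioo.2 hab)] at hdim
    simp at hdim
  refine ⟨α, Set.eq_singleton_iff_unique_mem.2 ⟨⟨hα0, hα⟩, ?_⟩⟩
  rintro β ⟨hβ0, hβ⟩
  exact le_antisymm (not_lt.1 (hno α β hα0 hα hβ)) (not_lt.1 (hno β α hβ0 hβ hα))

end IsOneRatioFunction

end SturmianPair

/-! ### The theorem -/

open SturmianPair
theorem theorem2p3 (A : Fin 2 → Mat2) (hA : TechnicalHypotheses A)
    (r : ℝ → ℝ) (hr : IsOneRatioFunction A r) :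
    -- (i)
    (ContinuousOn r (Set.Ici 0) ∧ MonotoneOn r (Set.Ici 0) ∧ r 0 = 0 ∧
      Tendsto r atTop (𝓝 1)) ∧
    -- (ii), preimages of rational points of (0, 1) are nondegenerate closed intervals
    (∀ γ : ℚ, 0 < γ → γ < 1 → ∃ a b : ℝ, a < b ∧ preimageOf r {(γ : ℝ)} = Set.Icc a b) ∧
    -- (ii), the endpoints 0 and 1
    ((preimageOf r {0} ∩ Set.Ioi 0).Nonempty ↔ Diagonalisable (A 0)) ∧
    ((preimageOf r {1}).Nonempty ↔ Diagonalisable (A 1)) ∧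
    (Diagonalisable (A 0) → ∃ P₀ : Mat2, IsPowerLimit (A 0) P₀ ∧
      preimageOf r {0} = Set.Icc 0 (specRad (A 0) / specRad (P₀ * A 1))) ∧
    (Diagonalisable (A 1) → ∃ P₁ : Mat2, IsPowerLimit (A 1) P₁ ∧
      preimageOf r {1} = Set.Ici (specRad (P₁ * A 0) / specRad (A 1))) ∧
    -- (ii), explicit formulae at p / q
    (∀ p q : ℕ, 0 < p → p < q → p.Coprime q →
      (∃ u v : Word, IsStandardPair u v ∧ wordSlope (u ++ v) = (p : ℝ) / q) ∧
      ∀ u v : Word, IsStandardPair u v → wordSlope (u ++ v) = (p : ℝ) / q →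
        (∀ i j, 0 < (wordProd A u * wordProd A v) i j) ∧
        ∃ P : Mat2, IsPowerLimit (wordProd A u * wordProd A v) P ∧
          preimageOf r {(p : ℝ) / q} = Set.Icc
            (specRad (wordProd A u * P) ^ q /
              specRad (wordProd A u * wordProd A v) ^ u.length)
            (specRad (wordProd A u * wordProd A v) ^ v.length /
              specRad (P * wordProd A v) ^ q) ∧
          ∀ α ∈ preimageOf r {(p : ℝ) / q},
            jsr (scaled A α) = specRad (wordProd (scaled A α) (u ++ v)) ^ ((1 : ℝ) / q)) ∧
    -- (iii)
    dimH (preimageOf r (Set.Ico (0 : ℝ) 1 \ Set.range ((↑) : ℚ → ℝ))) = 0 ∧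
    (∀ γ : ℝ, 0 < γ → γ < 1 → Irrational γ → ∃ α : ℝ, preimageOf r {γ} = {α}) := by

  refine ⟨⟨hr.continuousOn hA, hr.monotoneOn hA, hr.map_zero hA, hr.tendsto_atTop hA⟩, ?_,
    hr.preimage_zero_nonempty_iff hA, hr.preimage_one_nonempty_iff hA, ?_, hr.preimage_one hA, ?_,
    hr.dimH_preimage_irrational hA, fun γ h0 h1 hγ => hr.preimage_irrational hA h0 h1 hγ⟩
  · intro γ h0 h1
    have hnum : 0 < γ.num := Rat.num_pos.2 h0
    have hn : ((γ.num.toNat : ℕ) : ℤ) = γ.num := Int.toNat_of_nonneg hnum.le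
    have habs : γ.num.natAbs = γ.num.toNat := by omega
    have hc : γ.num.toNat.Coprime γ.den := habs ▸ γ.reduced
    have hlt : γ.num.toNat < γ.den := by
      have := Rat.lt_iff γ 1 |>.1 h1
      simp at this
      omega
    obtain ⟨u, v, h, h2, h3⟩ := exists_isStandardPair (by omega) hlt hc
    obtain ⟨-, P, -, hab, hpre⟩ := hr.preimage_standardPair hA h
    have hs : wordSlope (u ++ v) = (γ : ℝ) := by
      unfold wordSlope
      rw [h2, h3, Rat.cast_def]
      congr 1
      exact_mod_cast congrArg (Int.cast (R := ℝ)) hn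
    exact ⟨_, _, hab, hs ▸ hpre⟩
  · intro hD
    obtain ⟨P, hP, -, h⟩ := hr.preimage_zero hA hD
    exact ⟨P, hP, h⟩
  · intro p q hp hpq hc
    have hq : 0 < q := hp.trans hpq
    constructor
    · obtain ⟨u, v, h, h2, h3⟩ := exists_isStandardPair hp hpq hc
      exact ⟨u, v, h, by unfold wordSlope; rw [h2, h3]⟩
    · intro u v h hs
      obtain ⟨-, hlen⟩ := length_and_ones_of_wordSlope h hq hc hs
      obtain ⟨hpos, P, hP, -, hpre⟩ := hr.preimage_standardPair hA h
      rw [hs, hlen] at hpre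
      refine ⟨hpos, P, hP, hpre, ?_⟩
      rintro α ⟨hα0, hα⟩
      have hα : r α = p / q := hα
      have h1 := hr.jsr_eq_specRad hA h hα0 (by rw [hα, hs])
      rw [← specRad_scaled hA hα0, hlen] at h1
      rw [h1, one_div, Real.pow_rpow_inv_natCast (jsr_pos hA α).le hq.ne']
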